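/- Let $K$ be an algebraically closed field. Let $Q_A$ and $Q_B$ be finite quivers, let $I_A\subseteq KQ_A$ and $I_B\subseteq KQ_B$ be admissible (two-sided) ideals of the path algebras (i.e. $R^m\subseteq I\subseteq R^2$ for some $m\ge 2$, where $R$ is the ideal generated by the arrows), and let $A=KQ_A/I_A$ and $B=KQ_B/I_B$ be the corresponding finite-dimensional bound quiver algebras. Let $a$ be a vertex of $Q_A$ and $b$ a vertex of $Q_B$, let $Q$ be the quiver obtained from the disjoint union of $Q_A$ and $Q_B$ by identifying $a$ with $b$, and let $I$ be the two-sided ideal of $KQ$ generated by the images of $I_A$ and $I_B$. Assume that $\Lambda=KQ/I$ is finite-dimensional over $K$; it is then called a simple gluing algebra of $A$ and $B$. For a finite-dimensional $K$-algebra $R$, a finitely generated left $R$-module $M$ is called Gorenstein projective if $M\cong\ker d^0$ for some acyclic complex $(P^\bullet,d^\bullet)$, indexed by $\mathbb Z$, of finitely generated projective left $R$-modules such that the complex $\mathrm{Hom}_R(P^\bullet,R)$ is also acyclic. The algebra $R$ is called CM-free if its finitely generated Gorenstein projective modules are exactly its finitely generated projective modules, and CM-finite if there are only finitely many isomorphism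 classes of indecomposable finitely generated Gorenstein projective $R$-modules. Then: (i) $\Lambda$ is CM-free if and only if both $A$ and $B$ are CM-free; (ii) $\Lambda$ is CM-finite if and only if both $A$ and $B$ are CM-finite. -/

import Mathlib

/-! ## Path algebras of quivers -/

/-- The set of all paths of a quiver (including the trivial paths `Quiver.Path.nil`);
an element is `⟨source, target, path⟩`. -/
abbrev QuiverPath (V : Type*) [Quiver V] : Type _ :=
  Σ i j : V, Quiver.Path i j

/-- The path algebra `KQ`: the `K`-vector space with basis the set of all paths of `Q`. -/
def PathAlgebra (K V : Type*) [Field K] [Quiver V] : Type _ :=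
  QuiverPath V →₀ K

namespace PathAlgebra

variable (K : Type*) {V : Type*} [Field K] [Quiver V]

noncomputable instance : AddCommGroup (PathAlgebra K V) :=
  inferInstanceAs (AddCommGroup (QuiverPath V →₀ K))

noncomputable instance : Module K (PathAlgebra K V) :=
  inferInstanceAs (Module K (QuiverPath V →₀ K))

/-- The basis element of the path algebra given by a path. -/
noncomputable def ofPath {i j : V} (p : Quiver.Path i j) : PathAlgebra K V :=
  Finsupp.single (⟨i, j, p⟩ : QuiverPath V) (1 : K)

open Classical in
/-- The product `q * p` of two paths: the path "first `p`, then `q`" if `p` ends where `q` starts,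
and `0` otherwise. With this convention left modules over the path algebra are (covariant)
representations of the quiver. -/
noncomputable def pathMul (q p : QuiverPath V) : PathAlgebra K V :=
  if h : q.1 = p.2.1 then ofPath K (p.2.2.comp (q.2.2.cast h rfl)) else 0

/-- The linear map out of the path algebra with prescribed values on paths. -/
noncomputable def lift {M : Type*} [AddCommGroup M] [Module K M] (f : QuiverPath V → M) :
    PathAlgebra K V →ₗ[K] M :=
  (Finsupp.linearCombination K f : (QuiverPath V →₀ K) →ₗ[K] M)

theorem lift_ofPath {M : Type*} [AddCommGroup M] [Module K M] (f : QuiverPath V → M) {i j : V}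
    (p : Quiver.Path i j) : lift K f (ofPath K p) = f ⟨i, j, p⟩ :=
  (Finsupp.linearCombination_single K (1 : K) (⟨i, j, p⟩ : QuiverPath V)).trans (one_smul K _)

/-- The bilinear extension of the product of paths. -/
noncomputable def mulBilin :
    PathAlgebra K V →ₗ[K] PathAlgebra K V →ₗ[K] PathAlgebra K V :=
  lift K fun q => lift K fun p => pathMul K q p

noncomputable instance : Mul (PathAlgebra K V) := ⟨fun x y => mulBilin K x y⟩

/-- The identity of the path algebra of a finite quiver: the sum of all trivial paths. -/
noncomputable instance : One (PathAlgebra K V) :=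
  ⟨∑ᶠ i : V, ofPath K (Quiver.Path.nil : Quiver.Path i i)⟩

variable {K}

theorem mul_def (x y : PathAlgebra K V) : x * y = mulBilin K x y := rfl

theorem one_def : (1 : PathAlgebra K V) =
    ∑ᶠ i : V, ofPath K (Quiver.Path.nil : Quiver.Path i i) := rfl

theorem mulBilin_ofPath {i j k l : V} (q : Quiver.Path k l) (p : Quiver.Path i j) :
    mulBilin K (ofPath K q) (ofPath K p) = pathMul K ⟨k, l, q⟩ ⟨i, j, p⟩ := by
  rw [mulBilin, lift_ofPath, lift_ofPath]

theorem ofPath_mul_ofPath {i j k : V} (q : Quiver.Path j k) (p : Quiver.Path i j) :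
    ofPath K q * ofPath K p = ofPath K (p.comp q) := by
  rw [mul_def, mulBilin_ofPath]
  simp [pathMul]

theorem ofPath_mul_ofPath_of_ne {i j k l : V} (q : Quiver.Path k l) (p : Quiver.Path i j)
    (h : k ≠ j) : ofPath K q * ofPath K p = 0 := by
  rw [mul_def, mulBilin_ofPath]
  simp [pathMul, h]

theorem induction_on {motive : PathAlgebra K V → Prop} (x : PathAlgebra K V)
    (zero : motive 0) (add : ∀ x y, motive x → motive y → motive (x + y))
    (smul_ofPath : ∀ (c : K) {i j : V} (p : Quiver.Path i j), motive (c • ofPath K p)) :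
    motive x := by
  refine Finsupp.induction_linear (motive := motive) x zero add ?_
  rintro ⟨i, j, p⟩ c
  have h := smul_ofPath c p
  have e : c • ofPath K p = (Finsupp.single (⟨i, j, p⟩ : QuiverPath V) c : QuiverPath V →₀ K) := by
    refine (Finsupp.smul_single (M := K) c (⟨i, j, p⟩ : QuiverPath V) (1 : K)).trans ?_
    rw [smul_eq_mul, mul_one]
  rwa [e] at h

theorem ofPath_assoc {i j k l m n : V} (r : Quiver.Path m n) (q : Quiver.Path k l)
    (p : Quiver.Path i j) :
    ofPath K r * ofPath K q * ofPath K p = ofPath K r * (ofPath K q * ofPath K p) := by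
  by_cases h₁ : m = l
  · subst h₁
    by_cases h₂ : k = j
    · subst h₂
      simp only [ofPath_mul_ofPath, Quiver.Path.comp_assoc]
    · rw [ofPath_mul_ofPath, ofPath_mul_ofPath_of_ne _ _ h₂, ofPath_mul_ofPath_of_ne _ _ h₂]
      exact (map_zero (mulBilin K (ofPath K r))).symm
  · rw [ofPath_mul_ofPath_of_ne _ _ h₁]
    have h0 : (0 : PathAlgebra K V) * ofPath K p = 0 := by
      rw [mul_def, map_zero, LinearMap.zero_apply]
    rw [h0]
    by_cases h₂ : k = j
    · subst h₂
      rw [ofPath_mul_ofPath, ofPath_mul_ofPath_of_ne _ _ h₁]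
    · rw [ofPath_mul_ofPath_of_ne _ _ h₂]
      exact (map_zero (mulBilin K (ofPath K r))).symm

noncomputable instance : NonUnitalRing (PathAlgebra K V) where
  left_distrib x y z := map_add (mulBilin K x) y z
  right_distrib x y z := by simp only [mul_def, map_add, LinearMap.add_apply]
  zero_mul x := by simp only [mul_def, map_zero, LinearMap.zero_apply]
  mul_zero x := map_zero (mulBilin K x)
  mul_assoc x y z := by
    simp only [mul_def]
    induction x using induction_on with
    | zero => simp only [map_zero, LinearMap.zero_apply]
    | add x₁ x₂ h₁ h₂ => simp only [map_add, LinearMap.add_apply, h₁, h₂]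
    | smul_ofPath c r =>
      induction y using induction_on with
      | zero => simp only [map_zero, LinearMap.zero_apply]
      | add y₁ y₂ h₁ h₂ => simp only [map_add, LinearMap.add_apply, h₁, h₂]
      | smul_ofPath d q =>
        induction z using induction_on with
        | zero => simp only [map_zero]
        | add z₁ z₂ h₁ h₂ => simp only [map_add, h₁, h₂]
        | smul_ofPath e p =>
          simp only [map_smul, LinearMap.smul_apply]
          have h := ofPath_assoc (K := K) r q p
          simp only [mul_def] at h
          rw [h]

theorem smul_mul' (c : K) (x y : PathAlgebra K V) : c • x * y = c • (x * y) := by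
  simp only [mul_def, map_smul, LinearMap.smul_apply]

theorem mul_smul' (c : K) (x y : PathAlgebra K V) : x * c • y = c • (x * y) := by
  simp only [mul_def, map_smul]

theorem one_mul_aux [Finite V] (x : PathAlgebra K V) : 1 * x = x := by
  have := Fintype.ofFinite V
  rw [one_def, finsum_eq_sum_of_fintype, Finset.sum_mul]
  induction x using induction_on with
  | zero => simp
  | add x y hx hy => simp only [mul_add, Finset.sum_add_distrib, hx, hy]
  | @smul_ofPath c i j p =>
    simp only [mul_smul', ← Finset.smul_sum]
    rw [Finset.sum_eq_single j (fun k _ hk => ofPath_mul_ofPath_of_ne _ _ hk) (by simp),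
      ofPath_mul_ofPath, Quiver.Path.comp_nil]

theorem mul_one_aux [Finite V] (x : PathAlgebra K V) : x * 1 = x := by
  have := Fintype.ofFinite V
  rw [one_def, finsum_eq_sum_of_fintype, Finset.mul_sum]
  induction x using induction_on with
  | zero => simp
  | add x y hx hy => simp only [add_mul, Finset.sum_add_distrib, hx, hy]
  | @smul_ofPath c i j p =>
    simp only [smul_mul', ← Finset.smul_sum]
    rw [Finset.sum_eq_single i (fun k _ hk => ofPath_mul_ofPath_of_ne _ _ hk.symm) (by simp),
      ofPath_mul_ofPath, Quiver.Path.nil_comp]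

noncomputable instance [Finite V] : Ring (PathAlgebra K V) :=
  { (inferInstance : NonUnitalRing (PathAlgebra K V)) with
    one := 1
    one_mul := one_mul_aux
    mul_one := mul_one_aux }

noncomputable instance [Finite V] : Algebra K (PathAlgebra K V) :=
  Algebra.ofModule smul_mul' mul_smul'

variable (K V)

/-- The power `R ^ n` of the arrow ideal `R` of the path algebra: it is the subspace with basis
the paths of length at least `n`. -/
noncomputable def arrowIdealPow (n : ℕ) : Submodule K (PathAlgebra K V) :=
  Submodule.span K {x | ∃ (i j : V) (p : Quiver.Path i j), n ≤ p.length ∧ x = ofPath K p}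

variable {K V}

/-- A two-sided ideal `I` of the path algebra is admissible if `R ^ m ⊆ I ⊆ R ^ 2` for some
`m ≥ 2`, where `R` is the arrow ideal. -/
def IsAdmissible [Finite V] (I : TwoSidedIdeal (PathAlgebra K V)) : Prop :=
  (∃ m ≥ 2, ∀ x ∈ arrowIdealPow K V m, x ∈ I) ∧ ∀ x ∈ I, x ∈ arrowIdealPow K V 2

end PathAlgebra

/-- The quotient algebra `KQ/I`. -/
abbrev BoundQuiverAlgebra {K V : Type*} [Field K] [Quiver V] [Finite V]
    (I : TwoSidedIdeal (PathAlgebra K V)) : Type _ :=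
  PathAlgebra K V ⧸ TwoSidedIdeal.asIdeal I

/-! ## Gluing two quivers at a vertex -/

section Glue

universe v₁ v₂ w₁ w₂

variable {VA : Type v₁} {VB : Type v₂}

/-- The vertices of the simple gluing quiver: the disjoint union of the vertices of `Q_A` and of
`Q_B`, with `a` and `b` identified. -/
def GluedVertex (a : VA) (b : VB) : Type (max v₁ v₂) :=
  Quot fun x y : VA ⊕ VB => x = Sum.inl a ∧ y = Sum.inr b

namespace GluedVertex

variable (a : VA) (b : VB)

/-- The vertex of the glued quiver given by a vertex of `Q_A`. -/
def left (i : VA) : GluedVertex a b := Quot.mk _ (Sum.inl i)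

/-- The vertex of the glued quiver given by a vertex of `Q_B`. -/
def right (j : VB) : GluedVertex a b := Quot.mk _ (Sum.inr j)

instance [Finite VA] [Finite VB] : Finite (GluedVertex a b) :=
  inferInstanceAs (Finite (Quot _))

end GluedVertex

variable [Quiver.{w₁} VA] [Quiver.{w₂} VB]

/-- The arrows of the simple gluing quiver are the arrows of `Q_A` and the arrows of `Q_B`. -/
inductive GluedArrow (a : VA) (b : VB) :
    GluedVertex a b → GluedVertex a b → Type (max v₁ v₂ w₁ w₂)
  | left {i j : VA} (α : i ⟶ j) :
      GluedArrow a b (GluedVertex.left a b i) (GluedVertex.left a b j)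
  | right {i j : VB} (β : i ⟶ j) :
      GluedArrow a b (GluedVertex.right a b i) (GluedVertex.right a b j)

/-- The simple gluing quiver of `Q_A` and `Q_B` at the vertices `a` and `b`. -/
instance GluedVertex.instQuiver (a : VA) (b : VB) : Quiver (GluedVertex a b) where
  Hom := GluedArrow a b

/-- `Q_A` as a subquiver of the simple gluing quiver. -/
def glueLeft (a : VA) (b : VB) : VA ⥤q GluedVertex a b where
  obj := GluedVertex.left a b
  map α := GluedArrow.left α

/-- `Q_B` as a subquiver of the simple gluing quiver. -/
def glueRight (a : VA) (b : VB) : VB ⥤q GluedVertex a b where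
  obj := GluedVertex.right a b
  map β := GluedArrow.right β

end Glue

/-- The linear map between path algebras which sends every path to its image under a morphism
of quivers. -/
noncomputable def PathAlgebra.map (K : Type*) [Field K] {V W : Type*} [Quiver V] [Quiver W]
    (F : V ⥤q W) : PathAlgebra K V →ₗ[K] PathAlgebra K W :=
  PathAlgebra.lift K fun p => PathAlgebra.ofPath K (F.mapPath p.2.2)

/-- The ideal of the path algebra of the simple gluing quiver generated by `I_A` and `I_B`. -/
noncomputable def gluedIdeal {K VA VB : Type*} [Field K] [Quiver VA] [Quiver VB]
    [Finite VA] [Finite VB] (a : VA) (b : VB)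
    (IA : TwoSidedIdeal (PathAlgebra K VA)) (IB : TwoSidedIdeal (PathAlgebra K VB)) :
    TwoSidedIdeal (PathAlgebra K (GluedVertex a b)) :=
  TwoSidedIdeal.span
    (PathAlgebra.map K (glueLeft a b) '' {x | x ∈ IA} ∪
      PathAlgebra.map K (glueRight a b) '' {y | y ∈ IB})

/-- The algebra `Λ = KQ/I` where `Q` is the simple gluing quiver of `Q_A` and `Q_B`, and `I` is
generated by `I_A` and `I_B`. (It is called a simple gluing algebra if it is finite-dimensional.) -/
abbrev SimpleGluingAlgebra {K VA VB : Type*} [Field K] [Quiver VA] [Quiver VB]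
    [Finite VA] [Finite VB] (a : VA) (b : VB)
    (IA : TwoSidedIdeal (PathAlgebra K VA)) (IB : TwoSidedIdeal (PathAlgebra K VB)) : Type _ :=
  BoundQuiverAlgebra (gluedIdeal a b IA IB)

/-! ## Gorenstein projective modules -/

section Gorenstein

universe u v

/-- A totally acyclic complex of finitely generated projective left `R`-modules. -/
structure TotallyAcyclicComplex (R : Type u) [Ring R] where
  /-- The terms of the complex. -/
  X : ℤ → Type u
  [addCommGroup : ∀ i, AddCommGroup (X i)]
  [module : ∀ i, Module R (X i)]
  /-- The differential. -/
  d : ∀ i, X i →ₗ[R] X (i + 1)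
  finite : ∀ i, Module.Finite R (X i)
  projective : ∀ i, Module.Projective R (X i)
  /-- The complex is acyclic. -/
  exact : ∀ i, Function.Exact (d i) (d (i + 1))
  /-- The complex `Hom_R(X, R)` is acyclic. -/
  hom_exact : ∀ i, Function.Exact
    (fun f : X (i + 1 + 1) →ₗ[R] R => f ∘ₗ d (i + 1)) (fun f : X (i + 1) →ₗ[R] R => f ∘ₗ d i)

attribute [instance] TotallyAcyclicComplex.addCommGroup TotallyAcyclicComplex.module

/-- `M` is (finitely generated) Gorenstein projective: it is isomorphic to the kernel of the
differential in degree `0` of a totally acyclic complex. -/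
def IsGorensteinProjective (R : Type u) [Ring R] (M : Type v) [AddCommGroup M] [Module R M] :
    Prop :=
  ∃ P : TotallyAcyclicComplex R, Nonempty (M ≃ₗ[R] LinearMap.ker (P.d 0))

/-- `M` is indecomposable: it is nonzero and not a direct sum of two nonzero submodules. -/
def IsIndecomposableModule (R : Type u) [Ring R] (M : Type v) [AddCommGroup M] [Module R M] :
    Prop :=
  Nontrivial M ∧ ∀ N N' : Submodule R M, IsCompl N N' → N = ⊥ ∨ N' = ⊥

/-- `R` is CM-free: the finitely generated Gorenstein projective modules are exactly the finitely
generated projective modules. -/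
def IsCMFree (R : Type u) [Ring R] : Prop :=
  ∀ (M : Type u) [AddCommGroup M] [Module R M] [Module.Finite R M],
    IsGorensteinProjective R M ↔ Module.Projective R M

/-- `R` is CM-finite: there are only finitely many isomorphism classes of indecomposable finitely
generated Gorenstein projective modules, i.e. every such module is isomorphic to one in
a finite list of modules. -/
def IsCMFinite (R : Type u) [Ring R] : Prop :=
  ∃ (n : ℕ) (E : Fin n → ModuleCat.{u} R),
    ∀ (M : Type u) [AddCommGroup M] [Module R M] [Module.Finite R M],
      IsIndecomposableModule R M → IsGorensteinProjective R M → ∃ k, Nonempty (M ≃ₗ[R] E k)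

end Gorenstein

/-! Write `S` for the glued algebra, `ε` for the glued idempotent, and `e_A`, `e_B` for the images
of the units of `A` and `B`. Then `e_A e_B = e_B e_A = ε` and `1 = e_A + e_B - ε`. An `S`-module `M`
restricts to the `A`-module `e_A M`, and an `A`-module `X` induces `S ⊗_A X`, which means `S e_A ⊗_A
X`; likewise for `B`, and for `K` embedded as `Kε`.

That `S` has no relations beyond those of `A` and `B` is encoded by a derivation `D : S → S ⊗_K S`,
which is the commutator with `ε ⊗ ε` on `A` and zero on `B`. It has two consequences. First,
contracting one tensor factor of `D x` with the retraction `πA : S → A` expresses `e_A x` and `x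
e_A` through finitely many `A`-linear coordinates, so `S` is finitely generated projective over `A`
on either side (`GluingData.inAdd_restrict`, `GluingData.hasRightDualBasis`). Second, `D` supplies a
retraction that proves injectivity on the left of the Mayer-Vietoris sequence `0 → Sε ⊗_K εM → (S
⊗_A e_A M) ⊕ (S ⊗_B e_B M) → M → 0`, which is exact for every `M`.

Induction is therefore exact and preserves projectives, and by adjunction it preserves Gorenstein
projectives (`IsGorensteinProjective.induce`). Restriction preserves them too: a functional on `e_A
M` is extended through the Mayer-Vietoris sequence (`GluingData.exists_extension_parts`) and pushed
back to `A` by `πA`. If `M` is Gorenstein projective over `S`, the left term of the sequence is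
projective and `Ext¹(M, S)` vanishes, so the sequence splits and `M` is a summand of the sum of its
two induced parts (`GluingData.isSummand_parts`). Conversely `πA` makes every `X` a summand of `e_A
(S ⊗_A X)` (`GluingData.isSummand_restrict_induce`).

Both properties are statements about additive closures. CM-free means that all Gorenstein
projectives lie in `add R`; over an Artinian ring, CM-finite means that they lie in `add G` for one
finitely generated `G`, by Krull-Schmidt. Additive functors transport such statements, and the two
summand relations give both equivalences.

For bound quivers, `D` comes from the universal property of the glued path algebra applied to block
triangular endomorphisms. The retractions come from the augmentation at a vertex, which exists
because an admissible ideal contains no trivial paths or arrows in its elements. -/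

/-! ## Modules built from direct summands of powers of a given module -/

section InAdd

universe u w₁ w₂ w₃ w₄

variable {R : Type u} [Ring R]

/-- The homomorphisms which are finite sums of maps factoring through `G`. -/
def factorSums (R : Type u) [Ring R] (G : Type w₁) (M : Type w₂) (N : Type w₃)
    [AddCommGroup G] [Module R G] [AddCommGroup M] [Module R M] [AddCommGroup N] [Module R N] :
    AddSubmonoid (M →ₗ[R] N) :=
  AddSubmonoid.closure {f | ∃ (s : M →ₗ[R] G) (r : G →ₗ[R] N), f = r ∘ₗ s}

/-- `M` is a direct summand of a finite power of `G`. -/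
def InAdd (R : Type u) [Ring R] (G : Type w₁) (M : Type w₂)
    [AddCommGroup G] [Module R G] [AddCommGroup M] [Module R M] : Prop :=
  LinearMap.id ∈ factorSums R G M M

/-- `M` is a direct summand of `G`. -/
def IsSummand (R : Type u) [Ring R] (M : Type w₂) (G : Type w₁)
    [AddCommGroup G] [Module R G] [AddCommGroup M] [Module R M] : Prop :=
  ∃ (s : M →ₗ[R] G) (r : G →ₗ[R] M), r ∘ₗ s = LinearMap.id

variable {G : Type w₁} {H : Type w₄} {M : Type w₂} {N : Type w₃}
  [AddCommGroup G] [Module R G] [AddCommGroup H] [Module R H]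
  [AddCommGroup M] [Module R M] [AddCommGroup N] [Module R N]

theorem comp_mem_factorSums (s : M →ₗ[R] G) (r : G →ₗ[R] N) : r ∘ₗ s ∈ factorSums R G M N :=
  AddSubmonoid.subset_closure ⟨s, r, rfl⟩

theorem factorSums_comp {L : Type*} [AddCommGroup L] [Module R L] {f : M →ₗ[R] N}
    (hf : f ∈ factorSums R G M N) (s : L →ₗ[R] M) : f ∘ₗ s ∈ factorSums R G L N := by
  induction hf using AddSubmonoid.closure_induction with
  | mem x hx =>
    obtain ⟨s', r, rfl⟩ := hx
    rw [LinearMap.comp_assoc]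
    exact comp_mem_factorSums _ _
  | zero => rw [LinearMap.zero_comp]; exact zero_mem _
  | add x y _ _ hx hy => rw [LinearMap.add_comp]; exact add_mem hx hy

theorem comp_factorSums {L : Type*} [AddCommGroup L] [Module R L] {f : M →ₗ[R] N}
    (hf : f ∈ factorSums R G M N) (r : N →ₗ[R] L) : r ∘ₗ f ∈ factorSums R G M L := by
  induction hf using AddSubmonoid.closure_induction with
  | mem x hx =>
    obtain ⟨s', r', rfl⟩ := hx
    rw [← LinearMap.comp_assoc]
    exact comp_mem_factorSums _ _
  | zero => rw [LinearMap.comp_zero]; exact zero_mem _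
  | add x y _ _ hx hy => rw [LinearMap.comp_add]; exact add_mem hx hy

theorem IsSummand.inAdd (h : IsSummand R M G) : InAdd R G M := by
  obtain ⟨s, r, h⟩ := h
  rw [InAdd, ← h]
  exact comp_mem_factorSums s r

theorem LinearEquiv.isSummand (e : M ≃ₗ[R] N) : IsSummand R M N :=
  ⟨e, e.symm, by ext; simp⟩

theorem IsSummand.trans (h₁ : IsSummand R M N) (h₂ : IsSummand R N G) : IsSummand R M G := by
  obtain ⟨s, r, h⟩ := h₁
  obtain ⟨s', r', h'⟩ := h₂
  refine ⟨s' ∘ₗ s, r ∘ₗ r', ?_⟩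
  rw [LinearMap.comp_assoc, ← LinearMap.comp_assoc _ _ r', h', LinearMap.id_comp, h]

theorem IsSummand.prod_left : IsSummand R M (M × N) :=
  ⟨LinearMap.inl R M N, LinearMap.fst R M N, by ext; simp⟩

theorem IsSummand.prod_right : IsSummand R N (M × N) :=
  ⟨LinearMap.inr R M N, LinearMap.snd R M N, by ext; simp⟩

theorem IsSummand.pi {ι : Type*} (E : ι → Type*) [∀ i, AddCommGroup (E i)]
    [∀ i, Module R (E i)] (k : ι) : IsSummand R (E k) (∀ i, E i) := by
  classical
  exact ⟨LinearMap.single R E k, LinearMap.proj k, by ext; simp⟩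

theorem InAdd.refl : InAdd R M M :=
  (LinearEquiv.refl R M).isSummand.inAdd

/-- Inserting a factorisation through `G` at each passage through `H` suffices; no power of a module
is formed. The same induction on sums shows below that additive functors preserve the relation,
which is the reason for defining it by the identity map. -/
theorem InAdd.trans (h₁ : InAdd R G H) (h₂ : InAdd R H M) : InAdd R G M := by
  have key : ∀ f ∈ factorSums R H M M, f ∈ factorSums R G M M := by
    intro f hf
    induction hf using AddSubmonoid.closure_induction with
    | mem x hx =>
      obtain ⟨s, r, rfl⟩ := hx
      have := comp_factorSums (factorSums_comp h₁ s) r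
      rwa [LinearMap.id_comp] at this
    | zero => exact zero_mem _
    | add x y _ _ hx hy => exact add_mem hx hy
  exact key _ h₂

theorem InAdd.pi {ι : Type*} [Finite ι] (E : ι → Type*) [∀ i, AddCommGroup (E i)]
    [∀ i, Module R (E i)] (h : ∀ i, InAdd R G (E i)) : InAdd R G (∀ i, E i) := by
  classical
  have := Fintype.ofFinite ι
  have e : (LinearMap.id : (∀ i, E i) →ₗ[R] ∀ i, E i) =
      ∑ i, LinearMap.single R E i ∘ₗ LinearMap.id ∘ₗ LinearMap.proj i := by
    refine LinearMap.ext fun x => ?_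
    simp only [LinearMap.id_comp, LinearMap.sum_apply, LinearMap.comp_apply, LinearMap.proj_apply,
      LinearMap.id_apply]
    exact (LinearMap.sum_single_apply E x).symm
  rw [InAdd, e]
  exact sum_mem fun i _ => comp_factorSums (factorSums_comp (h i) _) _

theorem InAdd.prod (h₁ : InAdd R G M) (h₂ : InAdd R G N) : InAdd R G (M × N) := by
  have e : (LinearMap.id : M × N →ₗ[R] M × N) =
      LinearMap.inl R M N ∘ₗ LinearMap.id ∘ₗ LinearMap.fst R M N +
        LinearMap.inr R M N ∘ₗ LinearMap.id ∘ₗ LinearMap.snd R M N := by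
    ext <;> simp
  rw [InAdd, e]
  exact add_mem (comp_factorSums (factorSums_comp h₁ _) _)
    (comp_factorSums (factorSums_comp h₂ _) _)

/-- A sum of `n` maps through `G` is a single map through `G^n`, by concatenating the factors. -/
theorem InAdd.exists_isSummand_pow (h : InAdd R G M) : ∃ n : ℕ, IsSummand R M (Fin n → G) := by
  have key : ∀ f ∈ factorSums R G M M, ∃ (n : ℕ) (s : M →ₗ[R] Fin n → G)
      (r : (Fin n → G) →ₗ[R] M), r ∘ₗ s = f := by
    intro f hf
    induction hf using AddSubmonoid.closure_induction with
    | mem x hx =>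
      obtain ⟨s, r, rfl⟩ := hx
      exact ⟨1, LinearMap.pi fun _ => s, r ∘ₗ LinearMap.proj 0, by ext; simp⟩
    | zero => exact ⟨0, 0, 0, by simp⟩
    | add x y _ _ hx hy =>
      obtain ⟨n, s, r, rfl⟩ := hx
      obtain ⟨m, s', r', rfl⟩ := hy
      refine ⟨n + m, LinearMap.pi (Fin.addCases (fun i => LinearMap.proj i ∘ₗ s)
        (fun i => LinearMap.proj i ∘ₗ s')),
        r ∘ₗ LinearMap.funLeft R G (Fin.castAdd m) + r' ∘ₗ LinearMap.funLeft R G (Fin.natAdd n), ?_⟩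
      ext x
      simp only [LinearMap.add_comp, LinearMap.add_apply, LinearMap.comp_apply]
      congr 2
      · ext i; simp [LinearMap.funLeft]
      · ext i; simp [LinearMap.funLeft]
  obtain ⟨n, s, r, h⟩ := key _ h
  exact ⟨n, s, r, h⟩

theorem IsSummand.finite (h : IsSummand R M G) [Module.Finite R G] : Module.Finite R M := by
  obtain ⟨s, r, h⟩ := h
  exact Module.Finite.of_surjective r fun x => ⟨s x, LinearMap.congr_fun h x⟩

theorem IsSummand.projective (h : IsSummand R M G) [Module.Projective R G] :
    Module.Projective R M := by
  obtain ⟨s, r, h⟩ := h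
  exact Module.Projective.of_split s r h

theorem InAdd.finite (h : InAdd R G M) [Module.Finite R G] : Module.Finite R M := by
  obtain ⟨n, h⟩ := h.exists_isSummand_pow
  exact h.finite

theorem InAdd.projective (h : InAdd R G M) [Module.Projective R G] : Module.Projective R M := by
  obtain ⟨n, h⟩ := h.exists_isSummand_pow
  have : Module.Projective R (Π₀ _ : Fin n, G) := inferInstance
  have := Module.Projective.of_equiv (DFinsupp.linearEquivFunOnFintype (R := R) (M := fun _ : Fin n => G))
  exact h.projective

theorem inAdd_self_of_projective (M : Type w₂) [AddCommGroup M] [Module R M]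
    [Module.Finite R M] [Module.Projective R M] : InAdd R R M := by
  obtain ⟨n, f, hf⟩ := Module.Finite.exists_fin' R M
  obtain ⟨s, hs⟩ := Module.projective_lifting_property f LinearMap.id hf
  exact (InAdd.pi (fun _ : Fin n => R) fun _ => InAdd.refl).trans (IsSummand.inAdd ⟨s, f, hs⟩)

/-- Maps to `N` extend along `f` if maps to `G` do, for `N` a summand of a power of `G`. -/
theorem InAdd.extends {P : Type*} [AddCommGroup P] [Module R P] (h : InAdd R G N)
    (f : M →ₗ[R] P) (hf : ∀ φ : M →ₗ[R] G, ∃ ψ : P →ₗ[R] G, ψ ∘ₗ f = φ) (φ : M →ₗ[R] N) :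
    ∃ ψ : P →ₗ[R] N, ψ ∘ₗ f = φ := by
  have key : ∀ g ∈ factorSums R G N N, ∃ ψ : P →ₗ[R] N, ψ ∘ₗ f = g ∘ₗ φ := by
    intro g hg
    induction hg using AddSubmonoid.closure_induction with
    | mem x hx =>
      obtain ⟨s, r, rfl⟩ := hx
      obtain ⟨ψ, hψ⟩ := hf (s ∘ₗ φ)
      exact ⟨r ∘ₗ ψ, by rw [LinearMap.comp_assoc, hψ, LinearMap.comp_assoc]⟩
    | zero => exact ⟨0, by simp⟩
    | add x y _ _ hx hy =>
      obtain ⟨a, ha⟩ := hx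
      obtain ⟨b, hb⟩ := hy
      exact ⟨a + b, by rw [LinearMap.add_comp, ha, hb, LinearMap.add_comp]⟩
  exact key _ h

end InAdd

/-! ## Gorenstein projective modules and short exact sequences -/

section Step

universe u w₁ w₂ w₃ w₄ w

/-- A finitely generated module is isomorphic to one in the universe of the ring. -/
theorem Module.Finite.exists_small (R : Type u) [Ring R] (M : Type w) [AddCommGroup M] [Module R M]
    [Module.Finite R M] : ∃ M' : ModuleCat.{u} R, Nonempty (M ≃ₗ[R] M') := by
  obtain ⟨n, f, hf⟩ := Module.Finite.exists_fin' R M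
  exact ⟨ModuleCat.of R ((Fin n → R) ⧸ LinearMap.ker f), ⟨(f.quotKerEquivOfSurjective hf).symm⟩⟩

/-- There is a short exact sequence `0 → M → P → N → 0` with `P` finitely generated projective
which stays exact under `Hom(-, R)`. -/
def GorStep (R : Type u) [Ring R] (M : Type w₁) (N : Type w₂) [AddCommGroup M] [Module R M]
    [AddCommGroup N] [Module R N] : Prop :=
  ∃ (P : ModuleCat.{u} R) (f : M →ₗ[R] P) (g : P →ₗ[R] N), Module.Finite R P ∧
    Module.Projective R P ∧ Function.Injective f ∧ Function.Surjective g ∧ Function.Exact f g ∧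
    ∀ φ : M →ₗ[R] R, ∃ ψ : P →ₗ[R] R, ψ ∘ₗ f = φ

variable {R : Type u} [Ring R] {M : Type w₁} {N : Type w₂} [AddCommGroup M] [Module R M]
  [AddCommGroup N] [Module R N]

/-- The middle term may live in any universe: being finitely generated, it can be replaced by an
isomorphic copy in the universe of the ring. -/
theorem GorStep.intro {P : Type w} [AddCommGroup P] [Module R P] [Module.Finite R P]
    [Module.Projective R P] (f : M →ₗ[R] P) (g : P →ₗ[R] N) (hf : Function.Injective f)
    (hg : Function.Surjective g) (hfg : Function.Exact f g)
    (h : ∀ φ : M →ₗ[R] R, ∃ ψ : P →ₗ[R] R, ψ ∘ₗ f = φ) : GorStep R M N := by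
  obtain ⟨P', ⟨e⟩⟩ := Module.Finite.exists_small R P
  refine ⟨P', e.toLinearMap ∘ₗ f, g ∘ₗ e.symm.toLinearMap, Module.Finite.equiv e,
    Module.Projective.of_equiv e, e.injective.comp hf, hg.comp e.symm.surjective, ?_, ?_⟩
  · intro x
    have := hfg (e.symm x)
    simp only [LinearMap.comp_apply, LinearEquiv.coe_coe, this, Set.mem_range]
    simp only [LinearEquiv.eq_symm_apply]
  · intro φ
    obtain ⟨ψ, hψ⟩ := h φ
    exact ⟨ψ ∘ₗ e.symm.toLinearMap, by ext x; simp [← hψ]⟩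

theorem GorStep.of_equiv {M' : Type w₃} {N' : Type w₄} [AddCommGroup M'] [Module R M']
    [AddCommGroup N'] [Module R N'] (h : GorStep R M N) (e : M ≃ₗ[R] M') (e' : N ≃ₗ[R] N') :
    GorStep R M' N' := by
  obtain ⟨P, f, g, _, _, hf, hg, hfg, h⟩ := h
  refine ⟨P, f ∘ₗ e.symm.toLinearMap, e'.toLinearMap ∘ₗ g, ‹_›, ‹_›, hf.comp e.symm.injective,
    e'.surjective.comp hg, ?_, ?_⟩
  · intro x
    have := hfg x
    simp only [LinearMap.comp_apply, LinearEquiv.coe_coe, LinearEquiv.map_eq_zero_iff, this,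
      Set.mem_range]
    exact ⟨fun ⟨y, hy⟩ => ⟨e y, by simpa using hy⟩, fun ⟨y, hy⟩ => ⟨_, hy⟩⟩
  · intro φ
    obtain ⟨ψ, hψ⟩ := h (φ ∘ₗ e.toLinearMap)
    exact ⟨ψ, by rw [← LinearMap.comp_assoc, hψ]; ext; simp⟩

theorem GorStep.finite_right (h : GorStep R M N) : Module.Finite R N := by
  obtain ⟨P, f, g, _, _, hf, hg, hfg, h⟩ := h
  exact Module.Finite.of_surjective g hg

theorem TotallyAcyclicComplex.gorStep_ker (P : TotallyAcyclicComplex R) (i : ℤ) :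
    GorStep R (LinearMap.ker (P.d i)) (LinearMap.ker (P.d (i + 1))) := by
  -- A functional on the kernel in degree `i`, which is the image of degree `i - 1`, is extended by
  -- exactness of the dual complex at degree `i - 1`. That is `hom_exact (i - 2)`, hence the shift
  -- by two.
  obtain ⟨j, rfl⟩ : ∃ j, i = j + 1 + 1 := ⟨i - 2, by ring⟩
  have := P.finite (j + 1 + 1)
  have := P.projective (j + 1 + 1)
  refine GorStep.intro (P := P.X (j + 1 + 1)) (LinearMap.ker (P.d (j + 1 + 1))).subtype
    ((P.d (j + 1 + 1)).codRestrict _ fun x =>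
      LinearMap.mem_ker.2 ((P.exact (j + 1 + 1)).apply_apply_eq_zero x))
    Subtype.val_injective ?_ ?_ ?_
  · rintro ⟨x, hx⟩
    obtain ⟨y, hy⟩ := (P.exact (j + 1 + 1) x).1 hx
    exact ⟨y, Subtype.ext hy⟩
  · intro x
    rw [Subtype.ext_iff, LinearMap.codRestrict_apply, ZeroMemClass.coe_zero]
    exact ⟨fun h => ⟨⟨x, h⟩, rfl⟩, fun ⟨y, hy⟩ => hy ▸ y.2⟩
  · intro φ
    have hd : ∀ x, P.d (j + 1) x ∈ LinearMap.ker (P.d (j + 1 + 1)) := fun x =>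
      LinearMap.mem_ker.2 ((P.exact (j + 1)).apply_apply_eq_zero x)
    obtain ⟨ψ, hψ⟩ := (P.hom_exact j (φ ∘ₗ (P.d (j + 1)).codRestrict _ hd)).1 (by
      ext x
      simp only [LinearMap.comp_apply, LinearMap.zero_apply]
      rw [show (P.d (j + 1)).codRestrict _ hd (P.d j x) = 0 from
        Subtype.ext ((P.exact j).apply_apply_eq_zero x), map_zero])
    refine ⟨ψ, LinearMap.ext ?_⟩
    rintro ⟨x, hx⟩
    obtain ⟨y, rfl⟩ := (P.exact (j + 1) x).1 hx
    exact LinearMap.congr_fun hψ y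

theorem IsGorensteinProjective.of_equiv (h : IsGorensteinProjective R M) (e : M ≃ₗ[R] N) :
    IsGorensteinProjective R N := by
  obtain ⟨P, ⟨e'⟩⟩ := h
  exact ⟨P, ⟨e.symm.trans e'⟩⟩

/-- A module in a class of modules in which every module is the start and the end of an admissible
short exact sequence is Gorenstein projective. -/
theorem isGorensteinProjective_of_class (C : ModuleCat.{w} R → Prop)
    (hr : ∀ X, C X → ∃ Y, C Y ∧ GorStep R X Y) (hl : ∀ X, C X → ∃ Y, C Y ∧ GorStep R Y X)
    (X : ModuleCat.{w} R) (hX : C X) : IsGorensteinProjective R X := by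
  choose r hr using fun X : {X // C X} => hr X X.2
  choose l hl using fun X : {X // C X} => hl X X.2
  let r' : {X // C X} → {X // C X} := fun X => ⟨r X, (hr X).1⟩
  let l' : {X // C X} → {X // C X} := fun X => ⟨l X, (hl X).1⟩
  -- Nonnegative indices move to the right from `X`. Index `-(n + 1)` takes `n + 1` steps to the
  -- left, so `X` itself sits only at index `0` by construction.
  let c : ℤ → {X // C X} := fun i => Int.rec (fun n => r'^[n] ⟨X, hX⟩) (fun n => l'^[n + 1] ⟨X, hX⟩) i
  have hc : ∀ i, GorStep R (c i).1 (c (i + 1)).1 := by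
    rintro (n | n)
    · have : c (Int.ofNat n + 1) = r' (c (Int.ofNat n)) :=
        Function.iterate_succ_apply' r' n ⟨X, hX⟩
      rw [this]
      exact (hr _).2
    · have : c (Int.negSucc n) = l' (c (Int.negSucc n + 1)) := by
        cases n <;> exact Function.iterate_succ_apply' l' _ ⟨X, hX⟩
      rw [this]
      exact (hl _).2
  choose P f g hfin hproj hf hg hfg hext using hc
  -- Splice the sequences `c i → P i → c (i + 1)`. The differential passes through `c (i + 1)`, so
  -- its kernel in degree `0` is the image of `c 0 = X`.
  refine ⟨{ X := fun i => P i, d := fun i => f (i + 1) ∘ₗ g i, finite := hfin, projective := hproj,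
            exact := ?_, hom_exact := ?_ }, ⟨?_⟩⟩
  · intro i x
    have h1 : (f (i + 1 + 1) ∘ₗ g (i + 1)) x = 0 ↔ g (i + 1) x = 0 := by
      rw [LinearMap.comp_apply, map_eq_zero_iff _ (hf _)]
    rw [h1, hfg (i + 1) x]
    constructor
    · rintro ⟨y, rfl⟩
      obtain ⟨z, rfl⟩ := hg i y
      exact ⟨z, rfl⟩
    · rintro ⟨z, rfl⟩
      exact ⟨g i z, rfl⟩
  · intro i φ
    constructor
    · intro h
      have hφ : ∀ y, φ (f (i + 1) y) = 0 := by
        intro y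
        obtain ⟨z, rfl⟩ := hg i y
        exact LinearMap.congr_fun h z
      obtain ⟨φ', hφ'⟩ : ∃ φ' : (c (i + 1 + 1)).1 →ₗ[R] R, φ' ∘ₗ g (i + 1) = φ := by
        have hle : LinearMap.ker (g (i + 1)) ≤ LinearMap.ker φ := by
          intro x hx
          obtain ⟨y, rfl⟩ := (hfg (i + 1) x).1 hx
          exact hφ y
        refine ⟨(LinearMap.ker (g (i + 1))).liftQ φ hle ∘ₗ
          ((g (i + 1)).quotKerEquivOfSurjective (hg _)).symm.toLinearMap, ?_⟩
        ext x
        have : ((g (i + 1)).quotKerEquivOfSurjective (hg _)).symm (g (i + 1) x) =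
            Submodule.Quotient.mk x := by
          rw [LinearEquiv.symm_apply_eq]; rfl
        simp [this]
      obtain ⟨ψ, hψ⟩ := hext (i + 1 + 1) φ'
      exact ⟨ψ, by
        show ψ ∘ₗ (f (i + 1 + 1) ∘ₗ g (i + 1)) = φ
        rw [← LinearMap.comp_assoc, hψ, hφ']⟩
    · rintro ⟨ψ, rfl⟩
      ext x
      simp [(hfg (i + 1)).apply_apply_eq_zero]
  · have hk : LinearMap.ker (f (0 + 1) ∘ₗ g 0) = LinearMap.range (f 0) := by
      rw [LinearMap.ker_comp_of_ker_eq_bot _ (LinearMap.ker_eq_bot.2 (hf _))]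
      exact LinearMap.exact_iff.1 (hfg 0)
    exact (LinearEquiv.ofInjective (f 0) (hf 0)).trans (LinearEquiv.ofEq _ _ hk.symm)

theorem TotallyAcyclicComplex.isGorensteinProjective_ker (P : TotallyAcyclicComplex R) (i : ℤ) :
    IsGorensteinProjective R (LinearMap.ker (P.d i)) := by
  refine isGorensteinProjective_of_class
    (fun X => ∃ i, X = ModuleCat.of R (LinearMap.ker (P.d i))) ?_ ?_ (ModuleCat.of R _) ⟨i, rfl⟩
  · rintro _ ⟨i, rfl⟩
    exact ⟨_, ⟨i + 1, rfl⟩, P.gorStep_ker i⟩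
  · rintro _ ⟨i, rfl⟩
    obtain ⟨i, rfl⟩ : ∃ j, i = j + 1 := ⟨i - 1, by ring⟩
    exact ⟨_, ⟨i, rfl⟩, P.gorStep_ker i⟩

theorem IsGorensteinProjective.exists_right (h : IsGorensteinProjective R M) :
    ∃ N : ModuleCat.{u} R, IsGorensteinProjective R N ∧ GorStep R M N := by
  obtain ⟨P, ⟨e⟩⟩ := h
  exact ⟨ModuleCat.of R (LinearMap.ker (P.d (0 + 1))), P.isGorensteinProjective_ker _,
    (P.gorStep_ker 0).of_equiv e.symm (LinearEquiv.refl _ _)⟩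

theorem IsGorensteinProjective.exists_left (h : IsGorensteinProjective R M) :
    ∃ N : ModuleCat.{u} R, IsGorensteinProjective R N ∧ GorStep R N M := by
  obtain ⟨P, ⟨e⟩⟩ := h
  exact ⟨ModuleCat.of R (LinearMap.ker (P.d (-1))), P.isGorensteinProjective_ker _,
    (P.gorStep_ker (-1)).of_equiv (LinearEquiv.refl _ _) e.symm⟩

theorem IsGorensteinProjective.finite (h : IsGorensteinProjective R M) : Module.Finite R M := by
  obtain ⟨N, _, h⟩ := h.exists_left
  exact h.finite_right

theorem isGorensteinProjective_of_subsingleton (M : Type w) [AddCommGroup M] [Module R M]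
    [Subsingleton M] : IsGorensteinProjective R M := by
  have h : ∀ X : ModuleCat.{w} R, Subsingleton X → GorStep R X X := fun X _ =>
    GorStep.intro (P := PUnit.{u + 1}) 0 0 (Function.injective_of_subsingleton _)
      (fun x => ⟨0, Subsingleton.elim _ _⟩) (fun x => ⟨fun _ => ⟨0, rfl⟩, fun _ => rfl⟩)
      (fun φ => ⟨0, by ext x; rw [Subsingleton.elim x 0]; simp⟩)
  exact isGorensteinProjective_of_class (fun X : ModuleCat.{w} R => Subsingleton X)
    (fun X hX => ⟨X, hX, h X hX⟩) (fun X hX => ⟨X, hX, h X hX⟩) (ModuleCat.of R M) ‹_›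

theorem GorStep.prod_left (h : GorStep R M N) (Q : Type w) [AddCommGroup Q] [Module R Q]
    [Module.Finite R Q] [Module.Projective R Q] : GorStep R (M × Q) N := by
  obtain ⟨P, f, g, _, _, hf, hg, hfg, h⟩ := h
  refine GorStep.intro (P := P × Q) (f.prodMap LinearMap.id) (g ∘ₗ LinearMap.fst R P Q)
    (hf.prodMap Function.injective_id) (hg.comp Prod.fst_surjective) ?_ ?_
  · rintro ⟨x, y⟩
    simp only [LinearMap.comp_apply, LinearMap.fst_apply, hfg x, Set.mem_range]
    exact ⟨fun ⟨z, hz⟩ => ⟨(z, y), by simp [hz]⟩, fun ⟨z, hz⟩ => ⟨z.1, congrArg Prod.fst hz⟩⟩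
  · intro φ
    obtain ⟨ψ, hψ⟩ := h (φ ∘ₗ LinearMap.inl R M Q)
    refine ⟨ψ.coprod (φ ∘ₗ LinearMap.inr R M Q), LinearMap.ext ?_⟩
    rintro ⟨x, y⟩
    have := LinearMap.congr_fun hψ x
    simp only [LinearMap.comp_apply, LinearMap.inl_apply] at this
    simp [this, ← map_add]

theorem GorStep.prod_right (h : GorStep R M N) (Q : Type w) [AddCommGroup Q] [Module R Q]
    [Module.Finite R Q] [Module.Projective R Q] : GorStep R M (N × Q) := by
  obtain ⟨P, f, g, _, _, hf, hg, hfg, h⟩ := h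
  refine GorStep.intro (P := P × Q) (LinearMap.inl R P Q ∘ₗ f) (g.prodMap LinearMap.id)
    (LinearMap.inl_injective.comp hf) (hg.prodMap Function.surjective_id) ?_ ?_
  · rintro ⟨x, y⟩
    simp only [LinearMap.prodMap_apply, Prod.mk_eq_zero, hfg x, Set.mem_range,
      LinearMap.id_apply, LinearMap.comp_apply, LinearMap.inl_apply, Prod.mk.injEq]
    exact ⟨fun ⟨⟨z, hz⟩, hy⟩ => ⟨z, hz, hy.symm⟩, fun ⟨z, hz, hy⟩ => ⟨⟨z, hz⟩, hy.symm⟩⟩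
  · intro φ
    obtain ⟨ψ, hψ⟩ := h φ
    exact ⟨ψ ∘ₗ LinearMap.fst R P Q, by ext x; simp [← hψ]⟩

theorem IsGorensteinProjective.prod_projective (h : IsGorensteinProjective R M) (Q : Type w)
    [AddCommGroup Q] [Module R Q] [Module.Finite R Q] [Module.Projective R Q] :
    IsGorensteinProjective R (M × Q) := by
  have := h.finite
  obtain ⟨M', ⟨e⟩⟩ := Module.Finite.exists_small R M
  obtain ⟨Q', ⟨e'⟩⟩ := Module.Finite.exists_small R Q
  have := Module.Finite.equiv e'
  have := Module.Projective.of_equiv e'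
  have key : IsGorensteinProjective R (M' × Q') := by
    -- One step to either side absorbs `Q'` into the middle projective and leaves a Gorenstein
    -- projective module, so the class must contain both kinds of modules.
    refine isGorensteinProjective_of_class (fun X : ModuleCat.{u} R => IsGorensteinProjective R X ∨
      ∃ L : ModuleCat.{u} R, IsGorensteinProjective R L ∧ X = ModuleCat.of R (L × Q')) ?_ ?_
      (ModuleCat.of R (M' × Q')) (Or.inr ⟨M', h.of_equiv e, rfl⟩)
    · rintro X (hX | ⟨L, hL, rfl⟩)
      · obtain ⟨Y, hY, hs⟩ := hX.exists_right
        exact ⟨Y, Or.inl hY, hs⟩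
      · obtain ⟨Y, hY, hs⟩ := hL.exists_right
        exact ⟨Y, Or.inl hY, hs.prod_left Q'⟩
    · rintro X (hX | ⟨L, hL, rfl⟩)
      · obtain ⟨Y, hY, hs⟩ := hX.exists_left
        exact ⟨Y, Or.inl hY, hs⟩
      · obtain ⟨Y, hY, hs⟩ := hL.exists_left
        exact ⟨Y, Or.inl hY, hs.prod_right Q'⟩
  exact key.of_equiv (e.symm.prodCongr e'.symm)

theorem isGorensteinProjective_of_projective (Q : Type w) [AddCommGroup Q] [Module R Q]
    [Module.Finite R Q] [Module.Projective R Q] : IsGorensteinProjective R Q :=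
  ((isGorensteinProjective_of_subsingleton PUnit.{u + 1}).prod_projective Q).of_equiv
    (LinearEquiv.uniqueProd)

end Step

/-! ### Gorenstein projective modules are closed under direct summands. -/

section GorensteinSummand

universe u w w₁ w₂ w₃

variable {R : Type u} [Ring R]

/-- Two surjections with the same kernel have isomorphic targets. -/
theorem LinearMap.nonempty_equiv_of_ker_eq {P : Type w₁} {M : Type w₂} {N : Type w₃}
    [AddCommGroup P] [Module R P] [AddCommGroup M] [Module R M] [AddCommGroup N] [Module R N]
    (f : P →ₗ[R] M) (g : P →ₗ[R] N) (hf : Function.Surjective f) (hg : Function.Surjective g)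
    (h : LinearMap.ker f = LinearMap.ker g) : Nonempty (M ≃ₗ[R] N) :=
  ⟨(f.quotKerEquivOfSurjective hf).symm.trans
    ((Submodule.quotEquivOfEq _ _ h).trans (g.quotKerEquivOfSurjective hg))⟩

/-- Take `0 → M × N → P → L → 0`. The quotients of `P` by `M` and by `N` have direct sum `(P × P) /
(M × N)`, and this is `L × P`, which is again Gorenstein projective. The isomorphism comes from an
endomorphism `θ` of `P` extending the projection of `M × N` onto `M`. -/
theorem IsGorensteinProjective.exists_right_of_prod {M N : ModuleCat.{u} R}
    (h : IsGorensteinProjective R (M × N)) : ∃ M' N' : ModuleCat.{u} R,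
      IsGorensteinProjective R (M' × N') ∧ GorStep R M M' := by
  obtain ⟨L, hL, P, f, g, _, _, hf, hg, hfg, hext⟩ := h.exists_right
  obtain ⟨θ, hθ⟩ := (inAdd_self_of_projective (R := R) P).extends f hext
    (f ∘ₗ LinearMap.inl R M N ∘ₗ LinearMap.fst R M N)
  have hθ' : ∀ m n, θ (f (m, n)) = f (m, 0) := fun m n => LinearMap.congr_fun hθ (m, n)
  refine ⟨ModuleCat.of R (P ⧸ LinearMap.range (f ∘ₗ LinearMap.inl R M N)),
    ModuleCat.of R (P ⧸ LinearMap.range (f ∘ₗ LinearMap.inr R M N)), ?_, ?_⟩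
  · let Φ : P × P →ₗ[R] L × P := (g ∘ₗ (LinearMap.fst R P P + LinearMap.snd R P P)).prod
      (θ ∘ₗ (LinearMap.fst R P P + LinearMap.snd R P P) - LinearMap.fst R P P)
    -- The kernel of `Φ` is the product of the images of `M` and `N`: if `p + q = f (m, n)`, then
    -- the second coordinate forces `p = f (m, 0)`, and hence `q = f (0, n)`.
    have hΦ : ∀ p q, Φ (p, q) = (g (p + q), θ (p + q) - p) := fun p q => rfl
    obtain ⟨e⟩ := LinearMap.nonempty_equiv_of_ker_eq Φ
      ((LinearMap.range (f ∘ₗ LinearMap.inl R M N)).mkQ.prodMap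
        (LinearMap.range (f ∘ₗ LinearMap.inr R M N)).mkQ) (by
        rintro ⟨l, r⟩
        obtain ⟨s, rfl⟩ := hg l
        exact ⟨(θ s - r, s - (θ s - r)), by rw [hΦ]; simp⟩)
      ((Submodule.mkQ_surjective _).prodMap (Submodule.mkQ_surjective _)) (by
        ext ⟨p, q⟩
        rw [LinearMap.mem_ker, LinearMap.mem_ker, hΦ, LinearMap.prodMap_apply, Prod.mk_eq_zero,
          Prod.mk_eq_zero, hfg, sub_eq_zero, Submodule.mkQ_apply, Submodule.mkQ_apply,
          Submodule.Quotient.mk_eq_zero, Submodule.Quotient.mk_eq_zero]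
        constructor
        · rintro ⟨⟨⟨m, n⟩, hmn⟩, hp⟩
          rw [← hmn, hθ'] at hp
          refine ⟨⟨m, hp⟩, ⟨n, ?_⟩⟩
          have : f (m, n) = f (m, 0) + f (0, n) := by rw [← map_add]; simp
          rw [hmn, hp] at this
          exact (add_left_cancel this).symm
        · rintro ⟨⟨m, rfl⟩, ⟨n, rfl⟩⟩
          have : f (m, 0) + f (0, n) = f (m, n) := by rw [← map_add]; simp
          refine ⟨⟨(m, n), this.symm⟩, ?_⟩
          simp only [LinearMap.comp_apply, LinearMap.inl_apply, LinearMap.inr_apply]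
          rw [this, hθ'])
    exact (hL.prod_projective P).of_equiv e
  · refine GorStep.intro (f ∘ₗ LinearMap.inl R M N) (Submodule.mkQ _)
      (hf.comp LinearMap.inl_injective) (Submodule.mkQ_surjective _)
      (LinearMap.exact_iff.2 (Submodule.ker_mkQ _)) fun φ => ?_
    obtain ⟨ψ, hψ⟩ := hext (φ ∘ₗ LinearMap.fst R M N)
    exact ⟨ψ, by rw [← LinearMap.comp_assoc, hψ]; ext; simp⟩

/-- A Schanuel argument: for a projective cover sequence `0 → K → Q → M × N → 0`, not necessarily
minimal, the kernels of `Q → M` and `Q → N` have direct sum `K × Q`. Here `θ` lifts the projection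
onto `M` along `Q → M × N`. -/
theorem IsGorensteinProjective.exists_left_of_prod {M N : ModuleCat.{u} R}
    (h : IsGorensteinProjective R (M × N)) : ∃ M' N' : ModuleCat.{u} R,
      IsGorensteinProjective R (M' × N') ∧ GorStep R M' M := by
  obtain ⟨K, hK, Q, f, q, _, _, hf, hq, hfq, hext⟩ := h.exists_left
  obtain ⟨θ, hθ⟩ := Module.projective_lifting_property q
    (LinearMap.inl R M N ∘ₗ LinearMap.fst R M N ∘ₗ q) hq
  have hθ' : ∀ x, q (θ x) = ((q x).1, 0) := fun x => LinearMap.congr_fun hθ x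
  let qM := LinearMap.fst R M N ∘ₗ q
  let qN := LinearMap.snd R M N ∘ₗ q
  have hfM : ∀ k, f k ∈ LinearMap.ker qM := fun k => by
    simp [qM, hfq.apply_apply_eq_zero]
  have hM : ∀ y, y - θ y ∈ LinearMap.ker qM := fun y => by simp [qM, hθ']
  have hN : ∀ y, θ y ∈ LinearMap.ker qN := fun y => by simp [qN, hθ']
  refine ⟨ModuleCat.of R (LinearMap.ker qM), ModuleCat.of R (LinearMap.ker qN), ?_, ?_⟩
  · let u : K × Q →ₗ[R] Q := f ∘ₗ LinearMap.fst R K Q - (LinearMap.id - θ) ∘ₗ LinearMap.snd R K Q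
    let v : K × Q →ₗ[R] Q := f ∘ₗ LinearMap.fst R K Q + θ ∘ₗ LinearMap.snd R K Q
    have hu : ∀ k y, u (k, y) = f k - (y - θ y) := fun _ _ => rfl
    have hv : ∀ k y, v (k, y) = f k + θ y := fun _ _ => rfl
    have hu' : ∀ x, u x ∈ LinearMap.ker qM := fun ⟨k, y⟩ => by
      rw [hu]; exact sub_mem (hfM k) (hM y)
    have hv' : ∀ x, v x ∈ LinearMap.ker qN := fun ⟨k, y⟩ => by
      rw [hv]; exact add_mem (by simp [qN, hfq.apply_apply_eq_zero]) (hN y)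
    have e := LinearEquiv.ofBijective ((u.codRestrict _ hu').prod (v.codRestrict _ hv')) ⟨by
        rw [← LinearMap.ker_eq_bot, LinearMap.ker_eq_bot']
        rintro ⟨k, y⟩ h0
        have h1 : u (k, y) = 0 := congrArg (fun z => (z.1 : Q)) h0
        have h2 : v (k, y) = 0 := congrArg (fun z => (z.2 : Q)) h0
        rw [hu] at h1
        rw [hv] at h2
        have hy : y = 0 := by
          have : y = (f k + θ y) - (f k - (y - θ y)) := by abel
          rw [this, h1, h2, sub_zero]
        subst hy
        have : f k = 0 := by simpa using h2
        rw [hf (this.trans (map_zero f).symm)]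
        rfl, by
        rintro ⟨⟨a, ha⟩, ⟨b, hb⟩⟩
        have hx : q (a + ((b - a) - θ (b - a))) = 0 := by
          have ha' : (q a).1 = 0 := ha
          have hb' : (q b).2 = 0 := hb
          rw [map_add, map_sub, hθ', map_sub]
          ext <;> simp [ha', hb']
        obtain ⟨k, hk⟩ := (hfq _).1 hx
        refine ⟨(k, b - a), ?_⟩
        ext
        · show u (k, b - a) = a
          rw [hu, hk]; abel
        · show v (k, b - a) = b
          rw [hv, hk]; abel⟩
    exact (hK.prod_projective Q).of_equiv e
  · refine GorStep.intro (P := Q) (LinearMap.ker qM).subtype qM Subtype.val_injective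
      (Prod.fst_surjective.comp hq) (LinearMap.exact_subtype_ker_map qM) fun φ => ?_
    obtain ⟨α, hα⟩ := hext (φ ∘ₗ f.codRestrict _ hfM)
    -- On the kernel of `Q → M`, `θ` takes values in `K`, where `α` agrees with `φ`. The map `id -
    -- θ` sends all of `Q` into that kernel, so the formula is defined on `Q` and restricts to `φ`.
    refine ⟨α ∘ₗ θ + φ ∘ₗ (LinearMap.id - θ).codRestrict (LinearMap.ker qM) hM, ?_⟩
    ext ⟨x, hx⟩
    have hx' : (q x).1 = 0 := hx
    obtain ⟨k, hk⟩ := (hfq (θ x)).1 (by rw [hθ', hx']; rfl)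
    have := LinearMap.congr_fun hα k
    simp only [LinearMap.comp_apply, hk] at this
    simp only [LinearMap.comp_apply, LinearMap.add_apply, Submodule.subtype_apply, this]
    rw [← map_add]
    congr 1
    ext
    simp [hk]

theorem IsSummand.exists_compl {X : Type w₁} {M : Type w₂} [AddCommGroup X]
    [Module R X] [AddCommGroup M] [Module R M] (h : IsSummand R M X) :
    ∃ N : Submodule R X, IsSummand R N X ∧ Nonempty ((M × N) ≃ₗ[R] X) := by
  obtain ⟨s, r, hsr⟩ := h
  have hrs : ∀ x, r (s x) = x := fun x => LinearMap.congr_fun hsr x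
  refine ⟨LinearMap.ker r, ⟨Submodule.subtype _, (LinearMap.id - s ∘ₗ r).codRestrict _
    fun x => by simp [hrs], ?_⟩,
    ⟨LinearEquiv.ofBijective (s.coprod (LinearMap.ker r).subtype) ⟨?_, ?_⟩⟩⟩
  · ext ⟨x, hx⟩
    have : r x = 0 := hx
    simp [this]
  · rw [← LinearMap.ker_eq_bot, LinearMap.ker_eq_bot']
    rintro ⟨m, n, hn⟩ h
    have hn' : r n = 0 := hn
    have h' : s m + n = 0 := h
    have hm : m = 0 := by
      have := congrArg r h'
      rwa [map_add, hrs, hn', add_zero, map_zero] at this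
    subst hm
    have : n = 0 := by simpa using h'
    subst this
    rfl
  · intro x
    exact ⟨(r x, ⟨x - s (r x), by simp [hrs]⟩), by simp⟩

theorem IsGorensteinProjective.of_isSummand {X : Type w₁} {M : Type w₂} [AddCommGroup X]
    [Module R X] [AddCommGroup M] [Module R M] (hX : IsGorensteinProjective R X)
    (h : IsSummand R M X) : IsGorensteinProjective R M := by
  have := hX.finite
  have := h.finite
  obtain ⟨M', ⟨e⟩⟩ := Module.Finite.exists_small R M
  obtain ⟨N, hN, ⟨e₁⟩⟩ := h.exists_compl
  have := hN.finite
  obtain ⟨N', ⟨e'⟩⟩ := Module.Finite.exists_small R N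
  -- The class consists of modules having some complement with Gorenstein projective sum. The
  -- complement changes at each step, so it is quantified inside the class.
  refine (isGorensteinProjective_of_class (fun L : ModuleCat.{u} R => ∃ L' : ModuleCat.{u} R,
    IsGorensteinProjective R (L × L')) ?_ ?_ M'
    ⟨N', hX.of_equiv (e₁.symm.trans (e.prodCongr e'))⟩).of_equiv e.symm
  · rintro L ⟨L', hL⟩
    obtain ⟨M', N', h, hs⟩ := hL.exists_right_of_prod
    exact ⟨M', ⟨N', h⟩, hs⟩
  · rintro L ⟨L', hL⟩
    obtain ⟨M', N', h, hs⟩ := hL.exists_left_of_prod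
    exact ⟨M', ⟨N', h⟩, hs⟩

end GorensteinSummand

/-! ## Indecomposable modules -/

section Indecomposable

universe u w w₁ w₂

variable {R : Type u} [Ring R]

/-- Fitting's lemma: for large `n` the kernel and the range of `f ^ n` are complementary, so one of
them vanishes. -/
theorem IsIndecomposableModule.isUnit_or_isNilpotent {M : Type w} [AddCommGroup M] [Module R M]
    [IsNoetherian R M] [IsArtinian R M] (h : IsIndecomposableModule R M) (f : Module.End R M) :
    IsUnit f ∨ IsNilpotent f := by
  obtain ⟨n, hn1, hn⟩ := ((Filter.eventually_ge_atTop 1).and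
    f.eventually_isCompl_ker_pow_range_pow).exists
  rcases h.2 _ _ hn with h0 | h0
  · left
    rw [Module.End.isUnit_iff]
    have hinj : Function.Injective f := by
      rw [← LinearMap.ker_eq_bot, eq_bot_iff, ← h0]
      exact fun x hx => by
        obtain ⟨m, rfl⟩ := Nat.exists_eq_add_of_le' hn1
        rw [LinearMap.mem_ker, pow_succ, Module.End.mul_apply, LinearMap.mem_ker.1 hx, map_zero]
    exact IsArtinian.bijective_of_injective_endomorphism f hinj
  · exact Or.inr ⟨n, LinearMap.range_eq_bot.1 h0⟩

theorem IsIndecomposableModule.isUnit_or_isUnit_of_add {M : Type w} [AddCommGroup M] [Module R M]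
    [IsNoetherian R M] [IsArtinian R M] (h : IsIndecomposableModule R M) {f g : Module.End R M}
    (hfg : IsUnit (f + g)) : IsUnit f ∨ IsUnit g := by
  obtain ⟨v, hv⟩ := hfg
  have h1 : ((v⁻¹ : (Module.End R M)ˣ) : Module.End R M) * f + ((v⁻¹ : (Module.End R M)ˣ) : Module.End R M) * g = 1 := by
    rw [← mul_add, ← hv, Units.inv_mul]
  rcases h.isUnit_or_isNilpotent (((v⁻¹ : (Module.End R M)ˣ) : Module.End R M) * f) with h2 | h2
  · exact Or.inl ((Units.isUnit_units_mul _ _).1 h2)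
  · refine Or.inr ((Units.isUnit_units_mul v⁻¹ _).1 ?_)
    rw [eq_sub_of_add_eq' h1]
    exact h2.isUnit_one_sub

theorem IsIndecomposableModule.exists_isUnit_of_sum {M : Type w} [AddCommGroup M] [Module R M]
    [IsNoetherian R M] [IsArtinian R M] (h : IsIndecomposableModule R M) {ι : Type*}
    (s : Finset ι) (f : ι → Module.End R M) (hf : IsUnit (∑ i ∈ s, f i)) : ∃ i, IsUnit (f i) := by
  classical
  induction s using Finset.induction_on with
  | empty =>
    have := h.1
    rw [Finset.sum_empty] at hf
    exact absurd hf not_isUnit_zero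
  | insert i s hi ih =>
    rw [Finset.sum_insert hi] at hf
    rcases h.isUnit_or_isUnit_of_add hf with h | h
    · exact ⟨i, h⟩
    · exact ih h

/-- The identity of `M` is a sum of endomorphisms factoring through the `N i`. The endomorphism ring
is local, so one of them is invertible. -/
theorem IsIndecomposableModule.exists_isSummand_of_pi {M : Type w} [AddCommGroup M] [Module R M]
    [IsNoetherian R M] [IsArtinian R M] (h : IsIndecomposableModule R M) {ι : Type*} [Finite ι]
    (N : ι → Type w₁) [∀ i, AddCommGroup (N i)] [∀ i, Module R (N i)]
    (hN : IsSummand R M (∀ i, N i)) : ∃ i, IsSummand R M (N i) := by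
  classical
  have := Fintype.ofFinite ι
  obtain ⟨s, r, hsr⟩ := hN
  obtain ⟨i, v, hv⟩ := h.exists_isUnit_of_sum Finset.univ
    (fun i => r ∘ₗ LinearMap.single R N i ∘ₗ LinearMap.proj i ∘ₗ s) (by
      convert isUnit_one
      rw [Module.End.one_eq_id, ← hsr]
      ext x
      simp only [LinearMap.sum_apply, LinearMap.comp_apply, LinearMap.proj_apply]
      rw [← map_sum]
      exact congrArg r (LinearMap.sum_single_apply N (s x)))
  refine ⟨i, LinearMap.proj i ∘ₗ s, ((v⁻¹ : (Module.End R M)ˣ) : Module.End R M) ∘ₗ r ∘ₗ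
    LinearMap.single R N i, ?_⟩
  have : ((v⁻¹ : (Module.End R M)ˣ) : Module.End R M) * (v : Module.End R M) = 1 := Units.inv_mul v
  rw [hv] at this
  exact this

theorem IsIndecomposableModule.nonempty_equiv_of_isSummand {M : Type w₁} [AddCommGroup M]
    [Module R M] {N : Type w₂} [AddCommGroup N] [Module R N] (hM : IsIndecomposableModule R M)
    (hN : IsIndecomposableModule R N) (h : IsSummand R M N) : Nonempty (M ≃ₗ[R] N) := by
  obtain ⟨s, r, hsr⟩ := h
  have hrs : ∀ x, r (s x) = x := fun x => LinearMap.congr_fun hsr x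
  have hinj : Function.Injective s := Function.LeftInverse.injective hrs
  have hc : IsCompl (LinearMap.range s) (LinearMap.ker r) := by
    constructor
    · rw [Submodule.disjoint_def]
      rintro _ ⟨x, rfl⟩ hx
      rw [LinearMap.mem_ker, hrs] at hx
      rw [hx, map_zero]
    · rw [codisjoint_iff, Submodule.eq_top_iff']
      intro x
      exact Submodule.mem_sup.2 ⟨s (r x), ⟨_, rfl⟩, x - s (r x), by simp [hrs], by simp⟩
  rcases hN.2 _ _ hc with h0 | h0
  · have := hM.1
    obtain ⟨x, hx⟩ := exists_ne (0 : M)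
    refine absurd (hinj ?_) hx
    rw [map_zero]
    exact (Submodule.mem_bot R).1 (h0 ▸ ⟨x, rfl⟩ : s x ∈ (⊥ : Submodule R N))
  · exact ⟨LinearEquiv.ofBijective s ⟨hinj, fun y => ⟨r y, LinearMap.ker_eq_bot.1 h0 (hrs _)⟩⟩⟩

/-- A module of finite length is a finite direct sum of indecomposable modules. -/
theorem exists_equiv_pi_indecomposable (M : Type w) [AddCommGroup M] [Module R M]
    [IsArtinian R M] : ∃ (ι : Type) (_ : Finite ι) (N : ι → ModuleCat.{w} R),
      (∀ i, IsIndecomposableModule R (N i)) ∧ Nonempty (M ≃ₗ[R] ∀ i, N i) := by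
  -- Inducting over submodules of the fixed module `M` makes its descending chain condition
  -- available for well-founded induction.
  suffices h : ∀ W : Submodule R M, ∃ (ι : Type) (_ : Finite ι) (N : ι → ModuleCat.{w} R),
      (∀ i, IsIndecomposableModule R (N i)) ∧ Nonempty (W ≃ₗ[R] ∀ i, N i) by
    obtain ⟨ι, hι, N, hN, ⟨e⟩⟩ := h ⊤
    exact ⟨ι, hι, N, hN, ⟨Submodule.topEquiv.symm.trans e⟩⟩
  intro W
  induction W using WellFoundedLT.induction with
  | ind W ih =>
  by_cases hW : IsIndecomposableModule R W
  · exact ⟨Unit, inferInstance, fun _ => ModuleCat.of R W, fun _ => hW,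
      ⟨(LinearEquiv.funUnique Unit R W).symm⟩⟩
  by_cases h0 : Nontrivial W
  · rw [IsIndecomposableModule, not_and] at hW
    have hW' := hW h0
    push Not at hW'
    obtain ⟨P, P', hc, hP, hP'⟩ := hW'
    have key : ∀ P P' : Submodule R W, IsCompl P P' → P' ≠ ⊥ →
        ∃ (ι : Type) (_ : Finite ι) (N : ι → ModuleCat.{w} R),
          (∀ i, IsIndecomposableModule R (N i)) ∧ Nonempty (P ≃ₗ[R] ∀ i, N i) := by
      intro P P' hc hP'
      have hlt : P.map W.subtype < W := by
        refine lt_of_le_of_ne (Submodule.map_subtype_le W P) fun he => hP' ?_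
        have : P = ⊤ := by
          rw [eq_top_iff]
          rintro ⟨x, hx⟩ -
          rw [← he] at hx
          obtain ⟨y, hy, rfl⟩ := hx
          exact hy
        rw [this] at hc
        exact hc.symm.disjoint.eq_bot_of_le le_top
      obtain ⟨ι, hι, N, hN, ⟨e⟩⟩ := ih _ hlt
      exact ⟨ι, hι, N, hN, ⟨(Submodule.equivMapOfInjective _ W.injective_subtype P).trans e⟩⟩
    obtain ⟨ι, hι, N, hN, ⟨e⟩⟩ := key P P' hc hP'
    obtain ⟨ι', hι', N', hN', ⟨e'⟩⟩ := key P' P hc.symm hP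
    refine ⟨ι ⊕ ι', inferInstance, Sum.elim N N', ?_,
      ⟨(Submodule.prodEquivOfIsCompl P P' hc).symm.trans ((e.prodCongr e').trans
        (LinearEquiv.sumPiEquivProdPi R ι ι' fun i => ↥(Sum.elim N N' i)).symm)⟩⟩
    rintro (i | i)
    · exact hN i
    · exact hN' i
  · rw [not_nontrivial_iff_subsingleton] at h0
    exact ⟨Empty, inferInstance, fun _ => ModuleCat.of R W, fun i => i.elim,
      ⟨LinearEquiv.ofBijective 0 ⟨Function.injective_of_subsingleton _,
        fun x => ⟨0, Subsingleton.elim _ _⟩⟩⟩⟩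

end Indecomposable

/-! ## CM-free and CM-finite rings -/

section CM

universe u w

variable {R : Type u} [Ring R]

theorem isCMFree_iff : IsCMFree R ↔ ∀ (M : Type u) [AddCommGroup M] [Module R M],
    IsGorensteinProjective R M → Module.Projective R M := by
  constructor
  · intro h M _ _ hM
    have := hM.finite
    exact (h M).1 hM
  · intro h M _ _ _
    exact ⟨h M, fun _ => isGorensteinProjective_of_projective M⟩

theorem IsCMFree.inAdd (h : IsCMFree R) {M : Type w} [AddCommGroup M] [Module R M]
    (hM : IsGorensteinProjective R M) : InAdd R R M := by
  have := hM.finite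
  obtain ⟨M', ⟨e⟩⟩ := Module.Finite.exists_small R M
  have := isCMFree_iff.1 h M' (hM.of_equiv e)
  have := Module.Projective.of_equiv e.symm
  exact inAdd_self_of_projective M

theorem isCMFree_of_inAdd (h : ∀ (M : Type u) [AddCommGroup M] [Module R M],
    IsGorensteinProjective R M → InAdd R R M) : IsCMFree R :=
  isCMFree_iff.2 fun M _ _ hM => (h M hM).projective

theorem IsCMFinite.exists_inAdd [IsArtinianRing R] (h : IsCMFinite R) :
    ∃ G : ModuleCat.{u} R, Module.Finite R G ∧ ∀ (M : Type w) [AddCommGroup M] [Module R M],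
      IsGorensteinProjective R M → InAdd R G M := by
  classical
  obtain ⟨n, E, hE⟩ := h
  -- The list in the definition of CM-finiteness may contain modules that are not finitely
  -- generated. They match no module in question and are replaced by zero, so that the product is
  -- finitely generated.
  let E' : Fin n → ModuleCat.{u} R := fun k =>
    if Module.Finite R (E k) then E k else ModuleCat.of R PUnit.{u + 1}
  have hfin : ∀ k, Module.Finite R (E' k) := by
    intro k
    by_cases hk : Module.Finite R (E k)
    · rwa [show E' k = E k from if_pos hk]
    · rw [show E' k = ModuleCat.of R PUnit.{u + 1} from if_neg hk]
      exact (inferInstance : Module.Finite R PUnit.{u + 1})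
  refine ⟨ModuleCat.of R (∀ k, E' k), (inferInstance : Module.Finite R (∀ k, E' k)), ?_⟩
  intro M _ _ hM
  have := hM.finite
  obtain ⟨M', ⟨e⟩⟩ := Module.Finite.exists_small R M
  have := Module.Finite.equiv e
  obtain ⟨ι, _, N, hN, ⟨e'⟩⟩ := exists_equiv_pi_indecomposable (R := R) M'
  have key : ∀ i, InAdd R (∀ k, E' k) (N i) := by
    intro i
    have hs : IsSummand R (N i) M' :=
      (IsSummand.pi (fun i => N i) i).trans e'.symm.isSummand
    have := hs.finite
    obtain ⟨k, ⟨e₁⟩⟩ := hE (N i) (hN i) ((hM.of_equiv e).of_isSummand hs)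
    have hk := Module.Finite.equiv e₁
    have hk' : E' k = E k := if_pos hk
    have h1 : IsSummand R (E k) (∀ k, E' k) := hk' ▸ IsSummand.pi (fun k => E' k) k
    exact (e₁.isSummand.trans h1).inAdd
  exact (InAdd.pi (fun i => N i) key).trans (e.trans e').isSummand.inAdd

/-- Krull-Schmidt: an indecomposable summand of a power of `G` is isomorphic to one of the finitely
many indecomposable summands of `G`, which form the required list. -/
theorem isCMFinite_of_inAdd [IsArtinianRing R] (G : Type w) [AddCommGroup G] [Module R G]
    [Module.Finite R G] (h : ∀ (M : Type u) [AddCommGroup M] [Module R M],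
      IsGorensteinProjective R M → InAdd R G M) : IsCMFinite R := by
  obtain ⟨G', ⟨e⟩⟩ := Module.Finite.exists_small R G
  have := Module.Finite.equiv e
  obtain ⟨ι, _, N, hN, ⟨e'⟩⟩ := exists_equiv_pi_indecomposable (R := R) G'
  obtain ⟨n, ⟨f⟩⟩ := Finite.exists_equiv_fin ι
  refine ⟨n, fun k => N (f.symm k), ?_⟩
  intro M _ _ _ hM hG
  obtain ⟨m, hm⟩ := (h M hG).exists_isSummand_pow
  obtain ⟨_, h1⟩ := hM.exists_isSummand_of_pi _ hm
  obtain ⟨i, h2⟩ := hM.exists_isSummand_of_pi _ (h1.trans (e.trans e').isSummand)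
  refine ⟨f i, ?_⟩
  beta_reduce
  rw [Equiv.symm_apply_apply]
  exact hM.nonempty_equiv_of_isSummand (hN i) h2

end CM

open scoped TensorProduct

/-! ## Restriction and induction along a non-unital ring homomorphism -/

section Restrict

universe u₁ u₂ w

variable {R : Type u₁} {S : Type u₂} [Ring R] [Ring S] (ι : R →ₙ+* S)

/-- The fixed points of `ι 1` on an `S`-module. -/
def restrictSubgroup (M : Type w) [AddCommGroup M] [Module S M] : AddSubgroup M where
  carrier := {m | ι 1 • m = m}
  add_mem' {x y} hx hy := by
    rw [Set.mem_ofPred_eq] at *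
    rw [smul_add, hx, hy]
  zero_mem' := smul_zero _
  neg_mem' {x} hx := by
    rw [Set.mem_ofPred_eq] at *
    rw [smul_neg, hx]

/-- The restriction of an `S`-module along a non-unital ring homomorphism `ι : R → S`: it is the
largest subgroup on which `R` acts unitally. -/
def Restrict (M : Type w) [AddCommGroup M] [Module S M] : Type w := restrictSubgroup ι M

namespace Restrict

variable {M : Type w} [AddCommGroup M] [Module S M]

instance : AddCommGroup (Restrict ι M) := inferInstanceAs (AddCommGroup (restrictSubgroup ι M))

/-- The inclusion of the restriction. -/
def val : Restrict ι M →+ M := (restrictSubgroup ι M).subtype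

variable {ι}

theorem val_injective : Function.Injective (val ι (M := M)) := Subtype.val_injective

theorem val_inj {x y : Restrict ι M} : val ι x = val ι y ↔ x = y := val_injective.eq_iff

@[simp] theorem one_smul_val (x : Restrict ι M) : ι 1 • val ι x = val ι x := x.2

variable (ι)

/-- The projection onto the restriction. -/
def proj : M →+ Restrict ι M where
  toFun m := ⟨ι 1 • m, by
    show ι 1 • ι 1 • m = ι 1 • m
    rw [smul_smul, ← map_mul, one_mul]⟩
  map_zero' := val_injective (smul_zero (ι 1))
  map_add' x y := val_injective (smul_add (ι 1) x y)

variable {ι}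

@[simp] theorem val_proj (m : M) : val ι (proj ι m) = ι 1 • m := rfl

@[simp] theorem proj_val (x : Restrict ι M) : proj ι (val ι x) = x :=
  val_injective (by simp)

instance : SMul R (Restrict ι M) := ⟨fun r x => proj ι (ι r • val ι x)⟩

@[simp] theorem val_smul (r : R) (x : Restrict ι M) : val ι (r • x) = ι r • val ι x := by
  show ι 1 • ι r • val ι x = _
  rw [smul_smul, ← map_mul, one_mul]

instance : Module R (Restrict ι M) where
  one_smul x := val_injective (by simp)
  mul_smul r s x := val_injective (by simp [mul_smul])
  smul_zero r := val_injective (by simp)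
  smul_add r x y := val_injective (by simp)
  add_smul r s x := val_injective (by simp [add_smul])
  zero_smul x := val_injective (by simp)

theorem smul_proj (r : R) (m : M) : r • proj ι m = proj ι (ι r • m) :=
  val_injective (by simp only [val_smul, val_proj, smul_smul, ← map_mul, one_mul, mul_one])

section map

variable {N : Type*} [AddCommGroup N] [Module S N] {L : Type*} [AddCommGroup L] [Module S L]

variable (ι)

/-- Restriction is functorial. -/
def map (f : M →ₗ[S] N) : Restrict ι M →ₗ[R] Restrict ι N where
  toFun x := proj ι (f (val ι x))
  map_add' x y := by simp
  map_smul' r x := val_injective (by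
    simp only [val_smul, val_proj, map_smul, RingHom.id_apply, smul_smul, ← map_mul, one_mul,
      mul_one])

variable {ι}

@[simp] theorem val_map (f : M →ₗ[S] N) (x : Restrict ι M) : val ι (map ι f x) = f (val ι x) := by
  show ι 1 • f (val ι x) = _
  rw [← map_smul, one_smul_val]

theorem map_id : map ι (LinearMap.id : M →ₗ[S] M) = LinearMap.id :=
  LinearMap.ext fun x => val_injective (by simp)

theorem map_comp (g : N →ₗ[S] L) (f : M →ₗ[S] N) : map ι (g ∘ₗ f) = map ι g ∘ₗ map ι f :=
  LinearMap.ext fun x => val_injective (by simp)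

theorem map_add (f g : M →ₗ[S] N) : map ι (f + g) = map ι f + map ι g :=
  LinearMap.ext fun x => val_injective (by simp)

theorem map_zero : map ι (0 : M →ₗ[S] N) = 0 :=
  LinearMap.ext fun x => val_injective (by simp)

theorem map_injective {f : M →ₗ[S] N} (hf : Function.Injective f) :
    Function.Injective (map ι f) := fun x y h =>
  val_injective (hf (by rw [← val_map, h, val_map]))

theorem map_surjective {f : M →ₗ[S] N} (hf : Function.Surjective f) :
    Function.Surjective (map ι f) := fun y => by
  obtain ⟨x, hx⟩ := hf (val ι y)
  exact ⟨proj ι x, val_injective (by simp [hx])⟩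

theorem map_exact {f : M →ₗ[S] N} {g : N →ₗ[S] L} (h : Function.Exact f g) :
    Function.Exact (map ι f) (map ι g) := by
  intro y
  rw [← val_inj, val_map, AddMonoidHom.map_zero, h]
  constructor
  · rintro ⟨x, hx⟩
    exact ⟨proj ι x, val_injective (by simp [hx])⟩
  · rintro ⟨x, rfl⟩
    exact ⟨val ι x, by simp⟩

end map

end Restrict

theorem InAdd.restrict {G M : Type*} [AddCommGroup G] [Module S G] [AddCommGroup M] [Module S M]
    (h : InAdd S G M) : InAdd R (Restrict ι G) (Restrict ι M) := by
  have key : ∀ f ∈ factorSums S G M M,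
      Restrict.map ι f ∈ factorSums R (Restrict ι G) (Restrict ι M) (Restrict ι M) := by
    intro f hf
    induction hf using AddSubmonoid.closure_induction with
    | mem x hx =>
      obtain ⟨s, r, rfl⟩ := hx
      rw [Restrict.map_comp]
      exact comp_mem_factorSums _ _
    | zero => rw [Restrict.map_zero]; exact zero_mem _
    | add x y _ _ hx hy => rw [Restrict.map_add]; exact add_mem hx hy
  have := key _ h
  rwa [Restrict.map_id] at this

end Restrict

theorem AddMonoidHom.map_zsmul_apply {S X N : Type*} [AddCommGroup S] [AddCommGroup X]
    [AddCommGroup N] (f : S →+ X →+ N) (n : ℤ) (s : S) (x : X) : f (n • s) x = f s (n • x) := by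
  rw [map_zsmul, map_zsmul, AddMonoidHom.zsmul_apply]

/-! ### Induction along a non-unital homomorphism, and Gorenstein projectivity of induced modules.
-/

section Induce

universe u₁ u₂ w

variable {R : Type u₁} {S : Type u₂} [Ring R] [Ring S] (ι : R →ₙ+* S)

/-- The relations of the tensor product over `R`. -/
def induceRel (X : Type w) [AddCommGroup X] [Module R X] : Submodule S (S ⊗[ℤ] X) :=
  Submodule.span S {t | ∃ (s : S) (r : R) (x : X), t = (s * ι r) ⊗ₜ[ℤ] x - s ⊗ₜ[ℤ] (r • x)}

/-- The induction `S ⊗ X` of an `R`-module along a non-unital ring homomorphism `ι : R → S`. -/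
def Induce (X : Type w) [AddCommGroup X] [Module R X] : Type (max u₂ w) :=
  (S ⊗[ℤ] X) ⧸ induceRel ι X

namespace Induce

variable {X : Type w} [AddCommGroup X] [Module R X]

instance : AddCommGroup (Induce ι X) := inferInstanceAs (AddCommGroup ((S ⊗[ℤ] X) ⧸ induceRel ι X))

instance : Module S (Induce ι X) := inferInstanceAs (Module S ((S ⊗[ℤ] X) ⧸ induceRel ι X))

/-- The quotient map. -/
def mk : S ⊗[ℤ] X →ₗ[S] Induce ι X := (induceRel ι X).mkQ

theorem mk_surjective : Function.Surjective (mk ι (X := X)) := Submodule.mkQ_surjective _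

theorem mk_eq_zero {t : S ⊗[ℤ] X} : mk ι t = 0 ↔ t ∈ induceRel ι X :=
  Submodule.Quotient.mk_eq_zero _

/-- Pure tensors. -/
def tmul (s : S) (x : X) : Induce ι X := mk ι (s ⊗ₜ[ℤ] x)

variable {ι}

theorem tmul_add (s : S) (x y : X) : tmul ι s (x + y) = tmul ι s x + tmul ι s y := by
  simp only [tmul, TensorProduct.tmul_add, map_add]

theorem add_tmul (s t : S) (x : X) : tmul ι (s + t) x = tmul ι s x + tmul ι t x := by
  simp only [tmul, TensorProduct.add_tmul, map_add]

theorem tmul_zero (s : S) : tmul ι s (0 : X) = 0 := by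
  simp only [tmul, TensorProduct.tmul_zero, map_zero]

theorem zero_tmul (x : X) : tmul ι 0 x = 0 := by
  simp only [tmul, TensorProduct.zero_tmul, map_zero]

theorem smul_tmul (s t : S) (x : X) : s • tmul ι t x = tmul ι (s * t) x := rfl

theorem mul_tmul (s : S) (r : R) (x : X) : tmul ι (s * ι r) x = tmul ι s (r • x) := by
  rw [← sub_eq_zero, tmul, tmul, ← map_sub, mk_eq_zero]
  exact Submodule.subset_span ⟨s, r, x, rfl⟩

theorem mul_one_tmul (s : S) (x : X) : tmul ι (s * ι 1) x = tmul ι s x := by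
  rw [mul_tmul, one_smul]

@[elab_as_elim]
theorem induction_on {p : Induce ι X → Prop} (z : Induce ι X) (zero : p 0)
    (tmul : ∀ s x, p (tmul ι s x)) (add : ∀ x y, p x → p y → p (x + y)) : p z := by
  obtain ⟨t, rfl⟩ := mk_surjective ι z
  induction t using TensorProduct.induction_on with
  | zero => rw [map_zero]; exact zero
  | tmul s x => exact tmul s x
  | add x y hx hy => rw [map_add]; exact add _ _ hx hy

/-- The additive map given by a balanced biadditive map. -/
def liftAdd {N : Type*} [AddCommGroup N] (f : S →+ X →+ N)
    (hf : ∀ s r x, f (s * ι r) x = f s (r • x)) : Induce ι X →+ N :=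
  QuotientAddGroup.lift (induceRel ι X).toAddSubgroup
    (TensorProduct.liftAddHom f (AddMonoidHom.map_zsmul_apply f)) (by
      intro t ht
      -- The relations are an `S`-span but the map is only additive, so the induction must carry an
      -- arbitrary left multiplier.
      have key : ∀ s : S, TensorProduct.liftAddHom f (AddMonoidHom.map_zsmul_apply f) (s • t) = 0 := by
        induction ht using Submodule.span_induction with
        | mem t ht =>
          obtain ⟨s', r, x, rfl⟩ := ht
          intro s
          rw [smul_sub, TensorProduct.smul_tmul', TensorProduct.smul_tmul', map_sub,
            TensorProduct.liftAddHom_tmul, TensorProduct.liftAddHom_tmul, smul_eq_mul, smul_eq_mul,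
            ← mul_assoc, hf, sub_self]
        | zero => intro s; rw [smul_zero, map_zero]
        | add x y _ _ hx hy => intro s; rw [smul_add, map_add, hx, hy, add_zero]
        | smul a x _ hx => intro s; rw [smul_smul, hx]
      have := key 1
      rwa [one_smul] at this)

theorem liftAdd_tmul {N : Type*} [AddCommGroup N] (f : S →+ X →+ N)
    (hf : ∀ s r x, f (s * ι r) x = f s (r • x)) (s : S) (x : X) :
    liftAdd f hf (tmul ι s x) = f s x :=
  TensorProduct.liftAddHom_tmul (R := ℤ) f (AddMonoidHom.map_zsmul_apply f) s x

/-- The additive map underlying `Induce.lift`. -/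
def liftAux {N : Type*} [AddCommGroup N] [Module S N] (f : X →+ N)
    (hf : ∀ (r : R) (x : X), f (r • x) = ι r • f x) : Induce ι X →+ N :=
  liftAdd (ι := ι)
    { toFun := fun s => (DistribSMul.toAddMonoidHom N s).comp f
      map_zero' := by ext; simp
      map_add' := fun s t => by ext; simp [add_smul] }
    (fun s r x => by simp [hf, mul_smul])

theorem liftAux_tmul {N : Type*} [AddCommGroup N] [Module S N] (f : X →+ N)
    (hf : ∀ (r : R) (x : X), f (r • x) = ι r • f x) (s : S) (x : X) :
    liftAux f hf (tmul ι s x) = s • f x :=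
  liftAdd_tmul _ _ s x

/-- The linear map given by a semilinear map. -/
def lift {N : Type*} [AddCommGroup N] [Module S N] (f : X →+ N)
    (hf : ∀ (r : R) (x : X), f (r • x) = ι r • f x) : Induce ι X →ₗ[S] N :=
  { liftAux f hf with
    map_smul' := fun s z => by
      show liftAux f hf (s • z) = s • liftAux f hf z
      induction z using induction_on with
      | zero => simp
      | tmul t x => rw [smul_tmul, liftAux_tmul, liftAux_tmul, mul_smul]
      | add x y hx hy => rw [smul_add, map_add, hx, hy, map_add, smul_add] }

@[simp] theorem lift_tmul {N : Type*} [AddCommGroup N] [Module S N] (f : X →+ N)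
    (hf : ∀ (r : R) (x : X), f (r • x) = ι r • f x) (s : S) (x : X) :
    lift f hf (tmul ι s x) = s • f x :=
  liftAux_tmul f hf s x

/-- The adjoint of a map to a restriction. -/
def adj {N : Type*} [AddCommGroup N] [Module S N] (f : X →ₗ[R] Restrict ι N) : Induce ι X →ₗ[S] N :=
  lift ((Restrict.val ι).comp f.toAddMonoidHom) (fun r x =>
    (congrArg (Restrict.val ι) (f.map_smul r x)).trans (Restrict.val_smul r (f x)))

@[simp] theorem adj_tmul {N : Type*} [AddCommGroup N] [Module S N] (f : X →ₗ[R] Restrict ι N)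
    (s : S) (x : X) : adj f (tmul ι s x) = s • Restrict.val ι (f x) :=
  lift_tmul _ _ s x

theorem hom_ext {N : Type*} [AddCommGroup N] [Module S N] {f g : Induce ι X →ₗ[S] N}
    (h : ∀ x, f (tmul ι 1 x) = g (tmul ι 1 x)) : f = g := by
  ext z
  induction z using induction_on with
  | zero => simp
  | tmul s x => rw [← mul_one s, ← smul_tmul, map_smul, map_smul, h]
  | add x y hx hy => rw [map_add, map_add, hx, hy]

variable {Y : Type*} [AddCommGroup Y] [Module R Y] {Z : Type*} [AddCommGroup Z] [Module R Z]

variable (ι) in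
/-- The unit of the adjunction between induction and restriction. -/
def unit : X →ₗ[R] Restrict ι (Induce ι X) where
  toFun x := Restrict.proj ι (tmul ι 1 x)
  map_add' x y := by rw [tmul_add, map_add]
  map_smul' r x := by
    rw [RingHom.id_apply, Restrict.smul_proj, smul_tmul, mul_one, ← mul_tmul, one_mul]

@[simp] theorem val_unit (x : X) : Restrict.val ι (unit ι x) = tmul ι 1 x := by
  show ι 1 • tmul ι 1 x = _
  rw [smul_tmul, mul_one, ← one_mul (ι 1), mul_one_tmul]

variable (ι) in
/-- Induction is functorial. -/
def map (f : X →ₗ[R] Y) : Induce ι X →ₗ[S] Induce ι Y :=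
  adj (unit ι ∘ₗ f)

@[simp] theorem map_tmul (f : X →ₗ[R] Y) (s : S) (x : X) :
    map ι f (tmul ι s x) = tmul ι s (f x) := by
  simp [map, smul_tmul]

theorem map_id : map ι (LinearMap.id : X →ₗ[R] X) = LinearMap.id := hom_ext fun x => by simp

theorem map_comp (g : Y →ₗ[R] Z) (f : X →ₗ[R] Y) : map ι (g ∘ₗ f) = map ι g ∘ₗ map ι f :=
  hom_ext fun x => by simp

theorem map_add (f g : X →ₗ[R] Y) : map ι (f + g) = map ι f + map ι g :=
  hom_ext fun x => by simp [tmul_add]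

theorem map_zero : map ι (0 : X →ₗ[R] Y) = 0 := hom_ext fun x => by simp [tmul_zero]

theorem map_surjective {f : X →ₗ[R] Y} (hf : Function.Surjective f) :
    Function.Surjective (map ι f) := fun z => by
  induction z using induction_on with
  | zero => exact ⟨0, LinearMap.map_zero _⟩
  | tmul s y =>
    obtain ⟨x, rfl⟩ := hf y
    exact ⟨tmul ι s x, map_tmul f s x⟩
  | add x y hx hy =>
    obtain ⟨a, rfl⟩ := hx
    obtain ⟨b, rfl⟩ := hy
    exact ⟨a + b, LinearMap.map_add _ _ _⟩

variable (R) in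
-- `S ⊗_R R` is `S ι(1)`, and right multiplication by `ι(1)` retracts `S` onto it.
theorem isSummand_self : IsSummand S (Induce ι R) S := by
  have h : ∀ r x : R, (ι : R →+ S) (r • x) = ι r • (ι : R →+ S) x := fun r x => map_mul ι r x
  refine ⟨lift (ι : R →+ S) h, LinearMap.toSpanSingleton S _ (tmul ι 1 1), hom_ext fun x => ?_⟩
  rw [LinearMap.comp_apply, lift_tmul, LinearMap.toSpanSingleton_apply, LinearMap.id_apply,
    one_smul, smul_tmul, mul_one, AddMonoidHom.coe_coe, ← one_mul (ι x), mul_tmul, smul_eq_mul, mul_one]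

end Induce

variable {ι} in
theorem InAdd.induce {G X : Type*} [AddCommGroup G] [Module R G] [AddCommGroup X] [Module R X]
    (h : InAdd R G X) (ι : R →ₙ+* S) : InAdd S (Induce ι G) (Induce ι X) := by
  have key : ∀ f ∈ factorSums R G X X,
      Induce.map ι f ∈ factorSums S (Induce ι G) (Induce ι X) (Induce ι X) := by
    intro f hf
    induction hf using AddSubmonoid.closure_induction with
    | mem x hx =>
      obtain ⟨s, r, rfl⟩ := hx
      rw [Induce.map_comp]
      exact comp_mem_factorSums _ _
    | zero => rw [Induce.map_zero]; exact zero_mem _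
    | add x y _ _ hx hy => rw [Induce.map_add]; exact add_mem hx hy
  have := key _ h
  rwa [Induce.map_id] at this

theorem InAdd.induce_self {X : Type*} [AddCommGroup X] [Module R X] (h : InAdd R R X) :
    InAdd S S (Induce ι X) :=
  (Induce.isSummand_self R).inAdd.trans (h.induce ι)

instance Induce.finite (X : Type*) [AddCommGroup X] [Module R X] [Module.Finite R X] :
    Module.Finite S (Induce ι X) := by
  obtain ⟨n, f, hf⟩ := Module.Finite.exists_fin' R X
  have := (InAdd.induce_self ι (inAdd_self_of_projective (R := R) (Fin n → R))).finite
  exact Module.Finite.of_surjective _ (Induce.map_surjective hf)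

/-- A finite dual basis of `S * ι 1` as a right `R`-module: it exists if and only if this module is
finitely generated projective. -/
def HasRightDualBasis : Prop :=
  ∃ (κ : Type) (_ : Fintype κ) (u : κ → S) (f : κ → S →+ R),
    (∀ k s r, f k (s * ι r) = f k s * r) ∧ ∀ s, s * ι 1 = ∑ k, u k * ι (f k s)

variable {ι}

namespace Induce

variable {X : Type*} [AddCommGroup X] [Module R X] {Y : Type*} [AddCommGroup Y] [Module R Y]

/-- The map `f ⊗ X`, for a right linear map `f`. -/
def coord (f : S →+ R) (hf : ∀ s r, f (s * ι r) = f s * r)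
    (X : Type*) [AddCommGroup X] [Module R X] : Induce ι X →+ X :=
  liftAdd
    { toFun := fun s => DistribSMul.toAddMonoidHom X (f s)
      map_zero' := by ext; simp
      map_add' := fun s t => by ext; simp [add_smul] }
    (fun s r x => by simp [hf, mul_smul])

@[simp] theorem coord_tmul (f : S →+ R) (hf : ∀ s r, f (s * ι r) = f s * r) (s : S) (x : X) :
    coord f hf X (tmul ι s x) = f s • x :=
  liftAdd_tmul _ _ s x

theorem coord_map (f : S →+ R) (hf : ∀ s r, f (s * ι r) = f s * r) (g : X →ₗ[R] Y)
    (z : Induce ι X) : coord f hf Y (map ι g z) = g (coord f hf X z) := by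
  induction z using induction_on with
  | zero => simp
  | tmul s x => simp
  | add x y hx hy => simp [hx, hy]

theorem sum_tmul {κ : Type*} (t : Finset κ) (g : κ → S) (x : X) :
    tmul ι (∑ k ∈ t, g k) x = ∑ k ∈ t, tmul ι (g k) x :=
  map_sum (⟨⟨fun s => tmul ι s x, zero_tmul x⟩, fun s t => add_tmul s t x⟩ : S →+ Induce ι X) g t

/-- A dual basis of `S ι(1)` describes elements of `S ⊗_R X` by finitely many coordinates in `X`,
natural in `X`. This replaces flatness in the proofs that induction is exact. -/
theorem eq_sum_coord {κ : Type*} [Fintype κ] (u : κ → S) (f : κ → S →+ R)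
    (hf : ∀ k s r, f k (s * ι r) = f k s * r) (h : ∀ s, s * ι 1 = ∑ k, u k * ι (f k s))
    (z : Induce ι X) : z = ∑ k, tmul ι (u k) (coord (f k) (hf k) X z) := by
  induction z using induction_on with
  | zero => simp [tmul_zero]
  | tmul s x =>
    conv_lhs => rw [← mul_one_tmul, h, sum_tmul]
    exact Finset.sum_congr rfl fun k _ => by rw [coord_tmul, mul_tmul]
  | add x y hx hy =>
    conv_lhs => rw [hx, hy]
    rw [← Finset.sum_add_distrib]
    exact Finset.sum_congr rfl fun k _ => by rw [_root_.map_add, tmul_add]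

end Induce

namespace HasRightDualBasis

variable {X : Type*} [AddCommGroup X] [Module R X] {Y : Type*} [AddCommGroup Y] [Module R Y]
  {Z : Type*} [AddCommGroup Z] [Module R Z]

theorem map_injective (h : HasRightDualBasis ι) {g : X →ₗ[R] Y} (hg : Function.Injective g) :
    Function.Injective (Induce.map ι g) := by
  obtain ⟨κ, _, u, f, hf, h⟩ := h
  rw [injective_iff_map_eq_zero]
  intro z hz
  rw [Induce.eq_sum_coord u f hf h z]
  refine Finset.sum_eq_zero fun k _ => ?_
  have : g (Induce.coord (f k) (hf k) X z) = g 0 := by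
    rw [← Induce.coord_map, hz, map_zero, map_zero]
  rw [hg this, Induce.tmul_zero]

theorem map_exact (h : HasRightDualBasis ι) {g : X →ₗ[R] Y} {g' : Y →ₗ[R] Z}
    (hg : Function.Exact g g') : Function.Exact (Induce.map ι g) (Induce.map ι g') := by
  obtain ⟨κ, _, u, f, hf, h⟩ := h
  intro z
  constructor
  · intro hz
    have : ∀ k, ∃ x, g x = Induce.coord (f k) (hf k) Y z := fun k => (hg _).1 (by
      rw [← Induce.coord_map, hz, map_zero])
    choose x hx using this
    refine ⟨∑ k, Induce.tmul ι (u k) (x k), ?_⟩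
    rw [map_sum]
    conv_rhs => rw [Induce.eq_sum_coord u f hf h z]
    exact Finset.sum_congr rfl fun k _ => by rw [Induce.map_tmul, hx]
  · rintro ⟨x, rfl⟩
    have : Induce.map ι g' ∘ₗ Induce.map ι g = 0 := by
      rw [← Induce.map_comp, hg.linearMap_comp_eq_zero, Induce.map_zero]
    exact LinearMap.congr_fun this x

end HasRightDualBasis

variable {X : Type*} [AddCommGroup X] [Module R X] {Y : Type*} [AddCommGroup Y] [Module R Y]

/-- The dual basis `hr` keeps the sequence exact. A functional on `S ⊗_R X` is adjoint to an `R`-map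
from `X` to the restriction of `S`; since the latter lies in `add R` by `hl`, this map extends. -/
theorem GorStep.induce (h : GorStep R X Y) (hr : HasRightDualBasis ι)
    (hl : InAdd R R (Restrict ι S)) : GorStep S (Induce ι X) (Induce ι Y) := by
  obtain ⟨P, f, g, _, _, hf, hg, hfg, hext⟩ := h
  have := (InAdd.induce_self ι (inAdd_self_of_projective (R := R) P)).projective
  refine GorStep.intro (Induce.map ι f) (Induce.map ι g) (hr.map_injective hf)
    (Induce.map_surjective hg) (hr.map_exact hfg) fun φ => ?_
  obtain ⟨ψ, hψ⟩ := hl.extends f hext (Restrict.map ι φ ∘ₗ Induce.unit ι)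
  refine ⟨Induce.adj ψ, Induce.hom_ext fun x => ?_⟩
  have := LinearMap.congr_fun hψ x
  simp only [LinearMap.comp_apply] at this
  rw [LinearMap.comp_apply, Induce.map_tmul, Induce.adj_tmul, one_smul, this, Restrict.val_map, Induce.val_unit]

theorem IsSummand.induce (h : IsSummand R X Y) (ι : R →ₙ+* S) :
    IsSummand S (Induce ι X) (Induce ι Y) := by
  obtain ⟨s, r, h⟩ := h
  exact ⟨Induce.map ι s, Induce.map ι r, by rw [← Induce.map_comp, h, Induce.map_id]⟩

theorem IsGorensteinProjective.induce (h : IsGorensteinProjective R X) (hr : HasRightDualBasis ι)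
    (hl : InAdd R R (Restrict ι S)) : IsGorensteinProjective S (Induce ι X) := by
  have := h.finite
  obtain ⟨X', ⟨e⟩⟩ := Module.Finite.exists_small R X
  refine (isGorensteinProjective_of_class (fun M : ModuleCat.{max u₁ u₂} S =>
    ∃ X : ModuleCat.{u₁} R, IsGorensteinProjective R X ∧ M = ModuleCat.of S (Induce ι X)) ?_ ?_
    (ModuleCat.of S (Induce ι X')) ⟨X', h.of_equiv e, rfl⟩).of_isSummand (e.isSummand.induce ι)
  · rintro _ ⟨X, hX, rfl⟩
    obtain ⟨Y, hY, hs⟩ := hX.exists_right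
    exact ⟨_, ⟨Y, hY, rfl⟩, hs.induce hr hl⟩
  · rintro _ ⟨X, hX, rfl⟩
    obtain ⟨Y, hY, hs⟩ := hX.exists_left
    exact ⟨_, ⟨Y, hY, rfl⟩, hs.induce hr hl⟩

end Induce

/-! ## Gluing two algebras at an idempotent -/

section Exactness

variable {R : Type*} [Ring R] {L M N P : Type*} [AddCommGroup L] [Module R L] [AddCommGroup M]
  [Module R M] [AddCommGroup N] [Module R N] [AddCommGroup P] [Module R P]

theorem Function.Exact.exists_desc {f : L →ₗ[R] M} {g : M →ₗ[R] N} (h : Function.Exact f g)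
    (hg : Function.Surjective g) (φ : M →ₗ[R] P) (hφ : φ ∘ₗ f = 0) :
    ∃ φ' : N →ₗ[R] P, φ' ∘ₗ g = φ := by
  have hle : LinearMap.ker g ≤ LinearMap.ker φ := by
    intro x hx
    obtain ⟨y, rfl⟩ := (h x).1 hx
    exact LinearMap.congr_fun hφ y
  refine ⟨(LinearMap.ker g).liftQ φ hle ∘ₗ (g.quotKerEquivOfSurjective hg).symm.toLinearMap, ?_⟩
  ext x
  have : (g.quotKerEquivOfSurjective hg).symm (g x) = Submodule.Quotient.mk x := by
    rw [LinearEquiv.symm_apply_eq]; rfl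
  simp [this]

theorem Function.Exact.exists_lift {f : L →ₗ[R] M} {g : M →ₗ[R] N} (h : Function.Exact f g)
    (hf : Function.Injective f) (φ : P →ₗ[R] M) (hφ : g ∘ₗ φ = 0) :
    ∃ φ' : P →ₗ[R] L, f ∘ₗ φ' = φ := by
  have hr : ∀ x, φ x ∈ LinearMap.range f := fun x => (h _).1 (LinearMap.congr_fun hφ x)
  refine ⟨(LinearEquiv.ofInjective f hf).symm.toLinearMap ∘ₗ φ.codRestrict _ hr, ?_⟩
  ext x
  exact congrArg Subtype.val ((LinearEquiv.ofInjective f hf).apply_symm_apply ⟨φ x, hr x⟩)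

end Exactness

/-! ### Algebras glued at an idempotent, and the contraction formulas for the derivation. -/

section Gluing

universe uK uA uB uL w w'

/-- `S` is generated by the algebras `A` and `B`, glued at the idempotents `εA` and `εB`, without
further relations (which is expressed by the existence of a derivation `D`), and it retracts onto
`A` and `B`. -/
structure GluingData (K : Type uK) (A : Type uA) (B : Type uB) (S : Type uL) [Field K] [Ring A]
    [Ring B] [Ring S] [Algebra K A] [Algebra K B] [Algebra K S] where
  ιA : A →ₙ+* S
  ιB : B →ₙ+* S
  ιA_smul : ∀ (c : K) a, ιA (c • a) = c • ιA a
  ιB_smul : ∀ (c : K) b, ιB (c • b) = c • ιB b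
  εA : A
  εB : B
  ε_eq : ιB εB = ιA εA
  mulAB : ιA 1 * ιB 1 = ιA εA
  mulBA : ιB 1 * ιA 1 = ιA εA
  add_one : ιA 1 + ιB 1 = 1 + ιA εA
  πA : S →ₐ[K] A
  πB : S →ₐ[K] B
  πA_ιA : ∀ a, πA (ιA a) = a
  πA_ιB : ∀ b, ∃ c : K, πA (ιB b) = c • εA
  πB_ιB : ∀ b, πB (ιB b) = b
  πB_ιA : ∀ a, ∃ c : K, πB (ιA a) = c • εB
  D : S →ₗ[K] S ⊗[K] S
  D_mul : ∀ x y, D (x * y) = (x ⊗ₜ 1) * D y + D x * (1 ⊗ₜ y)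
  D_ιA : ∀ a, D (ιA a) = (ιA a * ιA εA) ⊗ₜ ιA εA - ιA εA ⊗ₜ (ιA εA * ιA a)
  D_ιB : ∀ b, D (ιB b) = 0
  adjoin_eq : Algebra.adjoin K (Set.range ιA ∪ Set.range ιB) = ⊤

namespace GluingData

variable {K : Type uK} {A : Type uA} {B : Type uB} {S : Type uL} [Field K] [Ring A] [Ring B]
  [Ring S] [Algebra K A] [Algebra K B] [Algebra K S] (d : GluingData K A B S)

/-- The idempotent at which `A` and `B` are glued. -/
def ε : S := d.ιA d.εA

theorem ιA_εA : d.ιA d.εA = d.ε := rfl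

theorem ιB_εB : d.ιB d.εB = d.ε := d.ε_eq

theorem one_mul_ιA (a : A) : d.ιA 1 * d.ιA a = d.ιA a := by rw [← map_mul, one_mul]

theorem ιA_mul_one (a : A) : d.ιA a * d.ιA 1 = d.ιA a := by rw [← map_mul, mul_one]

theorem one_mul_ιB (b : B) : d.ιB 1 * d.ιB b = d.ιB b := by rw [← map_mul, one_mul]

theorem ιB_mul_one (b : B) : d.ιB b * d.ιB 1 = d.ιB b := by rw [← map_mul, mul_one]

theorem oneA_mul_ε : d.ιA 1 * d.ε = d.ε := d.one_mul_ιA _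

theorem ε_mul_oneA : d.ε * d.ιA 1 = d.ε := d.ιA_mul_one _

theorem oneB_mul_ε : d.ιB 1 * d.ε = d.ε := by rw [← ιB_εB, one_mul_ιB]

theorem ε_mul_oneB : d.ε * d.ιB 1 = d.ε := by rw [← ιB_εB, ιB_mul_one]

/-- Idempotence need not be assumed: `ε = e_A e_B`, and `ε` absorbs both units on its right. -/
theorem ε_mul_ε : d.ε * d.ε = d.ε := by
  have h : d.ε = d.ιA 1 * d.ιB 1 := d.mulAB.symm
  nth_rw 2 [h]
  rw [← mul_assoc, ε_mul_oneA, ε_mul_oneB]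

theorem oneA_mul_ιB (b : B) : d.ιA 1 * d.ιB b = d.ε * d.ιB b := by
  rw [← one_mul_ιB, ← mul_assoc, d.mulAB, ← mul_assoc]
  rw [ιA_εA, ε_mul_oneB]

theorem ιB_mul_oneA (b : B) : d.ιB b * d.ιA 1 = d.ιB b * d.ε := by
  rw [← ιB_mul_one, mul_assoc, d.mulBA, mul_assoc, oneB_mul_ε, ιA_εA]

theorem oneB_mul_ιA (a : A) : d.ιB 1 * d.ιA a = d.ε * d.ιA a := by
  rw [← one_mul_ιA, ← mul_assoc, d.mulBA, ← mul_assoc]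
  rw [ιA_εA, ε_mul_oneA]

theorem ιA_mul_oneB (a : A) : d.ιA a * d.ιB 1 = d.ιA a * d.ε := by
  rw [← ιA_mul_one, mul_assoc, d.mulAB, mul_assoc, oneA_mul_ε, ιA_εA]

theorem one_eq : (1 : S) = d.ιA 1 + d.ιB 1 - d.ε := by
  rw [d.add_one, ιA_εA, add_sub_cancel_right]

theorem D_one : d.D 1 = 0 := by
  have h := d.D_mul 1 1
  rw [mul_one, ← Algebra.TensorProduct.one_def, one_mul, mul_one] at h
  exact left_eq_add.1 h

theorem D_ιA' (a : A) : d.D (d.ιA a) = (d.ιA a * d.ε) ⊗ₜ d.ε - d.ε ⊗ₜ (d.ε * d.ιA a) := d.D_ιA a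

theorem smul_eq (c : K) (x : S) :
    c • x = d.ιA (c • 1) * x + d.ιB (c • 1) * x + d.ιA (-(c • d.εA)) * x := by
  rw [d.ιA_smul, d.ιB_smul, map_neg, d.ιA_smul, ← add_mul, ← add_mul, ← smul_add, ← sub_eq_add_neg,
    ← smul_sub, ιA_εA, ← one_eq, smul_one_mul]

theorem smul_eq' (c : K) (x : S) :
    c • x = x * d.ιA (c • 1) + x * d.ιB (c • 1) + x * d.ιA (-(c • d.εA)) := by
  rw [d.ιA_smul, d.ιB_smul, map_neg, d.ιA_smul, ← mul_add, ← mul_add, ← smul_add, ← sub_eq_add_neg,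
    ← smul_sub, ιA_εA, ← one_eq, mul_smul_one]

/-- `S` is generated by `A` and `B`, and `1 = e_A + e_B - ε` rewrites multiplication by a scalar as
multiplications by elements of `A` and `B`. Hence no scalar case is required. -/
theorem left_induction {p : S → Prop} (one : p 1) (add : ∀ x y, p x → p y → p (x + y))
    (mulA : ∀ a x, p x → p (d.ιA a * x)) (mulB : ∀ b x, p x → p (d.ιB b * x)) (x : S) : p x := by
  have h : x ∈ Algebra.adjoin K (Set.range d.ιA ∪ Set.range d.ιB) := d.adjoin_eq ▸ trivial
  suffices ∀ y, p y → p (x * y) by simpa using this 1 one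
  induction h using Algebra.adjoin_induction with
  | mem x hx =>
    rcases hx with ⟨a, rfl⟩ | ⟨b, rfl⟩
    · exact mulA a
    · exact mulB b
  | algebraMap c =>
    intro y hy
    rw [← Algebra.smul_def, d.smul_eq]
    exact add _ _ (add _ _ (mulA _ _ hy) (mulB _ _ hy)) (mulA _ _ hy)
  | add x y _ _ hx hy =>
    intro z hz
    rw [add_mul]
    exact add _ _ (hx z hz) (hy z hz)
  | mul x y _ _ hx hy =>
    intro z hz
    rw [mul_assoc]
    exact hx _ (hy z hz)

theorem right_induction {p : S → Prop} (one : p 1) (add : ∀ x y, p x → p y → p (x + y))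
    (mulA : ∀ a x, p x → p (x * d.ιA a)) (mulB : ∀ b x, p x → p (x * d.ιB b)) (x : S) : p x := by
  have h : x ∈ Algebra.adjoin K (Set.range d.ιA ∪ Set.range d.ιB) := d.adjoin_eq ▸ trivial
  suffices ∀ y, p y → p (y * x) by simpa using this 1 one
  induction h using Algebra.adjoin_induction with
  | mem x hx =>
    rcases hx with ⟨a, rfl⟩ | ⟨b, rfl⟩
    · exact mulA a
    · exact mulB b
  | algebraMap c =>
    intro y hy
    rw [← Algebra.commutes, ← Algebra.smul_def, d.smul_eq']
    exact add _ _ (add _ _ (mulA _ _ hy) (mulB _ _ hy)) (mulA _ _ hy)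
  | add x y _ _ hx hy =>
    intro z hz
    rw [mul_add]
    exact add _ _ (hx z hz) (hy z hz)
  | mul x y _ _ hx hy =>
    intro z hz
    rw [← mul_assoc]
    exact hy _ (hx z hz)

/-- The gluing data with the roles of the two algebras exchanged. -/
def swap : GluingData K B A S where
  ιA := d.ιB
  ιB := d.ιA
  ιA_smul := d.ιB_smul
  ιB_smul := d.ιA_smul
  εA := d.εB
  εB := d.εA
  ε_eq := d.ε_eq.symm
  mulAB := d.mulBA.trans d.ε_eq.symm
  mulBA := d.mulAB.trans d.ε_eq.symm
  add_one := by rw [add_comm, d.add_one, d.ε_eq]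
  πA := d.πB
  πB := d.πA
  πA_ιA := d.πB_ιB
  πA_ιB := d.πB_ιA
  πB_ιB := d.πA_ιA
  πB_ιA := d.πA_ιB
  -- The inner derivation of `ε ⊗ ε` on all of `S` minus `D` is inner on `B` and zero on `A`.
  D := (LinearMap.mulRight K (d.ε ⊗ₜ[K] d.ε)) ∘ₗ Algebra.TensorProduct.includeLeft.toLinearMap -
    (LinearMap.mulLeft K (d.ε ⊗ₜ[K] d.ε)) ∘ₗ Algebra.TensorProduct.includeRight.toLinearMap - d.D
  D_mul x y := by
    simp only [LinearMap.sub_apply, LinearMap.comp_apply, LinearMap.mulRight_apply,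
      LinearMap.mulLeft_apply, AlgHom.toLinearMap_apply, map_mul, d.D_mul,
      Algebra.TensorProduct.includeLeft_apply, Algebra.TensorProduct.includeRight_apply]
    noncomm_ring
  D_ιA b := by
    simp [d.D_ιB, ιB_εB]
  D_ιB a := by
    simp [d.D_ιA']
  adjoin_eq := by rw [Set.union_comm]; exact d.adjoin_eq

theorem πA_ε : d.πA d.ε = d.εA := d.πA_ιA _

/-- The map `x ⊗ y ↦ π x * y`. -/
def leftContract : S ⊗[K] S →ₗ[K] S :=
  TensorProduct.lift ((LinearMap.mul K S) ∘ₗ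
    ({ toFun := fun x => d.ιA (d.πA x)
       map_add' := fun x y => by simp
       map_smul' := fun c x => by simp [d.ιA_smul] } : S →ₗ[K] S))

theorem leftContract_tmul (x y : S) : d.leftContract (x ⊗ₜ y) = d.ιA (d.πA x) * y := rfl

theorem leftContract_mul_left (x : S) (t : S ⊗[K] S) :
    d.leftContract ((x ⊗ₜ 1) * t) = d.ιA (d.πA x) * d.leftContract t := by
  induction t using TensorProduct.induction_on with
  | zero => simp
  | tmul y z => simp [leftContract_tmul, mul_assoc]
  | add s t hs ht => simp [mul_add, hs, ht]

theorem leftContract_mul_right (y : S) (t : S ⊗[K] S) :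
    d.leftContract (t * (1 ⊗ₜ y)) = d.leftContract t * y := by
  induction t using TensorProduct.induction_on with
  | zero => simp
  | tmul y z => simp [leftContract_tmul, mul_assoc]
  | add s t hs ht => simp [add_mul, hs, ht]

/-- The map `x ⊗ y ↦ x * π y`. -/
def rightContract : S ⊗[K] S →ₗ[K] S :=
  TensorProduct.lift ((LinearMap.mul K S).compl₂
    ({ toFun := fun x => d.ιA (d.πA x)
       map_add' := fun x y => by simp
       map_smul' := fun c x => by simp [d.ιA_smul] } : S →ₗ[K] S))

theorem rightContract_tmul (x y : S) : d.rightContract (x ⊗ₜ y) = x * d.ιA (d.πA y) := rfl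

theorem rightContract_mul_left (x : S) (t : S ⊗[K] S) :
    d.rightContract ((x ⊗ₜ 1) * t) = x * d.rightContract t := by
  induction t using TensorProduct.induction_on with
  | zero => simp
  | tmul y z => simp [rightContract_tmul, mul_assoc]
  | add s t hs ht => simp [mul_add, hs, ht]

theorem rightContract_mul_right (y : S) (t : S ⊗[K] S) :
    d.rightContract (t * (1 ⊗ₜ y)) = d.rightContract t * d.ιA (d.πA y) := by
  induction t using TensorProduct.induction_on with
  | zero => simp
  | tmul y z => simp [rightContract_tmul, mul_assoc]
  | add s t hs ht => simp [add_mul, hs, ht]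

/-- This is a normal form for `e_A x` as a left `A`-module element. Replacing the left tensor
factors of `D x` by their images in `A` leaves only the correction terms shown. Multiplication by
`A` is matched by the inner part of `D`; multiplication by `B` acts on left factors through a scalar
multiple of `ε`. -/
theorem oneA_mul_eq (x : S) : d.ιA 1 * x =
    d.ιA (d.πA x) * (d.ιA 1 - d.ε) + d.leftContract (d.D x) + d.ε * x := by
  refine d.left_induction (p := fun x => d.ιA 1 * x =
    d.ιA (d.πA x) * (d.ιA 1 - d.ε) + d.leftContract (d.D x) + d.ε * x) ?_ ?_ ?_ ?_ x
  · rw [D_one, map_one d.πA, map_zero, mul_sub, oneA_mul_ε, one_mul_ιA]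
    simp
  · intro x y hx hy
    simp only [mul_add, hx, hy, map_add, add_mul]
    abel
  · intro a x hx
    have h : d.leftContract (d.D (d.ιA a * x)) =
        d.ιA a * d.leftContract (d.D x) + d.ιA a * d.ε * x - d.ε * d.ιA a * x := by
      rw [d.D_mul, D_ιA', map_add, leftContract_mul_left, d.πA_ιA, leftContract_mul_right, map_sub,
        leftContract_tmul, leftContract_tmul, map_mul, d.πA_ιA, πA_ε, map_mul, ιA_εA, mul_assoc _ d.ε,
        ← mul_assoc d.ε d.ε, ε_mul_ε, sub_mul, add_sub_assoc]
    calc d.ιA 1 * (d.ιA a * x) = d.ιA a * (d.ιA 1 * x) := by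
          rw [← mul_assoc, one_mul_ιA, ← mul_assoc, ιA_mul_one]
      _ = d.ιA a * (d.ιA (d.πA x) * (d.ιA 1 - d.ε) + d.leftContract (d.D x) + d.ε * x) := by
          rw [hx]
      _ = _ := by
          rw [h, map_mul d.πA, d.πA_ιA, map_mul]
          noncomm_ring
  · intro b x hx
    obtain ⟨c, hc⟩ := d.πA_ιB b
    -- Multiply the induction hypothesis by `ε`: both sides contain `ε x`, so the remaining terms
    -- cancel.
    have key : d.ε * d.ιA (d.πA x) * (d.ιA 1 - d.ε) + d.ε * d.leftContract (d.D x) = 0 := by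
      have := congrArg (d.ε * ·) hx
      simp only [mul_add, ← mul_assoc, ε_mul_oneA, ε_mul_ε] at this
      exact right_eq_add.1 this
    rw [← mul_assoc, oneA_mul_ιB, d.D_mul, d.D_ιB, zero_mul, add_zero, leftContract_mul_left,
      map_mul, hc, smul_mul_assoc, d.ιA_smul, d.ιA_smul, map_mul, ιA_εA, smul_mul_assoc,
      smul_mul_assoc, ← smul_add, key, smul_zero, zero_add, mul_assoc]

/-- The mirror image of `oneA_mul_eq`. Contracting the right factor reverses the sign of the `D`
term, because the commutator defining `D` on `A` is antisymmetric between the two sides. -/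
theorem mul_oneA_eq (x : S) : x * d.ιA 1 =
    (d.ιA 1 - d.ε) * d.ιA (d.πA x) - d.rightContract (d.D x) + x * d.ε := by
  refine d.right_induction (p := fun x => x * d.ιA 1 =
    (d.ιA 1 - d.ε) * d.ιA (d.πA x) - d.rightContract (d.D x) + x * d.ε) ?_ ?_ ?_ ?_ x
  · rw [D_one, map_one d.πA, map_zero, sub_mul, ε_mul_oneA, one_mul_ιA]
    simp
  · intro x y hx hy
    simp only [mul_add, hx, hy, map_add, add_mul]
    abel
  · intro a x hx
    have h : d.rightContract (d.D (x * d.ιA a)) =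
        x * d.ιA a * d.ε - x * d.ε * d.ιA a + d.rightContract (d.D x) * d.ιA a := by
      rw [d.D_mul, D_ιA', map_add, rightContract_mul_left, rightContract_mul_right, d.πA_ιA, map_sub,
        rightContract_tmul, rightContract_tmul, map_mul, d.πA_ιA, πA_ε, map_mul, ιA_εA,
        mul_assoc _ d.ε, ← mul_assoc d.ε d.ε, ε_mul_ε, mul_sub, mul_assoc, mul_assoc]
    calc x * d.ιA a * d.ιA 1 = x * d.ιA 1 * d.ιA a := by
          rw [mul_assoc, mul_assoc, one_mul_ιA, ιA_mul_one]
      _ = ((d.ιA 1 - d.ε) * d.ιA (d.πA x) - d.rightContract (d.D x) + x * d.ε) * d.ιA a := by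
          rw [hx]
      _ = _ := by
          rw [h, map_mul d.πA, d.πA_ιA, map_mul]
          noncomm_ring
  · intro b x hx
    obtain ⟨c, hc⟩ := d.πA_ιB b
    have key : (d.ιA 1 - d.ε) * d.ιA (d.πA x) * d.ε - d.rightContract (d.D x) * d.ε = 0 := by
      have := congrArg (· * d.ε) hx
      simp only [add_mul, sub_mul, mul_assoc, oneA_mul_ε, ε_mul_ε] at this
      have := right_eq_add.1 this
      simpa only [sub_mul, mul_assoc] using this
    rw [mul_assoc, ιB_mul_oneA, d.D_mul, d.D_ιB, mul_zero, zero_add, rightContract_mul_right,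
      map_mul, hc, mul_smul_comm, d.ιA_smul, d.ιA_smul, map_mul, ιA_εA, mul_smul_comm,
      mul_smul_comm, ← smul_sub, ← mul_assoc (d.ιA 1 - d.ε), key, smul_zero, zero_add, mul_assoc]

end GluingData
end Gluing

section Gluing

universe uK uA uB uL w w'

namespace GluingData

variable {K : Type uK} {A : Type uA} {B : Type uB} {S : Type uL} [Field K] [Ring A] [Ring B]
  [Ring S] [Algebra K A] [Algebra K B] [Algebra K S] (d : GluingData K A B S)

/-! ### Projectivity of the glued algebra over its parts -/

section Contract

variable [Module.Finite K S]

/-- Contraction of the right factor with a coordinate functional. -/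
noncomputable def rightCoord (j : Fin (Module.finrank K S)) : S ⊗[K] S →ₗ[K] S :=
  TensorProduct.lift ((LinearMap.lsmul K S).flip.compl₂ ((Module.finBasis K S).coord j))

/-- Contraction of the left factor with a coordinate functional. -/
noncomputable def leftCoord (j : Fin (Module.finrank K S)) : S ⊗[K] S →ₗ[K] S :=
  TensorProduct.lift ((LinearMap.lsmul K S) ∘ₗ ((Module.finBasis K S).coord j))

theorem rightCoord_tmul (j) (x y : S) :
    rightCoord (K := K) j (x ⊗ₜ y) = (Module.finBasis K S).coord j y • x := rfl

theorem leftCoord_tmul (j) (x y : S) :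
    leftCoord (K := K) j (x ⊗ₜ y) = (Module.finBasis K S).coord j x • y := rfl

theorem rightCoord_mul (j) (x : S) (t : S ⊗[K] S) :
    rightCoord j ((x ⊗ₜ 1) * t) = x * rightCoord j t := by
  induction t using TensorProduct.induction_on with
  | zero => simp
  | tmul y z => simp [rightCoord_tmul]
  | add s t hs ht => simp [mul_add, hs, ht]

theorem leftCoord_mul (j) (x : S) (t : S ⊗[K] S) :
    leftCoord j (t * (1 ⊗ₜ x)) = leftCoord j t * x := by
  induction t using TensorProduct.induction_on with
  | zero => simp
  | tmul y z => simp [leftCoord_tmul]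
  | add s t hs ht => simp [add_mul, hs, ht]

theorem leftContract_eq_sum (t : S ⊗[K] S) :
    d.leftContract t = ∑ j, d.ιA (d.πA (rightCoord j t)) * Module.finBasis K S j := by
  induction t using TensorProduct.induction_on with
  | zero => simp
  | tmul x y =>
    rw [leftContract_tmul]
    conv_lhs => rw [← (Module.finBasis K S).sum_repr y, Finset.mul_sum]
    exact Finset.sum_congr rfl fun j _ => by
      rw [rightCoord_tmul, map_smul, d.ιA_smul, smul_mul_assoc, mul_smul_comm]; rfl
  | add s t hs ht => simp [hs, ht, add_mul, Finset.sum_add_distrib]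

theorem rightContract_eq_sum (t : S ⊗[K] S) :
    d.rightContract t = ∑ j, Module.finBasis K S j * d.ιA (d.πA (leftCoord j t)) := by
  induction t using TensorProduct.induction_on with
  | zero => simp
  | tmul x y =>
    rw [rightContract_tmul]
    conv_lhs => rw [← (Module.finBasis K S).sum_repr x, Finset.sum_mul]
    exact Finset.sum_congr rfl fun j _ => by
      rw [leftCoord_tmul, map_smul, d.ιA_smul, smul_mul_assoc, mul_smul_comm]; rfl
  | add s t hs ht => simp [hs, ht, mul_add, Finset.sum_add_distrib]

/-- Expand the left tensor factor of `D x` in a `K`-basis of `S` and insert it in `mul_oneA_eq`. The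
dual basis is this `K`-basis together with `e_A - ε`, whose coordinate is `πA`. The term `x ε` is
absorbed into the other coordinates, and this correction makes them right `A`-linear by cancelling
the inner part of `D`. -/
theorem hasRightDualBasis : HasRightDualBasis d.ιA := by
  let f : Fin (Module.finrank K S) → S →ₗ[K] A := fun j =>
    d.πA.toLinearMap ∘ₗ (((Module.finBasis K S).coord j).smulRight d.ε ∘ₗ
      LinearMap.mulRight K d.ε - leftCoord j ∘ₗ d.D)
  have hf : ∀ j x, f j x =
      d.πA ((Module.finBasis K S).coord j (x * d.ε) • d.ε - leftCoord j (d.D x)) := fun j x => rfl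
  refine ⟨Option (Fin (Module.finrank K S)), inferInstance,
    fun k => k.elim (d.ιA 1 - d.ε) (Module.finBasis K S),
    fun k => k.elim d.πA.toLinearMap.toAddMonoidHom fun j => (f j).toAddMonoidHom, ?_, ?_⟩
  · rintro (_ | j) x a
    · show d.πA (x * d.ιA a) = d.πA x * a
      rw [map_mul, d.πA_ιA]
    · show f j (x * d.ιA a) = f j x * a
      conv_rhs => rw [← d.πA_ιA a]
      rw [hf, hf, ← map_mul]
      congr 1
      rw [d.D_mul, D_ιA', map_add, leftCoord_mul, mul_sub, Algebra.TensorProduct.tmul_mul_tmul,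
        Algebra.TensorProduct.tmul_mul_tmul, one_mul, one_mul, map_sub, leftCoord_tmul,
        leftCoord_tmul, sub_mul, smul_mul_assoc, mul_assoc x]
      abel
  · intro x
    rw [Fintype.sum_option, mul_oneA_eq, rightContract_eq_sum]
    show _ = (d.ιA 1 - d.ε) * d.ιA (d.πA x) + ∑ j, Module.finBasis K S j * d.ιA (f j x)
    have h : ∀ j, Module.finBasis K S j * d.ιA (f j x) =
        ((Module.finBasis K S).coord j (x * d.ε) • Module.finBasis K S j) * d.ε -
          Module.finBasis K S j * d.ιA (d.πA (leftCoord j (d.D x))) := by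
      intro j
      rw [hf, map_sub, map_sub, mul_sub, map_smul, d.ιA_smul, πA_ε, ιA_εA, mul_smul_comm,
        smul_mul_assoc]
    have h' : ∑ j, (Module.finBasis K S).coord j (x * d.ε) • Module.finBasis K S j = x * d.ε :=
      (Module.finBasis K S).sum_repr _
    rw [Finset.sum_congr rfl fun j _ => h j, Finset.sum_sub_distrib, ← Finset.sum_mul, h',
      mul_assoc, ε_mul_ε]
    abel

/-- Left multiplication on a fixed element. -/
def restrictMulRight (x : S) : A →ₗ[A] Restrict d.ιA S where
  toFun a := Restrict.proj d.ιA (d.ιA a * x)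
  map_add' a b := by rw [map_add, add_mul, map_add]
  map_smul' a b := by
    rw [RingHom.id_apply, Restrict.smul_proj, smul_eq_mul, smul_eq_mul, map_mul d.ιA, mul_assoc]

/-- The left-handed version: `oneA_mul_eq` writes the identity of `e_A S` as a sum of an `A`-linear
coordinate followed by right multiplication by a fixed element. -/
theorem inAdd_restrict : InAdd A A (Restrict d.ιA S) := by
  let f : Fin (Module.finrank K S) → S →ₗ[K] A := fun j =>
    d.πA.toLinearMap ∘ₗ (((Module.finBasis K S).coord j).smulRight d.ε ∘ₗ
      LinearMap.mulLeft K d.ε + rightCoord j ∘ₗ d.D)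
  have hf : ∀ j x, f j x =
      d.πA ((Module.finBasis K S).coord j (d.ε * x) • d.ε + rightCoord j (d.D x)) := fun j x => rfl
  have hlin : ∀ j a x, f j (d.ιA a * x) = a * f j x := by
    intro j a x
    conv_rhs => rw [← d.πA_ιA a]
    rw [hf, hf, ← map_mul]
    congr 1
    rw [d.D_mul, D_ιA', map_add, rightCoord_mul, sub_mul, Algebra.TensorProduct.tmul_mul_tmul,
      Algebra.TensorProduct.tmul_mul_tmul, mul_one, mul_one, map_sub, rightCoord_tmul,
      rightCoord_tmul, mul_add, mul_smul_comm, mul_assoc d.ε]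
    abel
  let s : Fin (Module.finrank K S) → Restrict d.ιA S →ₗ[A] A := fun j =>
    { toFun := fun x => f j (Restrict.val d.ιA x)
      map_add' := fun x y => by simp
      map_smul' := fun a x => by rw [Restrict.val_smul, smul_eq_mul, hlin]; rfl }
  let s₀ : Restrict d.ιA S →ₗ[A] A :=
    { toFun := fun x => d.πA (Restrict.val d.ιA x)
      map_add' := fun x y => by simp
      map_smul' := fun a x => by
        rw [Restrict.val_smul, smul_eq_mul, map_mul, d.πA_ιA]; rfl }
  have key : (LinearMap.id : Restrict d.ιA S →ₗ[A] Restrict d.ιA S) =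
      d.restrictMulRight (d.ιA 1 - d.ε) ∘ₗ s₀ +
        ∑ j, d.restrictMulRight (Module.finBasis K S j) ∘ₗ s j := by
    refine LinearMap.ext fun x => Restrict.val_injective ?_
    rw [LinearMap.add_apply, LinearMap.sum_apply, map_add, map_sum]
    show Restrict.val d.ιA x = d.ιA 1 * (d.ιA (d.πA (Restrict.val d.ιA x)) * (d.ιA 1 - d.ε)) +
      ∑ j, d.ιA 1 * (d.ιA (f j (Restrict.val d.ιA x)) * Module.finBasis K S j)
    have hx : Restrict.val d.ιA x = d.ιA 1 * Restrict.val d.ιA x := (Restrict.one_smul_val x).symm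
    generalize Restrict.val d.ιA x = y at hx
    have h : ∀ j, d.ιA 1 * (d.ιA (f j y) * Module.finBasis K S j) =
        d.ε * ((Module.finBasis K S).coord j (d.ε * y) • Module.finBasis K S j) +
          d.ιA (d.πA (rightCoord j (d.D y))) * Module.finBasis K S j := by
      intro j
      rw [← mul_assoc, one_mul_ιA, hf, map_add, map_add, add_mul, map_smul, d.ιA_smul, πA_ε, ιA_εA,
        mul_smul_comm, smul_mul_assoc]
    have h' : ∑ j, (Module.finBasis K S).coord j (d.ε * y) • Module.finBasis K S j = d.ε * y :=
      (Module.finBasis K S).sum_repr _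
    rw [Finset.sum_congr rfl fun j _ => h j, Finset.sum_add_distrib, ← Finset.mul_sum, h',
      ← mul_assoc d.ε, ε_mul_ε, ← leftContract_eq_sum, ← mul_assoc, one_mul_ιA]
    rw [← add_assoc, add_right_comm, ← oneA_mul_eq]
    exact hx
  rw [InAdd, key]
  exact add_mem (comp_mem_factorSums _ _) (sum_mem fun j _ => comp_mem_factorSums _ _)

end Contract

/-! ### The base field as the common part -/

/-- The embedding of `K` at the gluing idempotent. -/
def ιK : K →ₙ+* S where
  toFun c := c • d.ε
  map_zero' := zero_smul _ _
  map_add' c c' := add_smul _ _ _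
  map_mul' c c' := by rw [smul_mul_smul_comm, ε_mul_ε]

theorem ιK_apply (c : K) : d.ιK c = c • d.ε := rfl

theorem ιK_one : d.ιK 1 = d.ε := one_smul _ _

theorem inAdd_restrict_ιK [Module.Finite K S] : InAdd K K (Restrict d.ιK S) := by
  let v : Restrict d.ιK S →ₗ[K] S :=
    { toFun := Restrict.val d.ιK
      map_add' := map_add _
      map_smul' := fun c x => by
        have h : d.ε * Restrict.val d.ιK x = Restrict.val d.ιK x := by
          rw [← ιK_one]; exact Restrict.one_smul_val x
        rw [Restrict.val_smul, ιK_apply, smul_eq_mul, smul_mul_assoc, h, RingHom.id_apply] }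
  have := Module.Finite.of_injective v Restrict.val_injective
  exact inAdd_self_of_projective _

end GluingData
end Gluing

section Gluing

universe uK uA uB uL w w'

namespace GluingData

variable {K : Type uK} {A : Type uA} {B : Type uB} {S : Type uL} [Field K] [Ring A] [Ring B]
  [Ring S] [Algebra K A] [Algebra K B] [Algebra K S] (d : GluingData K A B S)

/-! ### The Mayer-Vietoris sequence -/

section MayerVietoris

variable (M : Type*) [AddCommGroup M] [Module S M]

/-- The module induced from the restriction of `M` to the gluing vertex. -/
abbrev Vert := Induce d.ιK (Restrict d.ιK M)

/-- The sum of the modules induced from the restrictions of `M` to the two algebras. -/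
abbrev Parts := Induce d.ιA (Restrict d.ιA M) × Induce d.ιB (Restrict d.ιB M)

variable {M}

theorem proj_eq_of_smul_eq {R : Type*} [Ring R] {ι : R →ₙ+* S} {m m' : M}
    (h : ι 1 • m = ι 1 • m') : Restrict.proj ι m = Restrict.proj ι m' :=
  Restrict.val_injective h

theorem tmul_ε_projA (s : S) (m : M) :
    Induce.tmul d.ιA (s * d.ε) (Restrict.proj d.ιA m) =
      Induce.tmul d.ιA s (Restrict.proj d.ιA (d.ε • m)) := by
  rw [← ιA_εA, Induce.mul_tmul, Restrict.smul_proj]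

theorem tmul_ε_projB (s : S) (m : M) :
    Induce.tmul d.ιB (s * d.ε) (Restrict.proj d.ιB m) =
      Induce.tmul d.ιB s (Restrict.proj d.ιB (d.ε • m)) := by
  rw [← ιB_εB, Induce.mul_tmul, Restrict.smul_proj]

/-- The element `s ε ⊗ m` in the two summands, with opposite signs. -/
def antidiag (s : S) (m : M) : d.Parts M :=
  (Induce.tmul d.ιA (s * d.ε) (Restrict.proj d.ιA m),
    -Induce.tmul d.ιB (s * d.ε) (Restrict.proj d.ιB m))

theorem smul_antidiag (s t : S) (m : M) : s • d.antidiag t m = d.antidiag (s * t) m := by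
  rw [antidiag, antidiag, Prod.smul_mk, smul_neg, Induce.smul_tmul, Induce.smul_tmul, mul_assoc]

theorem antidiag_ε (s : S) (m : M) : d.antidiag s (d.ε • m) = d.antidiag s m := by
  rw [antidiag, antidiag, ← tmul_ε_projA, ← tmul_ε_projB, mul_assoc, ε_mul_ε]

variable (M) in
/-- The left map of the Mayer-Vietoris sequence. -/
def vertToParts : d.Vert M →ₗ[S] d.Parts M :=
  Induce.lift
    { toFun := fun m => d.antidiag 1 (Restrict.val d.ιK m)
      map_zero' := by simp [antidiag, Induce.tmul_zero]
      map_add' := fun x y => by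
        simp only [antidiag, map_add, Induce.tmul_add, Prod.mk_add_mk, neg_add] }
    (fun c m => by
      show d.antidiag 1 (Restrict.val d.ιK (c • m)) = d.ιK c • d.antidiag 1 (Restrict.val d.ιK m)
      rw [Restrict.val_smul, smul_antidiag, ιK_apply, mul_one]
      have h : (c • d.ε) * d.ε = 1 * d.ε * d.ιA (c • d.εA) := by
        rw [one_mul, d.ιA_smul, ιA_εA, smul_mul_assoc, mul_smul_comm]
      have h' : (c • d.ε) * d.ε = 1 * d.ε * d.ιB (c • d.εB) := by
        rw [one_mul, d.ιB_smul, ιB_εB, smul_mul_assoc, mul_smul_comm]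
      rw [antidiag, antidiag]
      congr 1
      · rw [h, Induce.mul_tmul, Restrict.smul_proj, d.ιA_smul, ιA_εA]
      · rw [h', Induce.mul_tmul, Restrict.smul_proj, d.ιB_smul, ιB_εB])

theorem vertToParts_tmul (s : S) (m : Restrict d.ιK M) :
    d.vertToParts M (Induce.tmul d.ιK s m) = d.antidiag s (Restrict.val d.ιK m) := by
  rw [vertToParts, Induce.lift_tmul]
  show s • d.antidiag 1 _ = _
  rw [smul_antidiag, mul_one]

theorem antidiag_mem (s : S) (m : M) : d.antidiag s m ∈ LinearMap.range (d.vertToParts M) := by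
  refine ⟨Induce.tmul d.ιK s (Restrict.proj d.ιK m), ?_⟩
  rw [vertToParts_tmul, Restrict.val_proj, ιK_one, antidiag_ε]

variable (M) in
/-- The right map of the Mayer-Vietoris sequence. -/
def partsTo : d.Parts M →ₗ[S] M :=
  (Induce.adj LinearMap.id).coprod (Induce.adj LinearMap.id)

theorem partsTo_tmul (s t : S) (x : Restrict d.ιA M) (y : Restrict d.ιB M) :
    d.partsTo M (Induce.tmul d.ιA s x, Induce.tmul d.ιB t y) =
      s • Restrict.val d.ιA x + t • Restrict.val d.ιB y := by
  simp [partsTo]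

theorem partsTo_comp_vertToParts : d.partsTo M ∘ₗ d.vertToParts M = 0 := by
  refine Induce.hom_ext fun m => ?_
  rw [LinearMap.comp_apply, vertToParts_tmul, antidiag, one_mul, LinearMap.zero_apply]
  have h : -Induce.tmul d.ιB d.ε (Restrict.proj d.ιB (Restrict.val d.ιK m)) =
      Induce.tmul d.ιB (-d.ε) (Restrict.proj d.ιB (Restrict.val d.ιK m)) := by
    rw [eq_comm, ← sub_eq_zero, sub_neg_eq_add, ← Induce.add_tmul, neg_add_cancel, Induce.zero_tmul]
  rw [h, partsTo_tmul, Restrict.val_proj, Restrict.val_proj, smul_smul, smul_smul, ε_mul_oneA,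
    neg_mul, ε_mul_oneB, neg_smul, add_neg_cancel]

/-- An additive section of `partsTo`. -/
def sect : M →+ d.Parts M where
  -- The coefficients split `1` as `e_A + (e_B - ε)`. With `ε` counted on the `A` side, the section
  -- commutes exactly with `A`, and with `B` up to antidiagonal elements.
  toFun m := (Induce.tmul d.ιA 1 (Restrict.proj d.ιA m),
    Induce.tmul d.ιB (d.ιB 1 - d.ε) (Restrict.proj d.ιB m))
  map_zero' := by simp [Induce.tmul_zero]
  map_add' x y := by simp [Induce.tmul_add]

theorem sect_apply (m : M) : d.sect m = (Induce.tmul d.ιA 1 (Restrict.proj d.ιA m),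
    Induce.tmul d.ιB (d.ιB 1 - d.ε) (Restrict.proj d.ιB m)) := rfl

theorem partsTo_sect (m : M) : d.partsTo M (d.sect m) = m := by
  rw [sect_apply, partsTo_tmul, Restrict.val_proj, Restrict.val_proj, one_smul, smul_smul, ← add_smul,
    sub_mul, one_mul_ιB, ε_mul_oneB, ← add_sub_assoc, ← one_eq, one_smul]

theorem partsTo_surjective : Function.Surjective (d.partsTo M) := fun m => ⟨_, d.partsTo_sect m⟩

theorem tmulB_sub (s : S) (y : Restrict d.ιB M) :
    Induce.tmul d.ιB (s * (d.ιB 1 - d.ε)) y = Induce.tmul d.ιB s y - Induce.tmul d.ιB (s * d.ε) y := by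
  rw [mul_sub, eq_sub_iff_add_eq, ← Induce.add_tmul, sub_add_cancel, Induce.mul_one_tmul]

theorem tmulB_oneA (a : A) (m : M) :
    Induce.tmul d.ιB (d.ιB 1 - d.ε) (Restrict.proj d.ιB (d.ιA a • m)) = 0 := by
  rw [← one_mul (d.ιB 1 - d.ε), tmulB_sub, one_mul, ← one_mul d.ε, tmul_ε_projB, sub_eq_zero]
  congr 1
  apply proj_eq_of_smul_eq
  simp only [smul_smul, ← mul_assoc, oneB_mul_ιA, oneB_mul_ε]

theorem tmulA_ιB (b : B) (m : M) : Induce.tmul d.ιA 1 (Restrict.proj d.ιA (d.ιB b • m)) =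
    Induce.tmul d.ιA d.ε (Restrict.proj d.ιA (d.ιB b • m)) := by
  rw [← one_mul d.ε, tmul_ε_projA]
  congr 1
  apply proj_eq_of_smul_eq
  simp only [smul_smul, ← mul_assoc, oneA_mul_ιB, oneA_mul_ε]

theorem smul_sect_ιA (a : A) (m : M) : d.ιA a • d.sect m = d.sect (d.ιA a • m) := by
  have h : d.ιA a * (d.ιB 1 - d.ε) = 0 := by rw [mul_sub, ιA_mul_oneB, sub_self]
  rw [sect_apply, sect_apply, tmulB_oneA, Prod.smul_mk, Induce.smul_tmul, Induce.smul_tmul, h,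
    Induce.zero_tmul, mul_one, ← Restrict.smul_proj, ← Induce.mul_tmul, one_mul]

theorem smul_sect_ιB (b : B) (m : M) :
    d.ιB b • d.sect m - d.antidiag (d.ιB b) m = d.sect (d.ιB b • m) - d.antidiag 1 (d.ιB b • m) := by
  rw [sect_apply, sect_apply, antidiag, antidiag, Prod.smul_mk, Prod.mk_sub_mk, Prod.mk_sub_mk,
    Induce.smul_tmul, Induce.smul_tmul, tmulB_sub, ← one_mul (d.ιB 1 - d.ε), tmulB_sub, mul_one]
  congr 1
  · rw [one_mul, tmulA_ιB, sub_self, ← Induce.mul_one_tmul, ιB_mul_oneA, sub_self]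
  · rw [sub_neg_eq_add, sub_add_cancel, sub_neg_eq_add, sub_add_cancel, ← Restrict.smul_proj,
      ← Induce.mul_tmul, one_mul]

/-- The section is linear modulo the image of the vertex term; it suffices to compare the actions of
the generators in `A` and `B`. -/
theorem smul_sect_sub_mem (s : S) (m : M) :
    s • d.sect m - d.sect (s • m) ∈ LinearMap.range (d.vertToParts M) := by
  refine d.left_induction
    (p := fun s => ∀ m : M, s • d.sect m - d.sect (s • m) ∈ LinearMap.range (d.vertToParts M))
    ?_ ?_ ?_ ?_ s m
  · intro m
    simp
  · intro x y hx hy m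
    have := add_mem (hx m) (hy m)
    rwa [sub_add_sub_comm, ← add_smul, ← map_add, ← add_smul] at this
  · intro a x hx m
    have := Submodule.smul_mem _ (d.ιA a) (hx m)
    rwa [smul_sub, smul_smul, smul_sect_ιA, smul_smul] at this
  · intro b x hx m
    have h₁ := Submodule.smul_mem _ (d.ιB b) (hx m)
    have h₂ := d.smul_sect_ιB b (x • m)
    have h₃ := sub_mem (d.antidiag_mem (d.ιB b) (x • m)) (d.antidiag_mem 1 (d.ιB b • x • m))
    have := add_mem h₁ h₃
    rw [smul_sub, smul_smul] at this
    rw [← smul_smul _ x m]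
    convert this using 1
    rw [sub_eq_sub_iff_add_eq_add, add_comm] at h₂
    rw [← sub_eq_zero] at h₂ ⊢
    rw [← h₂]
    abel

/-- A generator `s ⊗ x` of the `A` part is `s • sect x`, and one of the `B` part differs from such
an element by an antidiagonal. Linearity of the section modulo the image then gives exactness in the
middle. -/
theorem sub_sect_mem (z : d.Parts M) :
    z - d.sect (d.partsTo M z) ∈ LinearMap.range (d.vertToParts M) := by
  have hA : ∀ z : Induce d.ιA (Restrict d.ιA M),
      ((z, 0) : d.Parts M) - d.sect (d.partsTo M (z, 0)) ∈ LinearMap.range (d.vertToParts M) := by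
    intro z
    induction z using Induce.induction_on with
    | zero => rw [Prod.mk_zero_zero, map_zero, map_zero, sub_zero]; exact zero_mem _
    | tmul s x =>
      have h : ((Induce.tmul d.ιA s x, 0) : d.Parts M) = s • d.sect (Restrict.val d.ιA x) := by
        rw [sect_apply, ← Restrict.one_smul_val x, tmulB_oneA, Restrict.one_smul_val,
          Restrict.proj_val, Prod.smul_mk, smul_zero, Induce.smul_tmul, mul_one]
      rw [h, map_smul, partsTo_sect]
      exact d.smul_sect_sub_mem _ _
    | add x y hx hy =>
      have := add_mem hx hy
      rwa [sub_add_sub_comm, ← map_add, ← map_add, Prod.mk_add_mk, add_zero] at this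
  have hB : ∀ z : Induce d.ιB (Restrict d.ιB M),
      ((0, z) : d.Parts M) - d.sect (d.partsTo M (0, z)) ∈ LinearMap.range (d.vertToParts M) := by
    intro z
    induction z using Induce.induction_on with
    | zero => rw [Prod.mk_zero_zero, map_zero, map_zero, sub_zero]; exact zero_mem _
    | tmul s y =>
      have h : ((0, Induce.tmul d.ιB s y) : d.Parts M) =
          s • d.sect (Restrict.val d.ιB y) - d.antidiag s (Restrict.val d.ιB y) := by
        have h1 : Induce.tmul d.ιA 1 (Restrict.proj d.ιA (Restrict.val d.ιB y)) =
            Induce.tmul d.ιA d.ε (Restrict.proj d.ιA (Restrict.val d.ιB y)) := by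
          rw [← Restrict.one_smul_val y, tmulA_ιB]
        rw [sect_apply, h1, antidiag, Prod.smul_mk, Prod.mk_sub_mk, Induce.smul_tmul,
          Induce.smul_tmul, sub_self, tmulB_sub, sub_neg_eq_add, sub_add_cancel, Restrict.proj_val]
      have h2 : d.partsTo M (0, Induce.tmul d.ιB s y) = s • Restrict.val d.ιB y := by
        simp [partsTo]
      rw [h2, h, sub_right_comm]
      exact sub_mem (d.smul_sect_sub_mem _ _) (d.antidiag_mem _ _)
    | add x y hx hy =>
      have := add_mem hx hy
      rwa [sub_add_sub_comm, ← map_add, ← map_add, Prod.mk_add_mk, add_zero] at this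
  have := add_mem (hA z.1) (hB z.2)
  rwa [sub_add_sub_comm, ← map_add, ← map_add, Prod.mk_add_mk, add_zero, zero_add] at this

theorem exact_vertToParts_partsTo : Function.Exact (d.vertToParts M) (d.partsTo M) := by
  intro z
  constructor
  · intro hz
    have := d.sub_sect_mem z
    rwa [hz, map_zero, sub_zero] at this
  · rintro ⟨x, rfl⟩
    exact LinearMap.congr_fun d.partsTo_comp_vertToParts x

/-- The map `(x ⊗ y) ⊗ m ↦ x ⊗ y m`. -/
def act : S ⊗[K] S →+ M →+ d.Vert M :=
  TensorProduct.liftAddHom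
    (AddMonoidHom.mk' (fun x => AddMonoidHom.mk' (fun y => AddMonoidHom.mk'
      (fun m : M => Induce.tmul d.ιK x (Restrict.proj d.ιK (y • m)))
      (fun m m' => by rw [smul_add, map_add, Induce.tmul_add]))
      (fun y y' => by
        ext m
        show Induce.tmul _ _ _ = Induce.tmul _ _ _ + Induce.tmul _ _ _
        rw [add_smul, map_add, Induce.tmul_add]))
      (fun x x' => by
        ext y m
        show Induce.tmul _ _ _ = Induce.tmul _ _ _ + Induce.tmul _ _ _
        rw [Induce.add_tmul]))
    (fun c x y => by
      ext m
      show Induce.tmul d.ιK (c • x) (Restrict.proj d.ιK (y • m)) =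
        Induce.tmul d.ιK x (Restrict.proj d.ιK ((c • y) • m))
      have h : (c • x) * d.ιK 1 = x * d.ιK c := by
        rw [ιK_apply, ιK_apply, one_smul, smul_mul_assoc, mul_smul_comm]
      rw [← Induce.mul_one_tmul, h, Induce.mul_tmul, Restrict.smul_proj]
      congr 1
      apply proj_eq_of_smul_eq
      rw [smul_smul, smul_smul, smul_smul, ιK_one, ιK_apply, mul_smul_comm, ε_mul_ε,
        smul_mul_assoc, mul_smul_comm])

theorem act_tmul (x y : S) (m : M) :
    d.act (x ⊗ₜ y) m = Induce.tmul d.ιK x (Restrict.proj d.ιK (y • m)) := rfl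

theorem act_mul_left (x : S) (t : S ⊗[K] S) (m : M) :
    d.act ((x ⊗ₜ 1) * t) m = x • d.act t m := by
  induction t using TensorProduct.induction_on with
  | zero => simp
  | tmul y z => rw [Algebra.TensorProduct.tmul_mul_tmul, act_tmul, act_tmul, Induce.smul_tmul, one_mul]
  | add s t hs ht => simp [mul_add, hs, ht]

theorem act_mul_right (y : S) (t : S ⊗[K] S) (m : M) :
    d.act (t * (1 ⊗ₜ y)) m = d.act t (y • m) := by
  induction t using TensorProduct.induction_on with
  | zero => simp
  | tmul y z => rw [Algebra.TensorProduct.tmul_mul_tmul, act_tmul, act_tmul, mul_one, mul_smul]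
  | add s t hs ht => simp [add_mul, hs, ht]

theorem tmulK_ε (s : S) (x : Restrict d.ιK M) :
    Induce.tmul d.ιK (s * d.ε) x = Induce.tmul d.ιK s x := by
  rw [← ιK_one, Induce.mul_one_tmul]

theorem projK_ε (m : M) : Restrict.proj d.ιK (d.ε • m) = Restrict.proj d.ιK m :=
  proj_eq_of_smul_eq (by rw [smul_smul, ιK_one, ε_mul_ε])

/-- The retraction of the left map of the Mayer-Vietoris sequence, on the first summand. -/
def retractA : Induce d.ιA (Restrict d.ιA M) →+ d.Vert M :=
  Induce.liftAdd
    (AddMonoidHom.mk' (fun s => AddMonoidHom.mk'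
      (fun x => Induce.tmul d.ιK s (Restrict.proj d.ιK (Restrict.val d.ιA x)) -
        d.act (d.D s) (Restrict.val d.ιA x))
      (fun x y => by rw [map_add, map_add, map_add, Induce.tmul_add, add_sub_add_comm]))
      (fun s t => by
        ext x
        simp only [AddMonoidHom.mk'_apply, AddMonoidHom.add_apply, map_add, Induce.add_tmul,
          add_sub_add_comm]))
    (fun s a x => by
      simp only [AddMonoidHom.mk'_apply, Restrict.val_smul]
      rw [d.D_mul, D_ιA', mul_sub, map_add, map_sub, AddMonoidHom.add_apply, AddMonoidHom.sub_apply,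
        act_mul_left, act_mul_left, act_mul_right, act_tmul, act_tmul, Induce.smul_tmul,
        Induce.smul_tmul, ← mul_assoc, tmulK_ε, tmulK_ε, mul_smul, projK_ε, projK_ε]
      abel)

theorem retractA_tmul (s : S) (x : Restrict d.ιA M) : d.retractA (Induce.tmul d.ιA s x) =
    Induce.tmul d.ιK s (Restrict.proj d.ιK (Restrict.val d.ιA x)) -
      d.act (d.D s) (Restrict.val d.ιA x) :=
  Induce.liftAdd_tmul _ _ s x

/-- The retraction of the left map of the Mayer-Vietoris sequence, on the second summand. -/
def retractB : Induce d.ιB (Restrict d.ιB M) →+ d.Vert M :=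
  Induce.liftAdd
    (AddMonoidHom.mk' (fun s => (d.act (d.D s)).comp (Restrict.val d.ιB))
      (fun s t => by
        ext x
        simp only [AddMonoidHom.comp_apply, AddMonoidHom.add_apply, map_add]))
    (fun s b y => by
      simp only [AddMonoidHom.mk'_apply, AddMonoidHom.comp_apply, Restrict.val_smul]
      rw [d.D_mul, d.D_ιB, mul_zero, zero_add, act_mul_right])

theorem retractB_tmul (s : S) (y : Restrict d.ιB M) : d.retractB (Induce.tmul d.ιB s y) =
    d.act (d.D s) (Restrict.val d.ιB y) :=
  Induce.liftAdd_tmul _ _ s y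

/-- The retraction sends `s ⊗ x` in the `A` part to `s ⊗ εx - D(s) · x`, and subtracts `D(s) · y`
for `s ⊗ y` in the `B` part. The values of `D` on `A` and `B` are what makes these maps balanced. On
an antidiagonal element the two `D` terms cancel. -/
theorem vertToParts_injective : Function.Injective (d.vertToParts M) := by
  refine Function.LeftInverse.injective
    (g := fun z : d.Parts M => d.retractA z.1 - d.retractB z.2) fun w => ?_
  induction w using Induce.induction_on with
  | zero => simp
  | tmul s m =>
    have hm : d.ε • Restrict.val d.ιK m = Restrict.val d.ιK m := by
      rw [← ιK_one]; exact Restrict.one_smul_val m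
    have hA : d.ιA 1 • Restrict.val d.ιK m = Restrict.val d.ιK m := by
      rw [← hm, smul_smul, oneA_mul_ε]
    have hB : d.ιB 1 • Restrict.val d.ιK m = Restrict.val d.ιK m := by
      rw [← hm, smul_smul, oneB_mul_ε]
    rw [vertToParts_tmul, antidiag]
    dsimp only
    rw [map_neg, retractA_tmul, retractB_tmul, Restrict.val_proj, Restrict.val_proj, hA, hB,
      Restrict.proj_val, tmulK_ε, sub_neg_eq_add, sub_add_cancel]
  | add x y hx hy =>
    beta_reduce at hx hy ⊢
    rw [map_add, Prod.fst_add, Prod.snd_add, map_add, map_add, add_sub_add_comm, hx, hy]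

end MayerVietoris

end GluingData
end Gluing

theorem Module.Finite.restrict {R S : Type*} [Ring R] [Ring S] {ι : R →ₙ+* S}
    (h : InAdd R R (Restrict ι S)) (M : Type*) [AddCommGroup M] [Module S M] [Module.Finite S M] :
    Module.Finite R (Restrict ι M) := by
  obtain ⟨n, f, hf⟩ := Module.Finite.exists_fin' S M
  have := (h.trans ((inAdd_self_of_projective (R := S) (Fin n → S)).restrict ι)).finite
  exact Module.Finite.of_surjective _ (Restrict.map_surjective hf)

/-! ### Transfer of Gorenstein projectivity and CM properties between the glued algebra and its
parts. -/

section Gluing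

universe uK uA uB uL w w'

namespace GluingData

variable {K : Type uK} {A : Type uA} {B : Type uB} {S : Type uL} [Field K] [Ring A] [Ring B]
  [Ring S] [Algebra K A] [Algebra K B] [Algebra K S] (d : GluingData K A B S)

section Functoriality

variable {M N : Type*} [AddCommGroup M] [Module S M] [AddCommGroup N] [Module S N]

/-- The functoriality of `Parts`. -/
def partsMap (f : M →ₗ[S] N) : d.Parts M →ₗ[S] d.Parts N :=
  (Induce.map d.ιA (Restrict.map d.ιA f)).prodMap (Induce.map d.ιB (Restrict.map d.ιB f))

theorem partsTo_comp_partsMap (f : M →ₗ[S] N) :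
    d.partsTo N ∘ₗ d.partsMap f = f ∘ₗ d.partsTo M := by
  refine LinearMap.prod_ext ?_ ?_ <;> refine Induce.hom_ext fun x => ?_ <;> simp [partsTo, partsMap]

theorem map_proj {R : Type*} [Ring R] (ι : R →ₙ+* S) (f : M →ₗ[S] N) (m : M) :
    Restrict.map ι f (Restrict.proj ι m) = Restrict.proj ι (f m) :=
  Restrict.val_injective (by simp)

theorem partsMap_comp_vertToParts (f : M →ₗ[S] N) : d.partsMap f ∘ₗ d.vertToParts M =
    d.vertToParts N ∘ₗ Induce.map d.ιK (Restrict.map d.ιK f) := by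
  refine Induce.hom_ext fun x => ?_
  rw [LinearMap.comp_apply, LinearMap.comp_apply, vertToParts_tmul, Induce.map_tmul,
    vertToParts_tmul, antidiag, antidiag, partsMap, LinearMap.prodMap_apply, map_neg,
    Induce.map_tmul, Induce.map_tmul, map_proj, map_proj, Restrict.val_map]

end Functoriality

/-- `πA` is `A`-linear on both sides, so `s ⊗ x ↦ πA(s) x` splits the unit of the adjunction. -/
theorem isSummand_restrict_induce (X : Type*) [AddCommGroup X] [Module A X] :
    IsSummand A X (Restrict d.ιA (Induce d.ιA X)) := by
  have hπ : ∀ s r, d.πA.toLinearMap.toAddMonoidHom (s * d.ιA r) =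
      d.πA.toLinearMap.toAddMonoidHom s * r := fun s r => by
    show d.πA (s * d.ιA r) = d.πA s * r
    rw [map_mul, d.πA_ιA]
  have hlin : ∀ (a : A) (z : Induce d.ιA X), Induce.coord _ hπ X (d.ιA a • z) =
      a • Induce.coord _ hπ X z := fun a z => by
    induction z using Induce.induction_on with
    | zero => simp
    | tmul s x =>
      rw [Induce.smul_tmul, Induce.coord_tmul, Induce.coord_tmul, smul_smul]
      congr 1
      show d.πA (d.ιA a * s) = a * d.πA s
      rw [map_mul, d.πA_ιA]
    | add x y hx hy => rw [smul_add, map_add, hx, hy, map_add, smul_add]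
  refine ⟨Induce.unit d.ιA,
    { toFun := fun z => Induce.coord _ hπ X (Restrict.val d.ιA z)
      map_add' := fun x y => by rw [map_add, map_add]
      map_smul' := fun a z => by rw [Restrict.val_smul, hlin]; rfl }, ?_⟩
  ext x
  show Induce.coord _ hπ X (Restrict.val d.ιA (Induce.unit d.ιA x)) = x
  rw [Induce.val_unit, Induce.coord_tmul]
  show d.πA 1 • x = x
  rw [map_one, one_smul]

/-- Projectivity of `P` splits its Mayer-Vietoris sequence, so the problem separates into a vertex
term, where `K`-linear algebra extends everything, and a functional on `M`, which extends by
hypothesis. -/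
theorem exists_extension_parts {M P : Type*} [AddCommGroup M] [Module S M] [AddCommGroup P]
    [Module S P] [Module.Projective S P] (f : M →ₗ[S] P) (hf : Function.Injective f)
    (hext : ∀ φ : M →ₗ[S] S, ∃ ψ : P →ₗ[S] S, ψ ∘ₗ f = φ) (φ : d.Parts M →ₗ[S] S) :
    ∃ ψ : d.Parts P →ₗ[S] S, ψ ∘ₗ d.partsMap f = φ := by
  obtain ⟨ρ, hρ⟩ := LinearMap.exists_leftInverse_of_injective (Restrict.map d.ιK f)
    (LinearMap.ker_eq_bot.2 (Restrict.map_injective hf))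
  obtain ⟨s, hs⟩ := Module.projective_lifting_property (d.partsTo P) LinearMap.id
    d.partsTo_surjective
  obtain ⟨q, hq⟩ := d.exact_vertToParts_partsTo.exists_lift d.vertToParts_injective
    (LinearMap.id - s ∘ₗ d.partsTo P) (by
      rw [LinearMap.comp_sub, ← LinearMap.comp_assoc, hs, LinearMap.comp_id, LinearMap.id_comp,
        sub_self])
  have hqi : q ∘ₗ d.vertToParts P = LinearMap.id := by
    rw [← LinearMap.cancel_left d.vertToParts_injective, ← LinearMap.comp_assoc, hq,
      LinearMap.sub_comp, LinearMap.comp_assoc, partsTo_comp_vertToParts, LinearMap.comp_zero,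
      sub_zero, LinearMap.comp_id, LinearMap.id_comp]
  -- This agrees with `φ` on the vertex term of `M`: `q` retracts the parts of `P` onto the vertex
  -- term, and `ρ` is a `K`-linear retraction of `εM → εP`. The difference therefore descends to
  -- `M`.
  let ψ₁ : d.Parts P →ₗ[S] S := φ ∘ₗ d.vertToParts M ∘ₗ Induce.map d.ιK ρ ∘ₗ q
  obtain ⟨χ, hχ⟩ := d.exact_vertToParts_partsTo.exists_desc d.partsTo_surjective
    (φ - ψ₁ ∘ₗ d.partsMap f) (by
      have : ψ₁ ∘ₗ d.partsMap f ∘ₗ d.vertToParts M = φ ∘ₗ d.vertToParts M := by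
        rw [partsMap_comp_vertToParts]
        simp only [ψ₁, LinearMap.comp_assoc]
        rw [← LinearMap.comp_assoc _ _ q, hqi, LinearMap.id_comp, ← Induce.map_comp, hρ,
          Induce.map_id, LinearMap.comp_id]
      rw [LinearMap.sub_comp, LinearMap.comp_assoc, this, sub_self])
  obtain ⟨χ', hχ'⟩ := hext χ
  refine ⟨ψ₁ + χ' ∘ₗ d.partsTo P, ?_⟩
  rw [LinearMap.add_comp, LinearMap.comp_assoc _ _ χ', partsTo_comp_partsMap, ← LinearMap.comp_assoc,
    hχ', hχ, add_sub_cancel]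

variable [Module.Finite K S]

/-- `εM` is a finite-dimensional vector space, so inducing it from `K` gives a finitely generated
projective module. -/
theorem inAdd_vert (M : Type*) [AddCommGroup M] [Module S M] [Module.Finite S M] :
    InAdd S S (d.Vert M) := by
  have := Module.Finite.restrict d.inAdd_restrict_ιK M
  exact (inAdd_self_of_projective (R := K) (Restrict d.ιK M)).induce_self d.ιK

/-- This is the vanishing of `Ext¹(M, S)`, done by hand. Lift `P → M` to the parts; on `L` the lift
lands in the vertex term, which lies in `add S`, so this obstruction extends to `P`. Subtracting it
gives a lift that descends to a section on `M`. -/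
theorem isSummand_parts_of_gorStep {L M : Type*} [AddCommGroup L] [Module S L] [AddCommGroup M]
    [Module S M] (h : GorStep S L M) : IsSummand S M (d.Parts M) := by
  have := h.finite_right
  obtain ⟨P, f, g, _, _, hf, hg, hfg, hext⟩ := h
  obtain ⟨l, hl⟩ := Module.projective_lifting_property (d.partsTo M) g d.partsTo_surjective
  obtain ⟨k, hk⟩ := d.exact_vertToParts_partsTo.exists_lift d.vertToParts_injective (l ∘ₗ f) (by
    rw [← LinearMap.comp_assoc, hl, hfg.linearMap_comp_eq_zero])
  obtain ⟨k', hk'⟩ := (d.inAdd_vert M).extends f hext k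
  obtain ⟨s, hs⟩ := hfg.exists_desc hg (l - d.vertToParts M ∘ₗ k') (by
    rw [LinearMap.sub_comp, LinearMap.comp_assoc, hk', hk, sub_self])
  refine ⟨s, d.partsTo M, ?_⟩
  rw [← LinearMap.cancel_right hg, LinearMap.comp_assoc, hs, LinearMap.comp_sub, hl,
    ← LinearMap.comp_assoc, partsTo_comp_vertToParts, LinearMap.zero_comp, sub_zero,
    LinearMap.id_comp]

/-- Maps from the parts to `S` extend along a map in an admissible short exact sequence. -/
theorem gorStep_restrict {M N : Type*} [AddCommGroup M] [Module S M] [AddCommGroup N] [Module S N]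
    (h : GorStep S M N) : GorStep A (Restrict d.ιA M) (Restrict d.ιA N) := by
  obtain ⟨P, f, g, _, _, hf, hg, hfg, hext⟩ := h
  have hP : InAdd A A (Restrict d.ιA P) :=
    d.inAdd_restrict.trans ((inAdd_self_of_projective (R := S) P).restrict d.ιA)
  have := hP.finite
  have := hP.projective
  refine GorStep.intro (Restrict.map d.ιA f) (Restrict.map d.ιA g) (Restrict.map_injective hf)
    (Restrict.map_surjective hg) (Restrict.map_exact hfg) fun φ => ?_
  -- The functional with values in `A` becomes an `S`-functional on the induced module through `ιA`.
  -- After extension to the parts of `P`, `πA` returns its values to `A`.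
  let φ' : Induce d.ιA (Restrict d.ιA M) →ₗ[S] S := Induce.adj (d.restrictMulRight 1 ∘ₗ φ)
  obtain ⟨ψ, hψ⟩ := d.exists_extension_parts f hf hext (φ' ∘ₗ LinearMap.fst S _ _)
  refine ⟨{ toFun := fun y => d.πA (ψ (Induce.tmul d.ιA 1 y, 0))
            map_add' := fun x y => by
              rw [Induce.tmul_add, ← map_add, ← map_add, Prod.mk_add_mk, add_zero]
            map_smul' := fun a y => ?_ }, ?_⟩
  · have h : ((Induce.tmul d.ιA 1 (a • y), 0) : d.Parts P) =
        d.ιA a • (Induce.tmul d.ιA 1 y, 0) := by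
      rw [Prod.smul_mk, smul_zero, Induce.smul_tmul, mul_one, ← Induce.mul_tmul, one_mul]
    rw [h, map_smul, smul_eq_mul, map_mul, d.πA_ιA]
    rfl
  · ext x
    have := LinearMap.congr_fun hψ (Induce.tmul d.ιA 1 x, 0)
    rw [LinearMap.comp_apply, partsMap, LinearMap.prodMap_apply, map_zero, Induce.map_tmul] at this
    show d.πA (ψ (Induce.tmul d.ιA 1 (Restrict.map d.ιA f x), 0)) = φ x
    rw [this]
    show d.πA (φ' (Induce.tmul d.ιA 1 x)) = φ x
    rw [Induce.adj_tmul, one_smul, LinearMap.comp_apply]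
    show d.πA (d.ιA 1 * (d.ιA (φ x) * 1)) = φ x
    rw [mul_one, one_mul_ιA, d.πA_ιA]

theorem isGorensteinProjective_restrict {M : Type w} [AddCommGroup M] [Module S M]
    (h : IsGorensteinProjective S M) : IsGorensteinProjective A (Restrict d.ιA M) := by
  have := h.finite
  obtain ⟨M', ⟨e⟩⟩ := Module.Finite.exists_small S M
  have hs : IsSummand A (Restrict d.ιA M) (Restrict d.ιA M') :=
    ⟨Restrict.map d.ιA e.toLinearMap, Restrict.map d.ιA e.symm.toLinearMap, by
      rw [← Restrict.map_comp, LinearEquiv.symm_comp, Restrict.map_id]⟩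
  refine (isGorensteinProjective_of_class (fun X : ModuleCat.{uL} A =>
    ∃ M : ModuleCat.{uL} S, IsGorensteinProjective S M ∧ X = ModuleCat.of A (Restrict d.ιA M)) ?_ ?_
    (ModuleCat.of A (Restrict d.ιA M')) ⟨M', h.of_equiv e, rfl⟩).of_isSummand hs
  · rintro _ ⟨X, hX, rfl⟩
    obtain ⟨Y, hY, hs⟩ := hX.exists_right
    exact ⟨_, ⟨Y, hY, rfl⟩, d.gorStep_restrict hs⟩
  · rintro _ ⟨X, hX, rfl⟩
    obtain ⟨Y, hY, hs⟩ := hX.exists_left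
    exact ⟨_, ⟨Y, hY, rfl⟩, d.gorStep_restrict hs⟩

theorem finite_left (d : GluingData K A B S) : Module.Finite K A :=
  Module.Finite.of_surjective d.πA.toLinearMap fun a => ⟨d.ιA a, d.πA_ιA a⟩

theorem isGorensteinProjective_induce {X : Type*} [AddCommGroup X] [Module A X]
    (h : IsGorensteinProjective A X) : IsGorensteinProjective S (Induce d.ιA X) :=
  h.induce d.hasRightDualBasis d.inAdd_restrict

theorem isSummand_parts {M : Type*} [AddCommGroup M] [Module S M]
    (h : IsGorensteinProjective S M) : IsSummand S M (d.Parts M) := by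
  obtain ⟨L, _, h⟩ := h.exists_left
  exact d.isSummand_parts_of_gorStep h

theorem isCMFree_left (d : GluingData K A B S) (h : IsCMFree S) : IsCMFree A :=
  isCMFree_of_inAdd fun X _ _ hX =>
    (d.inAdd_restrict.trans ((h.inAdd (d.isGorensteinProjective_induce hX)).restrict d.ιA)).trans
      (d.isSummand_restrict_induce X).inAdd

theorem isCMFinite_left (d : GluingData K A B S) (h : IsCMFinite S) : IsCMFinite A := by
  have := d.finite_left
  have := IsArtinianRing.of_finite K A
  have := IsArtinianRing.of_finite K S
  obtain ⟨G, _, hG⟩ := h.exists_inAdd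
  have := Module.Finite.restrict d.inAdd_restrict G
  exact isCMFinite_of_inAdd (Restrict d.ιA G) fun X _ _ hX =>
    ((hG _ (d.isGorensteinProjective_induce hX)).restrict d.ιA).trans
      (d.isSummand_restrict_induce X).inAdd

theorem isCMFree_iff (d : GluingData K A B S) : IsCMFree S ↔ IsCMFree A ∧ IsCMFree B := by
  refine ⟨fun h => ⟨d.isCMFree_left h, d.swap.isCMFree_left h⟩, fun ⟨hA, hB⟩ =>
    isCMFree_of_inAdd fun M _ _ hM => ?_⟩
  exact InAdd.trans
    (((hA.inAdd (d.isGorensteinProjective_restrict hM)).induce_self d.ιA).prod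
      ((hB.inAdd (d.swap.isGorensteinProjective_restrict hM)).induce_self d.ιB))
    (d.isSummand_parts hM).inAdd

theorem isCMFinite_iff (d : GluingData K A B S) : IsCMFinite S ↔ IsCMFinite A ∧ IsCMFinite B := by
  refine ⟨fun h => ⟨d.isCMFinite_left h, d.swap.isCMFinite_left h⟩, fun ⟨hA, hB⟩ => ?_⟩
  have := d.finite_left
  have := d.swap.finite_left
  have := IsArtinianRing.of_finite K A
  have := IsArtinianRing.of_finite K B
  have := IsArtinianRing.of_finite K S
  obtain ⟨G, _, hG⟩ := hA.exists_inAdd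
  obtain ⟨H, _, hH⟩ := hB.exists_inAdd
  refine isCMFinite_of_inAdd (Induce d.ιA G × Induce d.ιB H) fun M _ _ hM => ?_
  exact InAdd.trans
    ((IsSummand.prod_left.inAdd.trans
        ((hG _ (d.isGorensteinProjective_restrict hM)).induce d.ιA)).prod
      (IsSummand.prod_right.inAdd.trans
        ((hH _ (d.swap.isGorensteinProjective_restrict hM)).induce d.ιB)))
    (d.isSummand_parts hM).inAdd

end GluingData
end Gluing

/-! ## The universal property of path algebras -/

section Universal

namespace PathAlgebra

variable {K V : Type*} [Field K] [Quiver V]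

theorem ofPath_cons {i j k : V} (p : Quiver.Path i j) (α : j ⟶ k) :
    ofPath K (p.cons α) = ofPath K α.toPath * ofPath K p := by
  rw [ofPath_mul_ofPath]
  rfl

/-- The idempotent of a vertex. -/
noncomputable def vertex (K : Type*) {V : Type*} [Field K] [Quiver V] (i : V) : PathAlgebra K V :=
  ofPath K (Quiver.Path.nil : Quiver.Path i i)

theorem vertex_mul_self (i : V) : vertex K i * vertex K i = vertex K i := by
  rw [vertex, ofPath_mul_ofPath, Quiver.Path.comp_nil]

theorem vertex_mul_of_ne {i j : V} (h : i ≠ j) : vertex K i * vertex K j = 0 :=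
  ofPath_mul_ofPath_of_ne _ _ h

theorem vertex_mul_arrow {i j : V} (α : i ⟶ j) :
    vertex K j * ofPath K α.toPath = ofPath K α.toPath := by
  rw [vertex, ofPath_mul_ofPath, Quiver.Path.comp_nil]

theorem arrow_mul_vertex {i j : V} (α : i ⟶ j) :
    ofPath K α.toPath * vertex K i = ofPath K α.toPath := by
  rw [vertex, ofPath_mul_ofPath, Quiver.Path.nil_comp]

theorem one_eq_sum [Fintype V] : (1 : PathAlgebra K V) = ∑ i, vertex K i := by
  rw [one_def, finsum_eq_sum_of_fintype]
  rfl

/-- A representation of a quiver in an algebra. -/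
structure AlgRep (K V T : Type*) [Field K] [Quiver V] [Finite V] [Ring T] [Algebra K T] where
  e : V → T
  x : ∀ {i j : V}, (i ⟶ j) → T
  e_mul_self : ∀ i, e i * e i = e i
  e_mul_of_ne : ∀ i j, i ≠ j → e i * e j = 0
  e_sum : ∑ᶠ i, e i = 1
  e_mul_x : ∀ {i j : V} (α : i ⟶ j), e j * x α = x α
  x_mul_e : ∀ {i j : V} (α : i ⟶ j), x α * e i = x α

namespace AlgRep

variable [Finite V] {T : Type*} [Ring T] [Algebra K T] (ρ : AlgRep K V T)

/-- The value of a representation on a path. -/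
def path {i : V} : {j : V} → Quiver.Path i j → T
  | _, Quiver.Path.nil => ρ.e i
  | _, Quiver.Path.cons p α => ρ.x α * path p

theorem path_nil (i : V) : ρ.path (Quiver.Path.nil : Quiver.Path i i) = ρ.e i := rfl

theorem path_cons {i j k : V} (p : Quiver.Path i j) (α : j ⟶ k) :
    ρ.path (p.cons α) = ρ.x α * ρ.path p := rfl

theorem e_mul_path {i j : V} (p : Quiver.Path i j) : ρ.e j * ρ.path p = ρ.path p := by
  cases p with
  | nil => exact ρ.e_mul_self i
  | cons p α => rw [path_cons, ← mul_assoc, ρ.e_mul_x]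

theorem path_mul_e {i j : V} (p : Quiver.Path i j) : ρ.path p * ρ.e i = ρ.path p := by
  induction p with
  | nil => exact ρ.e_mul_self i
  | cons p α ih => rw [path_cons, mul_assoc, ih]

theorem path_comp {i j k : V} (p : Quiver.Path i j) (q : Quiver.Path j k) :
    ρ.path (p.comp q) = ρ.path q * ρ.path p := by
  induction q with
  | nil => rw [Quiver.Path.comp_nil, path_nil, e_mul_path]
  | cons q α ih => rw [Quiver.Path.comp_cons, path_cons, path_cons, ih, mul_assoc]

/-- The algebra homomorphism given by a representation. -/
noncomputable def algHom : PathAlgebra K V →ₐ[K] T :=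
  AlgHom.ofLinearMap (PathAlgebra.lift K fun p => ρ.path p.2.2)
    (by
      have := Fintype.ofFinite V
      rw [one_eq_sum, map_sum, ← ρ.e_sum, finsum_eq_sum_of_fintype]
      exact Finset.sum_congr rfl fun i _ => lift_ofPath K _ _)
    (fun x y => by
      induction x using induction_on with
      | zero => rw [zero_mul, map_zero, zero_mul]
      | add x₁ x₂ h₁ h₂ => rw [add_mul, map_add, map_add, h₁, h₂, add_mul]
      | @smul_ofPath c k l q =>
        induction y using induction_on with
        | zero => rw [mul_zero, map_zero, mul_zero]
        | add x₁ x₂ h₁ h₂ => rw [mul_add, map_add, map_add, h₁, h₂, mul_add]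
        | @smul_ofPath c' i j p =>
          rw [smul_mul_smul_comm, map_smul, map_smul, map_smul, smul_mul_smul_comm, lift_ofPath,
            lift_ofPath]
          congr 1
          by_cases h : k = j
          · subst h
            rw [ofPath_mul_ofPath, lift_ofPath]
            exact ρ.path_comp p q
          · rw [ofPath_mul_ofPath_of_ne _ _ h, map_zero]
            show 0 = ρ.path q * ρ.path p
            rw [← ρ.path_mul_e q, ← ρ.e_mul_path p, mul_assoc, ← mul_assoc (ρ.e k),
              ρ.e_mul_of_ne _ _ h, zero_mul, mul_zero])

theorem algHom_ofPath {i j : V} (p : Quiver.Path i j) : ρ.algHom (ofPath K p) = ρ.path p :=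
  lift_ofPath K _ _

end AlgRep

end PathAlgebra

/-- Maps out of the quotient by a two-sided ideal. -/
def TwoSidedIdeal.quotLift {R T : Type*} [Ring R] [Ring T] (I : TwoSidedIdeal R) (f : R →ₙ+* T)
    (hf : ∀ x ∈ I, f x = 0) : R ⧸ I.asIdeal →ₙ+* T :=
  let g : R ⧸ I.asIdeal →+ T := QuotientAddGroup.lift I.asIdeal.toAddSubgroup (f : R →+ T)
    fun x hx => hf x (TwoSidedIdeal.mem_asIdeal.1 hx)
  { g with
    map_mul' := fun x y => by
      obtain ⟨x, rfl⟩ := Ideal.Quotient.mk_surjective x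
      obtain ⟨y, rfl⟩ := Ideal.Quotient.mk_surjective y
      exact map_mul f x y }

end Universal

/-! ## The simple gluing algebra -/

section SimpleGluing

open PathAlgebra

variable {K : Type*} [Field K] {VA VB : Type*} [Quiver VA] [Finite VA] [Quiver VB] [Finite VB]

namespace BoundQuiver

variable {V : Type*} [Quiver V] [Finite V] (I : TwoSidedIdeal (PathAlgebra K V))

/-- The quotient map. -/
noncomputable def quo : PathAlgebra K V →ₐ[K] BoundQuiverAlgebra I :=
  Ideal.Quotient.mkₐ K I.asIdeal

theorem quo_surjective : Function.Surjective (quo I) := Ideal.Quotient.mk_surjective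

theorem quo_eq_zero {x : PathAlgebra K V} : quo I x = 0 ↔ x ∈ I :=
  Ideal.Quotient.eq_zero_iff_mem.trans TwoSidedIdeal.mem_asIdeal

/-- The idempotent of a vertex in a bound quiver algebra. -/
noncomputable def vtx (i : V) : BoundQuiverAlgebra I := quo I (vertex K i)

theorem vtx_mul_self (i : V) : vtx I i * vtx I i = vtx I i := by
  rw [vtx, ← map_mul, vertex_mul_self]

theorem vtx_mul_of_ne {i j : V} (h : i ≠ j) : vtx I i * vtx I j = 0 := by
  rw [vtx, vtx, ← map_mul, vertex_mul_of_ne h, map_zero]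

theorem one_eq_sum_vtx [Fintype V] : (1 : BoundQuiverAlgebra I) = ∑ i, vtx I i := by
  rw [← map_one (quo I), one_eq_sum, map_sum]
  rfl

/-- The algebra map out of a bound quiver algebra given by a representation. -/
noncomputable def liftAlg {T : Type*} [Ring T] [Algebra K T] (f : PathAlgebra K V →ₐ[K] T)
    (hf : ∀ x ∈ I, f x = 0) : BoundQuiverAlgebra I →ₐ[K] T :=
  Ideal.Quotient.liftₐ I.asIdeal f fun x hx => hf x (TwoSidedIdeal.mem_asIdeal.1 hx)

theorem liftAlg_mk {T : Type*} [Ring T] [Algebra K T] (f : PathAlgebra K V →ₐ[K] T)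
    (hf : ∀ x ∈ I, f x = 0) (x : PathAlgebra K V) : liftAlg I f hf (quo I x) = f x :=
  Ideal.Quotient.lift_mk _ _ _

open Classical in
/-- The one-dimensional representation at a vertex. -/
noncomputable def augRep (K : Type*) [Field K] {V : Type*} [Quiver V] [Finite V] (i : V) :
    AlgRep K V K where
  e j := if j = i then 1 else 0
  x _ := 0
  e_mul_self j := by split_ifs <;> simp
  e_mul_of_ne j k h := by
    by_cases hj : j = i
    · subst hj
      rw [if_neg h.symm, mul_zero]
    · rw [if_neg hj, zero_mul]
  e_sum := by
    have := Fintype.ofFinite V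
    rw [finsum_eq_sum_of_fintype]
    simp
  e_mul_x _ := mul_zero _
  x_mul_e _ := zero_mul _

/-- The augmentation kills every path of positive length, and an admissible ideal is spanned inside
paths of length at least two. -/
theorem augRep_eq_zero (hI : IsAdmissible I) (i : V) (x : PathAlgebra K V) (hx : x ∈ I) :
    (augRep K i).algHom x = 0 := by
  have h := hI.2 x hx
  clear hx
  induction h using Submodule.span_induction with
  | mem x hx =>
    obtain ⟨j, k, p, hp, rfl⟩ := hx
    rw [AlgRep.algHom_ofPath]
    cases p with
    | nil => simp at hp
    | cons p α => exact zero_mul _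
  | zero => exact map_zero _
  | add x y _ _ hx hy => rw [map_add, hx, hy, add_zero]
  | smul c x _ hx => rw [map_smul, hx, smul_zero]

/-- The augmentation of a bound quiver algebra at a vertex. -/
noncomputable def aug (hI : IsAdmissible I) (i : V) : BoundQuiverAlgebra I →ₐ[K] K :=
  liftAlg I (augRep K i).algHom (augRep_eq_zero I hI i)

theorem aug_vtx (hI : IsAdmissible I) (i : V) : aug I hI i (vtx I i) = 1 := by
  rw [aug, vtx, liftAlg_mk, vertex, AlgRep.algHom_ofPath, AlgRep.path_nil]
  exact if_pos rfl

end BoundQuiver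

end SimpleGluing

/-! ### Embeddings of the two bound quiver algebras, and the universal property of their simple
gluing. -/

section SimpleGluing

open PathAlgebra BoundQuiver

namespace GluedVertex

variable {VA VB : Type*} (a : VA) (b : VB)

/-- The retraction onto the vertices of the first quiver. -/
noncomputable def retractLeft : GluedVertex a b → VA :=
  Quot.lift (Sum.elim id fun _ => a) (by rintro _ _ ⟨rfl, rfl⟩; rfl)

/-- The retraction onto the vertices of the second quiver. -/
noncomputable def retractRight : GluedVertex a b → VB :=
  Quot.lift (Sum.elim (fun _ => b) id) (by rintro _ _ ⟨rfl, rfl⟩; rfl)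

/-- The vertex retractions detect equality, so the equivalence relation generated by the
identification never has to be described. -/
theorem left_injective : Function.Injective (left a b) := fun _ _ h =>
  congrArg (retractLeft a b) h

theorem right_injective : Function.Injective (right a b) := fun _ _ h =>
  congrArg (retractRight a b) h

theorem left_eq_right : left a b a = right a b b := Quot.sound ⟨rfl, rfl⟩

theorem eq_of_left_eq_right {i : VA} {j : VB} (h : left a b i = right a b j) : i = a ∧ j = b :=
  ⟨congrArg (retractLeft a b) h, (congrArg (retractRight a b) h).symm⟩

theorem ind {p : GluedVertex a b → Prop} (hl : ∀ i, p (left a b i)) (hr : ∀ j, p (right a b j))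
    (v : GluedVertex a b) : p v := by
  rcases v with ⟨i | j⟩
  · exact hl i
  · exact hr j

end GluedVertex

open GluedVertex

/-- The non-unital homomorphism of path algebras induced by a quiver morphism that is injective on
vertices. -/
noncomputable def PathAlgebra.mapHom (K : Type*) [Field K] {V W : Type*} [Quiver V] [Quiver W]
    (F : V ⥤q W) (hF : Function.Injective F.obj) : PathAlgebra K V →ₙ+* PathAlgebra K W where
  toFun := PathAlgebra.map K F
  map_zero' := map_zero _
  map_add' := map_add _
  map_mul' x y := by
    induction x using induction_on with
    | zero => rw [zero_mul, map_zero, zero_mul]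
    | add x₁ x₂ h₁ h₂ => rw [add_mul, map_add, map_add, h₁, h₂, add_mul]
    | @smul_ofPath c k l q =>
      induction y using induction_on with
      | zero => rw [mul_zero, map_zero, mul_zero]
      | add x₁ x₂ h₁ h₂ => rw [mul_add, map_add, map_add, h₁, h₂, mul_add]
      | @smul_ofPath c' i j p =>
        simp only [PathAlgebra.smul_mul', PathAlgebra.mul_smul', map_smul]
        congr 2
        simp only [PathAlgebra.map, lift_ofPath]
        by_cases h : k = j
        · subst h
          rw [ofPath_mul_ofPath, lift_ofPath, ofPath_mul_ofPath, Prefunctor.mapPath_comp]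
        -- Injectivity on vertices ensures that non-composable paths remain non-composable.
        · rw [ofPath_mul_ofPath_of_ne _ _ h, map_zero,
            ofPath_mul_ofPath_of_ne _ _ (fun h' => h (hF h'))]

theorem PathAlgebra.map_ofPath (K : Type*) [Field K] {V W : Type*} [Quiver V] [Quiver W]
    (F : V ⥤q W) {i j : V} (p : Quiver.Path i j) :
    PathAlgebra.map K F (ofPath K p) = ofPath K (F.mapPath p) :=
  lift_ofPath K _ _

variable {K : Type*} [Field K] {VA VB : Type*} [Quiver VA] [Finite VA] [Quiver VB] [Finite VB]
  (a : VA) (b : VB) (IA : TwoSidedIdeal (PathAlgebra K VA)) (IB : TwoSidedIdeal (PathAlgebra K VB))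

namespace SimpleGluing

theorem map_left_mem {x : PathAlgebra K VA} (hx : x ∈ IA) :
    PathAlgebra.map K (glueLeft a b) x ∈ gluedIdeal a b IA IB :=
  TwoSidedIdeal.subset_span (Or.inl ⟨x, hx, rfl⟩)

theorem map_right_mem {x : PathAlgebra K VB} (hx : x ∈ IB) :
    PathAlgebra.map K (glueRight a b) x ∈ gluedIdeal a b IA IB :=
  TwoSidedIdeal.subset_span (Or.inr ⟨x, hx, rfl⟩)

/-- The embedding of `A` in the simple gluing algebra. -/
noncomputable def inclA : BoundQuiverAlgebra IA →ₙ+* SimpleGluingAlgebra a b IA IB :=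
  IA.quotLift ((quo (gluedIdeal a b IA IB)).toRingHom.toNonUnitalRingHom.comp
    (PathAlgebra.mapHom K (glueLeft a b) (left_injective a b)))
    fun _ hx => (quo_eq_zero _).2 (map_left_mem a b IA IB hx)

/-- The embedding of `B` in the simple gluing algebra. -/
noncomputable def inclB : BoundQuiverAlgebra IB →ₙ+* SimpleGluingAlgebra a b IA IB :=
  IB.quotLift ((quo (gluedIdeal a b IA IB)).toRingHom.toNonUnitalRingHom.comp
    (PathAlgebra.mapHom K (glueRight a b) (right_injective a b)))
    fun _ hx => (quo_eq_zero _).2 (map_right_mem a b IA IB hx)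

theorem inclA_mk (x : PathAlgebra K VA) : inclA a b IA IB (quo IA x) =
    quo (gluedIdeal a b IA IB) (PathAlgebra.map K (glueLeft a b) x) := rfl

theorem inclB_mk (x : PathAlgebra K VB) : inclB a b IA IB (quo IB x) =
    quo (gluedIdeal a b IA IB) (PathAlgebra.map K (glueRight a b) x) := rfl

theorem inclA_vtx (i : VA) : inclA a b IA IB (vtx IA i) =
    vtx (gluedIdeal a b IA IB) (left a b i) := by
  rw [vtx, inclA_mk, vertex, PathAlgebra.map_ofPath]
  rfl

theorem inclB_vtx (i : VB) : inclB a b IA IB (vtx IB i) =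
    vtx (gluedIdeal a b IA IB) (right a b i) := by
  rw [vtx, inclB_mk, vertex, PathAlgebra.map_ofPath]
  rfl

theorem inclA_smul (c : K) (x : BoundQuiverAlgebra IA) :
    inclA a b IA IB (c • x) = c • inclA a b IA IB x := by
  obtain ⟨x, rfl⟩ := quo_surjective IA x
  rw [← map_smul, inclA_mk, inclA_mk, map_smul, map_smul]

theorem inclB_smul (c : K) (x : BoundQuiverAlgebra IB) :
    inclB a b IA IB (c • x) = c • inclB a b IA IB x := by
  obtain ⟨x, rfl⟩ := quo_surjective IB x
  rw [← map_smul, inclB_mk, inclB_mk, map_smul, map_smul]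

local notation "E" => vtx (gluedIdeal a b IA IB)

theorem inclA_one_mul_left (i : VA) : inclA a b IA IB 1 * E (left a b i) = E (left a b i) := by
  rw [← inclA_vtx, ← map_mul, one_mul]

theorem left_mul_inclA_one (i : VA) : E (left a b i) * inclA a b IA IB 1 = E (left a b i) := by
  rw [← inclA_vtx, ← map_mul, mul_one]

theorem inclB_one_mul_right (i : VB) : inclB a b IA IB 1 * E (right a b i) = E (right a b i) := by
  rw [← inclB_vtx, ← map_mul, one_mul]

theorem inclA_one_mul_right {j : VB} (hj : j ≠ b) : inclA a b IA IB 1 * E (right a b j) = 0 := by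
  have := Fintype.ofFinite VA
  rw [one_eq_sum_vtx, map_sum, Finset.sum_mul]
  exact Finset.sum_eq_zero fun i _ => by
    rw [inclA_vtx, vtx_mul_of_ne _ fun h => hj (eq_of_left_eq_right a b h).2]

theorem right_mul_inclA_one {j : VB} (hj : j ≠ b) : E (right a b j) * inclA a b IA IB 1 = 0 := by
  have := Fintype.ofFinite VA
  rw [one_eq_sum_vtx, map_sum, Finset.mul_sum]
  exact Finset.sum_eq_zero fun i _ => by
    rw [inclA_vtx, vtx_mul_of_ne _ fun h => hj (eq_of_left_eq_right a b h.symm).2]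

theorem inclB_one_mul_left {i : VA} (hi : i ≠ a) : inclB a b IA IB 1 * E (left a b i) = 0 := by
  have := Fintype.ofFinite VB
  rw [one_eq_sum_vtx, map_sum, Finset.sum_mul]
  exact Finset.sum_eq_zero fun j _ => by
    rw [inclB_vtx, vtx_mul_of_ne _ fun h => hi (eq_of_left_eq_right a b h.symm).1]

theorem inclB_vtx_eq : inclB a b IA IB (vtx IB b) = inclA a b IA IB (vtx IA a) := by
  rw [inclA_vtx, inclB_vtx, left_eq_right]

theorem inclA_one_mul_inclB_one :
    inclA a b IA IB 1 * inclB a b IA IB 1 = inclA a b IA IB (vtx IA a) := by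
  classical
  have := Fintype.ofFinite VB
  rw [one_eq_sum_vtx IB, map_sum, Finset.mul_sum, Finset.sum_eq_single b]
  · rw [inclB_vtx, ← left_eq_right, inclA_one_mul_left, inclA_vtx]
  · intro j _ hj
    rw [inclB_vtx, inclA_one_mul_right _ _ _ _ hj]
  · simp

theorem inclB_one_mul_inclA_one :
    inclB a b IA IB 1 * inclA a b IA IB 1 = inclA a b IA IB (vtx IA a) := by
  classical
  have := Fintype.ofFinite VB
  rw [one_eq_sum_vtx IB, map_sum, Finset.sum_mul, Finset.sum_eq_single b]
  · rw [inclB_vtx, ← left_eq_right, left_mul_inclA_one, inclA_vtx]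
  · intro j _ hj
    rw [inclB_vtx, right_mul_inclA_one _ _ _ _ hj]
  · simp

/-- Compare both sides on each vertex idempotent, since these sum to `1`; the glued vertex is
treated as a vertex of the first quiver. -/
theorem inclA_one_add_inclB_one :
    inclA a b IA IB 1 + inclB a b IA IB 1 = 1 + inclA a b IA IB (vtx IA a) := by
  have := Fintype.ofFinite (GluedVertex a b)
  have h : ∀ v, (inclA a b IA IB 1 + inclB a b IA IB 1 - inclA a b IA IB (vtx IA a)) * E v = E v := by
    have hl : ∀ i, (inclA a b IA IB 1 + inclB a b IA IB 1 - inclA a b IA IB (vtx IA a)) *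
        E (left a b i) = E (left a b i) := by
      intro i
      rw [sub_mul, add_mul, inclA_one_mul_left, inclA_vtx]
      by_cases hi : i = a
      · subst hi
        rw [vtx_mul_self, add_sub_assoc, left_eq_right, inclB_one_mul_right, sub_self, add_zero]
      · rw [inclB_one_mul_left _ _ _ _ hi,
          vtx_mul_of_ne _ fun h => hi (left_injective a b h).symm, add_zero, sub_zero]
    refine GluedVertex.ind a b hl fun j => ?_
    by_cases hj : j = b
    · subst hj
      rw [← left_eq_right]
      exact hl a
    · rw [sub_mul, add_mul, inclB_one_mul_right, inclA_one_mul_right _ _ _ _ hj, inclA_vtx,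
        vtx_mul_of_ne _ fun h => hj (eq_of_left_eq_right a b h).2, zero_add, sub_zero]
  rw [← sub_eq_iff_eq_add, ← mul_one (_ - _), one_eq_sum_vtx (gluedIdeal a b IA IB), Finset.mul_sum]
  exact Finset.sum_congr rfl fun v _ => h v

theorem adjoin_eq : Algebra.adjoin K
    (Set.range (inclA a b IA IB) ∪ Set.range (inclB a b IA IB)) = ⊤ := by
  rw [eq_top_iff]
  rintro x -
  obtain ⟨x, rfl⟩ := quo_surjective _ x
  have hA : ∀ x, inclA a b IA IB x ∈ Algebra.adjoin K
      (Set.range (inclA a b IA IB) ∪ Set.range (inclB a b IA IB)) := fun x =>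
    Algebra.subset_adjoin (Or.inl ⟨x, rfl⟩)
  have hB : ∀ x, inclB a b IA IB x ∈ Algebra.adjoin K
      (Set.range (inclA a b IA IB) ∪ Set.range (inclB a b IA IB)) := fun x =>
    Algebra.subset_adjoin (Or.inr ⟨x, rfl⟩)
  induction x using induction_on with
  | zero => rw [map_zero]; exact zero_mem _
  | add x y hx hy => rw [map_add]; exact add_mem hx hy
  | @smul_ofPath c i j p =>
    rw [map_smul]
    refine Subalgebra.smul_mem _ ?_ c
    induction p with
    | nil =>
      refine GluedVertex.ind (p := fun i => quo _ (ofPath K (Quiver.Path.nil : Quiver.Path i i)) ∈ _)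
        a b (fun i => ?_) (fun j => ?_) i
      · have := hA (vtx IA i)
        rwa [inclA_vtx] at this
      · have := hB (vtx IB j)
        rwa [inclB_vtx] at this
    | cons p α ih =>
      rw [ofPath_cons, map_mul]
      refine mul_mem ?_ ih
      rcases α with α | β
      · have := hA (quo IA (ofPath K α.toPath))
        rwa [inclA_mk, PathAlgebra.map_ofPath] at this
      · have := hB (quo IB (ofPath K β.toPath))
        rwa [inclB_mk, PathAlgebra.map_ofPath] at this

/-! ### The universal property -/

section Lift

variable {T : Type*} [Ring T] [Algebra K T]

/-- Compatible maps from the two algebras to a third one. -/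
structure Cocone (T : Type*) [Ring T] [Algebra K T] where
  f : BoundQuiverAlgebra IA →ₙ+* T
  g : BoundQuiverAlgebra IB →ₙ+* T
  f_smul : ∀ (c : K) x, f (c • x) = c • f x
  g_smul : ∀ (c : K) x, g (c • x) = c • g x
  eq : g (vtx IB b) = f (vtx IA a)
  mulAB : f 1 * g 1 = f (vtx IA a)
  mulBA : g 1 * f 1 = f (vtx IA a)
  add_one : f 1 + g 1 = 1 + f (vtx IA a)

variable {a b IA IB} (c : Cocone a b IA IB T)

namespace Cocone

/-- The images of the vertices. -/
noncomputable def e : GluedVertex a b → T :=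
  Quot.lift (Sum.elim (fun i => c.f (vtx IA i)) fun j => c.g (vtx IB j)) (by
    rintro _ _ ⟨rfl, rfl⟩
    exact c.eq.symm)

theorem e_left (i : VA) : c.e (left a b i) = c.f (vtx IA i) := rfl

theorem e_right (j : VB) : c.e (right a b j) = c.g (vtx IB j) := rfl

/-- The axiom on the product of the units inserts `f (e_a)` between the two factors. Only the gluing
vertex can survive on the `A` side, and there `f (e_a) = g (e_b)` moves the question into `B`. -/
theorem f_mul_g {i : VA} {j : VB} (h : left a b i ≠ right a b j) :
    c.f (vtx IA i) * c.g (vtx IB j) = 0 := by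
  have h1 : c.f (vtx IA i) * c.g (vtx IB j) = c.f (vtx IA i * vtx IA a) * c.g (vtx IB j) := by
    rw [map_mul, ← c.mulAB, ← mul_assoc, ← map_mul, mul_one, mul_assoc, ← map_mul, one_mul]
  rw [h1]
  by_cases hi : i = a
  · subst hi
    rw [vtx_mul_self, ← c.eq, ← map_mul, vtx_mul_of_ne, map_zero]
    rintro rfl
    exact h (left_eq_right _ _)
  · rw [vtx_mul_of_ne _ hi, map_zero, zero_mul]

theorem g_mul_f {i : VA} {j : VB} (h : left a b i ≠ right a b j) :
    c.g (vtx IB j) * c.f (vtx IA i) = 0 := by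
  have h1 : c.g (vtx IB j) * c.f (vtx IA i) = c.g (vtx IB j) * c.f (vtx IA a * vtx IA i) := by
    rw [map_mul, ← c.mulBA, ← mul_assoc, ← mul_assoc, ← map_mul, mul_one, mul_assoc, ← map_mul,
      one_mul]
  rw [h1]
  by_cases hi : i = a
  · subst hi
    rw [vtx_mul_self, ← c.eq, ← map_mul, vtx_mul_of_ne, map_zero]
    rintro rfl
    exact h (left_eq_right _ _)
  · rw [vtx_mul_of_ne _ (Ne.symm hi), map_zero, mul_zero]

theorem e_mul_of_ne (v w : GluedVertex a b) (h : v ≠ w) : c.e v * c.e w = 0 := by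
  induction v using GluedVertex.ind with
  | hl i =>
    induction w using GluedVertex.ind with
    | hl k => rw [e_left, e_left, ← map_mul, vtx_mul_of_ne _ fun h' => h (congrArg (left a b) h'), map_zero]
    | hr j => exact c.f_mul_g h
  | hr j =>
    induction w using GluedVertex.ind with
    | hl k => exact c.g_mul_f h.symm
    | hr k =>
      rw [e_right, e_right, ← map_mul, vtx_mul_of_ne _ fun h' => h (congrArg (right a b) h'), map_zero]

theorem e_mul_self (v : GluedVertex a b) : c.e v * c.e v = c.e v := by
  induction v using GluedVertex.ind with
  | hl i => rw [e_left, ← map_mul, vtx_mul_self]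
  | hr j => rw [e_right, ← map_mul, vtx_mul_self]

/-- The sum is a left identity for `f 1`, `g 1` and `f (e_a)`, and `1` is a combination of these. -/
theorem e_sum : ∑ᶠ v, c.e v = 1 := by
  classical
  have := Fintype.ofFinite (GluedVertex a b)
  have := Fintype.ofFinite VA
  have := Fintype.ofFinite VB
  rw [finsum_eq_sum_of_fintype]
  have h : ∀ w, (∑ v, c.e v) * c.e w = c.e w := fun w => by
    rw [Finset.sum_mul, Finset.sum_eq_single w (fun v _ h => c.e_mul_of_ne v w h) (by simp),
      e_mul_self]
  have hf : (∑ v, c.e v) * c.f 1 = c.f 1 := by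
    rw [one_eq_sum_vtx IA, map_sum, Finset.mul_sum]
    exact Finset.sum_congr rfl fun i _ => h (left a b i)
  have hg : (∑ v, c.e v) * c.g 1 = c.g 1 := by
    rw [one_eq_sum_vtx IB, map_sum, Finset.mul_sum]
    exact Finset.sum_congr rfl fun i _ => h (right a b i)
  have h1 : (1 : T) = c.f 1 + c.g 1 - c.f (vtx IA a) := by rw [c.add_one, add_sub_cancel_right]
  rw [← mul_one (∑ v, c.e v), h1, mul_sub, mul_add, hf, hg]
  congr 1
  exact h (left a b a)

/-- The representation of the glued quiver given by a cocone. -/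
noncomputable def rep : AlgRep K (GluedVertex a b) T where
  e := c.e
  x α := match α with
    | GluedArrow.left α => c.f (quo IA (ofPath K α.toPath))
    | GluedArrow.right β => c.g (quo IB (ofPath K β.toPath))
  e_mul_self := c.e_mul_self
  e_mul_of_ne := c.e_mul_of_ne
  e_sum := c.e_sum
  e_mul_x α := by
    rcases α with α | β
    · exact (map_mul c.f _ _).symm.trans (by rw [vtx, ← map_mul, vertex_mul_arrow])
    · exact (map_mul c.g _ _).symm.trans (by rw [vtx, ← map_mul, vertex_mul_arrow])
  x_mul_e α := by
    rcases α with α | β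
    · exact (map_mul c.f _ _).symm.trans (by rw [vtx, ← map_mul, arrow_mul_vertex])
    · exact (map_mul c.g _ _).symm.trans (by rw [vtx, ← map_mul, arrow_mul_vertex])

theorem rep_map_left (x : PathAlgebra K VA) :
    c.rep.algHom (PathAlgebra.map K (glueLeft a b) x) = c.f (quo IA x) := by
  induction x using induction_on with
  | zero => simp only [map_zero]
  | add x y hx hy => simp only [map_add, hx, hy]
  | @smul_ofPath k i j p =>
    simp only [map_smul, c.f_smul]
    congr 1
    rw [PathAlgebra.map_ofPath, AlgRep.algHom_ofPath]
    induction p with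
    | nil => rfl
    | cons p α ih => rw [ofPath_cons, map_mul, map_mul, ← ih]; rfl

theorem rep_map_right (x : PathAlgebra K VB) :
    c.rep.algHom (PathAlgebra.map K (glueRight a b) x) = c.g (quo IB x) := by
  induction x using induction_on with
  | zero => simp only [map_zero]
  | add x y hx hy => simp only [map_add, hx, hy]
  | @smul_ofPath k i j p =>
    simp only [map_smul, c.g_smul]
    congr 1
    rw [PathAlgebra.map_ofPath, AlgRep.algHom_ofPath]
    induction p with
    | nil => rfl
    | cons p α ih => rw [ofPath_cons, map_mul, map_mul, ← ih]; rfl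

theorem rep_eq_zero (x : PathAlgebra K (GluedVertex a b)) (hx : x ∈ gluedIdeal a b IA IB) :
    c.rep.algHom x = 0 := by
  have h : gluedIdeal a b IA IB ≤ TwoSidedIdeal.ker c.rep.algHom := by
    refine TwoSidedIdeal.span_le.2 ?_
    rintro _ (⟨x, hx, rfl⟩ | ⟨x, hx, rfl⟩)
    · rw [SetLike.mem_coe, TwoSidedIdeal.mem_ker, rep_map_left, (quo_eq_zero IA).2 hx, map_zero]
    · rw [SetLike.mem_coe, TwoSidedIdeal.mem_ker, rep_map_right, (quo_eq_zero IB).2 hx, map_zero]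
  exact (TwoSidedIdeal.mem_ker _).1 (h hx)

/-- The algebra homomorphism out of the simple gluing algebra given by a cocone. -/
noncomputable def desc : SimpleGluingAlgebra a b IA IB →ₐ[K] T :=
  liftAlg _ c.rep.algHom c.rep_eq_zero

theorem desc_inclA (x : BoundQuiverAlgebra IA) : c.desc (inclA a b IA IB x) = c.f x := by
  obtain ⟨x, rfl⟩ := quo_surjective IA x
  rw [inclA_mk, desc, liftAlg_mk, rep_map_left]

theorem desc_inclB (x : BoundQuiverAlgebra IB) : c.desc (inclB a b IA IB x) = c.g x := by
  obtain ⟨x, rfl⟩ := quo_surjective IB x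
  rw [inclB_mk, desc, liftAlg_mk, rep_map_right]

end Cocone

end Lift

end SimpleGluing

end SimpleGluing

/-! ### The derivation of the simple gluing algebra -/

section Derivation

variable {K S : Type*} [Field K] [Ring S] [Algebra K S]

variable (K S) in
/-- The algebra in which the triangular endomorphisms live. -/
def TriangularAlg : Type _ := Module.End K ((S ⊗[K] S) × S)

noncomputable instance : Ring (TriangularAlg K S) :=
  inferInstanceAs (Ring (Module.End K ((S ⊗[K] S) × S)))

noncomputable instance : Algebra K (TriangularAlg K S) :=
  inferInstanceAs (Algebra K (Module.End K ((S ⊗[K] S) × S)))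

/-- The endomorphism `(n, μ) ↦ (x n + w μ, x μ)`. -/
noncomputable def triangular (x : S) (w : S ⊗[K] S) : TriangularAlg K S :=
  show Module.End K ((S ⊗[K] S) × S) from (LinearMap.mulLeft K (x ⊗ₜ[K] (1 : S)) ∘ₗ LinearMap.fst K _ _ + LinearMap.mulLeft K w ∘ₗ
    Algebra.TensorProduct.includeRight.toLinearMap ∘ₗ LinearMap.snd K _ _).prod
      (LinearMap.mulLeft K x ∘ₗ LinearMap.snd K _ _)

/-- The value of an endomorphism at `(n, y)`. -/
noncomputable def TriangularAlg.eval (f : TriangularAlg K S) (v : (S ⊗[K] S) × S) :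
    (S ⊗[K] S) × S :=
  (show Module.End K ((S ⊗[K] S) × S) from f) v

theorem TriangularAlg.ext {f g : TriangularAlg K S} (h : ∀ n y, f.eval (n, y) = g.eval (n, y)) :
    f = g :=
  LinearMap.ext (f := (show Module.End K ((S ⊗[K] S) × S) from f)) fun v => h v.1 v.2

theorem triangular_eval (x : S) (w n : S ⊗[K] S) (y : S) :
    (triangular x w).eval (n, y) = ((x ⊗ₜ 1) * n + w * (1 ⊗ₜ y), x * y) := rfl

theorem TriangularAlg.mul_eval (f g : TriangularAlg K S) (v : (S ⊗[K] S) × S) :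
    (f * g).eval v = f.eval (g.eval v) := rfl

theorem TriangularAlg.add_eval (f g : TriangularAlg K S) (v : (S ⊗[K] S) × S) :
    (f + g).eval v = f.eval v + g.eval v := rfl

theorem TriangularAlg.smul_eval (c : K) (f : TriangularAlg K S) (v : (S ⊗[K] S) × S) :
    (c • f).eval v = c • f.eval v := rfl

theorem TriangularAlg.zero_eval (v : (S ⊗[K] S) × S) : (0 : TriangularAlg K S).eval v = 0 := rfl

theorem TriangularAlg.one_eval (v : (S ⊗[K] S) × S) : (1 : TriangularAlg K S).eval v = v := rfl

variable (K S) in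
/-- The upper right entry. -/
noncomputable def TriangularAlg.entry : TriangularAlg K S →ₗ[K] S ⊗[K] S where
  toFun f := (f.eval (0, 1)).1
  map_add' f g := by rw [add_eval, Prod.fst_add]
  map_smul' c f := by rw [smul_eval, Prod.smul_fst, RingHom.id_apply]

theorem TriangularAlg.entry_triangular (x : S) (w : S ⊗[K] S) :
    entry K S (triangular x w) = w := by
  show ((triangular x w).eval (0, 1)).1 = w
  rw [triangular_eval, mul_zero, zero_add, ← Algebra.TensorProduct.one_def, mul_one]

/-- The upper right entry obeys the Leibniz rule for the outer bimodule structure on `S ⊗ S`. A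
homomorphism with diagonal entry `x` is thus the same as a derivation, so derivations can be built
from the universal property. -/
theorem triangular_mul (x x' : S) (w w' : S ⊗[K] S) : triangular x w * triangular x' w' =
    triangular (x * x') ((x ⊗ₜ 1) * w' + w * (1 ⊗ₜ x')) := by
  refine TriangularAlg.ext fun n y => ?_
  have h1 : (x * x') ⊗ₜ[K] (1 : S) = (x ⊗ₜ 1) * (x' ⊗ₜ 1) := by simp
  have h2 : (1 : S) ⊗ₜ[K] (x' * y) = (1 ⊗ₜ x') * (1 ⊗ₜ y) := by simp
  rw [TriangularAlg.mul_eval, triangular_eval, triangular_eval, triangular_eval, h1, h2,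
    mul_assoc x]
  congr 1
  noncomm_ring

theorem triangular_add (x x' : S) (w w' : S ⊗[K] S) :
    triangular (x + x') (w + w') = triangular x w + triangular x' w' := by
  refine TriangularAlg.ext fun n y => ?_
  rw [TriangularAlg.add_eval, triangular_eval, triangular_eval, triangular_eval, Prod.mk_add_mk,
    TensorProduct.add_tmul]
  congr 1
  · noncomm_ring
  · noncomm_ring

theorem triangular_smul (c : K) (x : S) (w : S ⊗[K] S) :
    triangular (c • x) (c • w) = c • triangular x w := by
  refine TriangularAlg.ext fun n y => ?_
  rw [TriangularAlg.smul_eval, triangular_eval, triangular_eval, Prod.smul_mk, smul_add,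
    ← TensorProduct.smul_tmul', smul_mul_assoc, smul_mul_assoc, smul_mul_assoc]

theorem triangular_zero : triangular (0 : S) (0 : S ⊗[K] S) = 0 := by
  refine TriangularAlg.ext fun n y => ?_
  rw [triangular_eval, TensorProduct.zero_tmul, TriangularAlg.zero_eval]
  simp

theorem triangular_one : triangular (1 : S) (0 : S ⊗[K] S) = 1 := by
  refine TriangularAlg.ext fun n y => ?_
  rw [triangular_eval, ← Algebra.TensorProduct.one_def, TriangularAlg.one_eval]
  simp

/-- The commutator with `ε ⊗ ε`. -/
def tensorComm (K : Type*) [Field K] {S : Type*} [Ring S] [Algebra K S] (ε x : S) : S ⊗[K] S :=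
  (x ⊗ₜ 1) * (ε ⊗ₜ ε) - (ε ⊗ₜ ε) * (1 ⊗ₜ x)

theorem tensorComm_eq (ε x : S) : tensorComm K ε x = (x * ε) ⊗ₜ ε - ε ⊗ₜ (ε * x) := by
  simp [tensorComm]

theorem tensorComm_mul (ε x y : S) : tensorComm K ε (x * y) =
    (x ⊗ₜ 1) * tensorComm K ε y + tensorComm K ε x * (1 ⊗ₜ y) := by
  have h1 : (x * y) ⊗ₜ[K] (1 : S) = (x ⊗ₜ 1) * (y ⊗ₜ 1) := by simp
  have h2 : (1 : S) ⊗ₜ[K] (x * y) = (1 ⊗ₜ x) * (1 ⊗ₜ y) := by simp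
  rw [tensorComm, tensorComm, tensorComm, h1, h2]
  noncomm_ring

theorem tensorComm_add (ε x y : S) :
    tensorComm K ε (x + y) = tensorComm K ε x + tensorComm K ε y := by
  rw [tensorComm, tensorComm, tensorComm, TensorProduct.add_tmul, TensorProduct.tmul_add]
  noncomm_ring

theorem tensorComm_zero (ε : S) : tensorComm K ε (0 : S) = 0 := by
  simp [tensorComm]

theorem tensorComm_smul (c : K) (ε x : S) : tensorComm K ε (c • x) = c • tensorComm K ε x := by
  rw [tensorComm_eq, tensorComm_eq, smul_sub, smul_mul_assoc, mul_smul_comm,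
    TensorProduct.tmul_smul, ← TensorProduct.smul_tmul']

/-- Applied to `ε` and `e_A`, this makes the inner and the zero derivation agree where the two
algebras meet, which is the compatibility needed for a cocone. -/
theorem tensorComm_of_commute {ε x : S} (h : x * ε = ε) (h' : ε * x = ε) :
    tensorComm K ε x = 0 := by
  rw [tensorComm_eq, h, h', sub_self]

variable (K) in
/-- The homomorphism which corresponds to the inner derivation. -/
noncomputable def innerHom (ε : S) : S →ₙ+* TriangularAlg K S where
  toFun x := triangular x (tensorComm K ε x)
  map_zero' := by rw [tensorComm_zero, triangular_zero]
  map_add' x y := by rw [tensorComm_add, triangular_add]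
  map_mul' x y := by rw [tensorComm_mul, triangular_mul]

variable (K S) in
/-- The homomorphism which corresponds to the zero derivation. -/
noncomputable def diagonalHom : S →ₙ+* TriangularAlg K S where
  toFun x := triangular x 0
  map_zero' := triangular_zero
  map_add' x y := by rw [← triangular_add, add_zero]
  map_mul' x y := by rw [triangular_mul, mul_zero, zero_mul, add_zero]

theorem innerHom_apply (ε x : S) : innerHom K ε x = triangular x (tensorComm K ε x) := rfl

theorem diagonalHom_apply (x : S) : diagonalHom K S x = triangular x 0 := rfl

theorem innerHom_smul (ε : S) (c : K) (x : S) : innerHom K ε (c • x) = c • innerHom K ε x := by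
  rw [innerHom_apply, innerHom_apply, tensorComm_smul, triangular_smul]

theorem diagonalHom_smul (c : K) (x : S) : diagonalHom K S (c • x) = c • diagonalHom K S x := by
  rw [diagonalHom_apply, diagonalHom_apply, ← triangular_smul, smul_zero]

theorem diagonalHom_one : diagonalHom K S 1 = 1 := triangular_one

theorem innerHom_eq_diagonalHom {ε x : S} (h : x * ε = ε) (h' : ε * x = ε) :
    innerHom K ε x = diagonalHom K S x := by
  rw [innerHom_apply, tensorComm_of_commute h h', diagonalHom_apply]

end Derivation

/-! ### The derivation and the retractions of the simple gluing algebra. -/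

section SimpleGluing

open PathAlgebra BoundQuiver

variable {K : Type*} [Field K] {VA VB : Type*} [Quiver VA] [Finite VA] [Quiver VB] [Finite VB]
  (a : VA) (b : VB) (IA : TwoSidedIdeal (PathAlgebra K VA)) (IB : TwoSidedIdeal (PathAlgebra K VB))

namespace SimpleGluing

local notation "Λ" => SimpleGluingAlgebra a b IA IB

theorem innerHom_vtx : innerHom K (inclA a b IA IB (vtx IA a)) (inclA a b IA IB (vtx IA a)) =
    diagonalHom K Λ (inclA a b IA IB (vtx IA a)) :=
  innerHom_eq_diagonalHom (by rw [← map_mul, vtx_mul_self]) (by rw [← map_mul, vtx_mul_self])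

theorem innerHom_inclA_one : innerHom K (inclA a b IA IB (vtx IA a)) (inclA a b IA IB 1) =
    diagonalHom K Λ (inclA a b IA IB 1) :=
  innerHom_eq_diagonalHom (by rw [← map_mul, one_mul]) (by rw [← map_mul, mul_one])

/-- The pair of homomorphisms which gives the derivation. -/
noncomputable def derivCocone : Cocone a b IA IB (TriangularAlg K Λ) where
  f := (innerHom K (inclA a b IA IB (vtx IA a))).comp (inclA a b IA IB)
  g := (diagonalHom K Λ).comp (inclB a b IA IB)
  f_smul c x := by
    rw [NonUnitalRingHom.comp_apply, NonUnitalRingHom.comp_apply, inclA_smul, innerHom_smul]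
  g_smul c x := by
    rw [NonUnitalRingHom.comp_apply, NonUnitalRingHom.comp_apply, inclB_smul, diagonalHom_smul]
  eq := by
    rw [NonUnitalRingHom.comp_apply, NonUnitalRingHom.comp_apply, innerHom_vtx, inclB_vtx_eq]
  mulAB := by
    rw [NonUnitalRingHom.comp_apply, NonUnitalRingHom.comp_apply, NonUnitalRingHom.comp_apply,
      innerHom_vtx, innerHom_inclA_one, ← map_mul, inclA_one_mul_inclB_one]
  mulBA := by
    rw [NonUnitalRingHom.comp_apply, NonUnitalRingHom.comp_apply, NonUnitalRingHom.comp_apply,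
      innerHom_vtx, innerHom_inclA_one, ← map_mul, inclB_one_mul_inclA_one]
  add_one := by
    rw [NonUnitalRingHom.comp_apply, NonUnitalRingHom.comp_apply, NonUnitalRingHom.comp_apply,
      innerHom_vtx, innerHom_inclA_one, ← map_add, inclA_one_add_inclB_one, map_add,
      diagonalHom_one]

/-- The derivation which is inner on `A` and zero on `B`. -/
noncomputable def deriv : Λ →ₗ[K] Λ ⊗[K] Λ :=
  TriangularAlg.entry K Λ ∘ₗ (derivCocone a b IA IB).desc.toLinearMap

theorem deriv_eq_of {x : Λ} {w : Λ ⊗[K] Λ} (h : (derivCocone a b IA IB).desc x = triangular x w) :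
    deriv a b IA IB x = w :=
  (congrArg (TriangularAlg.entry K Λ) h).trans (TriangularAlg.entry_triangular x w)

theorem desc_inclA_eq (x : BoundQuiverAlgebra IA) :
    (derivCocone a b IA IB).desc (inclA a b IA IB x) = triangular (inclA a b IA IB x)
      (tensorComm K (inclA a b IA IB (vtx IA a)) (inclA a b IA IB x)) :=
  Cocone.desc_inclA _ x

theorem desc_inclB_eq (x : BoundQuiverAlgebra IB) :
    (derivCocone a b IA IB).desc (inclB a b IA IB x) = triangular (inclB a b IA IB x) 0 :=
  Cocone.desc_inclB _ x

/-- Being triangular with diagonal entry `x` holds on the generators and passes to sums, products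
and scalars; the remaining entry is then read off by `deriv`. -/
theorem desc_eq_triangular (x : Λ) :
    (derivCocone a b IA IB).desc x = triangular x (deriv a b IA IB x) := by
  have h : x ∈ Algebra.adjoin K
      (Set.range (inclA a b IA IB) ∪ Set.range (inclB a b IA IB)) := by
    rw [adjoin_eq]; trivial
  suffices ∃ w, (derivCocone a b IA IB).desc x = triangular x w by
    obtain ⟨w, hw⟩ := this
    rw [deriv_eq_of a b IA IB hw, hw]
  induction h using Algebra.adjoin_induction with
  | mem x hx =>
    rcases hx with ⟨x, rfl⟩ | ⟨x, rfl⟩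
    · exact ⟨_, desc_inclA_eq a b IA IB x⟩
    · exact ⟨_, desc_inclB_eq a b IA IB x⟩
  | algebraMap c =>
    refine ⟨0, ?_⟩
    rw [AlgHom.commutes, Algebra.algebraMap_eq_smul_one, Algebra.algebraMap_eq_smul_one,
      ← triangular_one, ← triangular_smul, smul_zero]
  | add x y _ _ hx hy =>
    obtain ⟨w, hw⟩ := hx
    obtain ⟨w', hw'⟩ := hy
    exact ⟨w + w', by rw [map_add, hw, hw', triangular_add]⟩
  | mul x y _ _ hx hy =>
    obtain ⟨w, hw⟩ := hx
    obtain ⟨w', hw'⟩ := hy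
    exact ⟨_, by rw [map_mul, hw, hw', triangular_mul]⟩

theorem deriv_mul (x y : Λ) : deriv a b IA IB (x * y) =
    (x ⊗ₜ 1) * deriv a b IA IB y + deriv a b IA IB x * (1 ⊗ₜ y) :=
  deriv_eq_of a b IA IB (by
    rw [map_mul, desc_eq_triangular, desc_eq_triangular, triangular_mul])

variable {IA IB} in
/-- The cocone which gives the retraction onto `A`. -/
noncomputable def retractACocone (hB : IsAdmissible IB) :
    Cocone a b IA IB (BoundQuiverAlgebra IA) where
  f := NonUnitalRingHom.id _
  -- `B` is collapsed onto the gluing vertex by its augmentation at `b`.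
  g :=
    { toFun := fun x => aug IB hB b x • vtx IA a
      map_zero' := by rw [map_zero, zero_smul]
      map_add' := fun x y => by rw [map_add, add_smul]
      map_mul' := fun x y => by rw [map_mul, smul_mul_smul_comm, vtx_mul_self] }
  f_smul c x := rfl
  g_smul c x := by
    show aug IB hB b (c • x) • vtx IA a = c • aug IB hB b x • vtx IA a
    rw [map_smul, smul_assoc]
  eq := by
    show aug IB hB b (vtx IB b) • vtx IA a = vtx IA a
    rw [aug_vtx, one_smul]
  mulAB := by
    show 1 * aug IB hB b 1 • vtx IA a = vtx IA a
    rw [map_one, one_smul, one_mul]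
  mulBA := by
    show aug IB hB b 1 • vtx IA a * 1 = vtx IA a
    rw [map_one, one_smul, mul_one]
  add_one := by
    show 1 + aug IB hB b 1 • vtx IA a = 1 + vtx IA a
    rw [map_one, one_smul]

variable {IA IB} in
/-- The cocone which gives the retraction onto `B`. -/
noncomputable def retractBCocone (hA : IsAdmissible IA) :
    Cocone a b IA IB (BoundQuiverAlgebra IB) where
  f :=
    { toFun := fun x => aug IA hA a x • vtx IB b
      map_zero' := by rw [map_zero, zero_smul]
      map_add' := fun x y => by rw [map_add, add_smul]
      map_mul' := fun x y => by rw [map_mul, smul_mul_smul_comm, vtx_mul_self] }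
  g := NonUnitalRingHom.id _
  f_smul c x := by
    show aug IA hA a (c • x) • vtx IB b = c • aug IA hA a x • vtx IB b
    rw [map_smul, smul_assoc]
  g_smul c x := rfl
  eq := by
    show vtx IB b = aug IA hA a (vtx IA a) • vtx IB b
    rw [aug_vtx, one_smul]
  mulAB := by
    show aug IA hA a 1 • vtx IB b * 1 = aug IA hA a (vtx IA a) • vtx IB b
    rw [map_one, aug_vtx, mul_one]
  mulBA := by
    show 1 * aug IA hA a 1 • vtx IB b = aug IA hA a (vtx IA a) • vtx IB b
    rw [map_one, aug_vtx, one_mul]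
  add_one := by
    show aug IA hA a 1 • vtx IB b + 1 = 1 + aug IA hA a (vtx IA a) • vtx IB b
    rw [map_one, aug_vtx, add_comm]

variable {IA IB} in
/-- The simple gluing algebra is glued from the two bound quiver algebras. -/
noncomputable def gluingData (hA : IsAdmissible IA) (hB : IsAdmissible IB) :
    GluingData K (BoundQuiverAlgebra IA) (BoundQuiverAlgebra IB) Λ where
  ιA := inclA a b IA IB
  ιB := inclB a b IA IB
  ιA_smul := inclA_smul a b IA IB
  ιB_smul := inclB_smul a b IA IB
  εA := vtx IA a
  εB := vtx IB b
  ε_eq := inclB_vtx_eq a b IA IB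
  mulAB := inclA_one_mul_inclB_one a b IA IB
  mulBA := inclB_one_mul_inclA_one a b IA IB
  add_one := inclA_one_add_inclB_one a b IA IB
  πA := (retractACocone a b hB).desc
  πB := (retractBCocone a b hA).desc
  πA_ιA x := Cocone.desc_inclA _ x
  πA_ιB x := ⟨aug IB hB b x, Cocone.desc_inclB _ x⟩
  πB_ιB x := Cocone.desc_inclB _ x
  πB_ιA x := ⟨aug IA hA a x, Cocone.desc_inclA _ x⟩
  D := deriv a b IA IB
  D_mul := deriv_mul a b IA IB
  D_ιA x := (deriv_eq_of a b IA IB (desc_inclA_eq a b IA IB x)).trans (tensorComm_eq _ _)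
  D_ιB x := deriv_eq_of a b IA IB (desc_inclB_eq a b IA IB x)
  adjoin_eq := adjoin_eq a b IA IB

end SimpleGluing

end SimpleGluing

theorem corollary3p20 {K : Type*} [Field K] [IsAlgClosed K]
    {VA : Type*} [Quiver VA] [Finite VA] [∀ i j : VA, Finite (i ⟶ j)]
    {VB : Type*} [Quiver VB] [Finite VB] [∀ i j : VB, Finite (i ⟶ j)]
    (a : VA) (b : VB)
    (IA : TwoSidedIdeal (PathAlgebra K VA)) (IB : TwoSidedIdeal (PathAlgebra K VB))
    (hA : PathAlgebra.IsAdmissible IA) (hB : PathAlgebra.IsAdmissible IB)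
    (hfin : Module.Finite K (SimpleGluingAlgebra a b IA IB)) :
    (IsCMFree (SimpleGluingAlgebra a b IA IB) ↔
      IsCMFree (BoundQuiverAlgebra IA) ∧ IsCMFree (BoundQuiverAlgebra IB)) ∧
    (IsCMFinite (SimpleGluingAlgebra a b IA IB) ↔
      IsCMFinite (BoundQuiverAlgebra IA) ∧ IsCMFinite (BoundQuiverAlgebra IB)) :=
  ⟨(SimpleGluing.gluingData a b hA hB).isCMFree_iff,
    (SimpleGluing.gluingData a b hA hB).isCMFinite_iff⟩
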